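/- **Setting.** Let $X$ be a projective, smooth, geometrically connected curve over the finite field $\mathbb F_q$, let $\infty\in X(\mathbb F_q)$, put $A=\Gamma(X\setminus\{\infty\},\mathcal O_X)$ and $|a|=q^{-\mathrm{ord}_\infty(a)}$ for $0\neq a\in A$. Let $\mathfrak p\subset A$ be a maximal ideal, $\hat q=|A/\mathfrak p|$ and $t\in\mathfrak p\setminus\mathfrak p^2$. Let $R$ be a complete discrete valuation ring that is an algebra over the $\mathfrak p$-adic completion of $A$, with structure map $\theta$ and maximal ideal generated by $\pi=\theta(t)$, together with an $A$-algebra endomorphism $\phi$ of $R$ with $\phi(x)\equiv x^{\hat q}\bmod \pi$. Formal schemes over $\mathrm{Spf}\,R$ are identified with their functors of points on $R$-algebras $B$ in which $\pi$ is nilpotent. For an $R$-algebra $B$ let $W_n(B)=B^{n+1}$ be the ring of $\pi$-typical Witt vectors: its functorial ring structure makes the ghost components $w_i=x_0^{\hat q^{\,i}}+\pi x_1^{\hat q^{\,i-1}}+\dots+\pi^i x_i$ ring homomorphisms. It is an $R$-algebra through the functorial map $r\mapsto$ (vector with ghost components $r,\phi(r),\phi^2(r),\dots$). The Frobenius $F:W_{n+1}(B)\to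 W_n(B)$ shifts ghost components and lies over $\phi$. An admissible $A$-module $E$ is $\hat{\mathbb G}_{a}$ over $\mathrm{Spf}\,R$ with an action $\varphi_E$ of $A$ by endomorphisms such that $a$ acts on the tangent space as $\theta(a)$. It is a Drinfeld module of rank $r$ if, for all $0\ne a\in A$, the group scheme $\ker\varphi_E(a)$ is finite flat over $R$ of degree $|a|^r$. Let $J^nE$ be the functor $B\mapsto E(W_n(B))$, let $u:J^nE\to J^{n'}E$ ($n'\le n$) be the truncations, let $\phi:J^{n+1}E\to J^nE$ be induced by $F$, and let $i:N^n\to J^nE$ be the kernel of $u:J^nE\to J^0E=E$. Its points are the Witt vectors $(0,x_1,\dots,x_n)$. Let $\mathbf X_n(E)=\mathrm{Hom}_A(J^nE,\hat{\mathbb G}_a)$, where $A$ acts on $\hat{\mathbb G}_a$ by multiplication through $\theta$. It is an $R$-module. Let $\mathbf X_\infty(E)$ be the colimit of the $\mathbf X_n(E)$ along $u^*$; it is a left module over the twisted polynomial ring $R\{\phi^*\}$ with $\phi^*r=\phi(r)\phi^*$. One says that $E$ splits at $m$ if $\mathbf X_m(E)\neq0$ and $\mathbf X_i(E)=0$ for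 $0\le i<m$; then $m\ge1$. The lateral Frobenius $\mathfrak f:N^{n+1}\to N^n$ ($n\ge1$) is $(0,y)\mapsto(0,F(y))$ for $y\in W_n(B)$. **Theorem.** Let $E$ be a Drinfeld module that splits at $m$. (a) There is a unique $\vartheta_1\in\mathrm{Hom}_A(N^1,\hat{\mathbb G}_a)$ with tangent map $1$ in the coordinate $x_1$. Put $\Psi_i=\vartheta_1\circ\mathfrak f^{\,i-1}\in\mathrm{Hom}_A(N^n,\hat{\mathbb G}_a)$ for $1\le i\le n$, where $N^n$ is first projected to $N^i$ by $u$. There is a unique $\Theta_m\in\mathbf X_m(E)$ such that $$i^*\Theta_m=\Psi_m-\lambda_{m-1}\Psi_{m-1}-\dots-\lambda_1\Psi_1\quad\text{for some }\lambda_1,\dots,\lambda_{m-1}\in R.$$ (b) The $R$-module $\mathbf X_m(E)$ is free of rank $1$ with basis $\Theta_m$. (c) The canonical map $R\{\phi^*\}\otimes_R\mathbf X_m(E)\to\mathbf X_\infty(E)$, $P\otimes\Theta\mapsto P\cdot\Theta$, is an isomorphism. (d) For every $n\ge m$, the $R$-module $\mathbf X_n(E)$ is free with basis $\Theta_m,\phi^*\Theta_m,\dots,(\phi^*)^{n-m}\Theta_m$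 (regarded in $\mathbf X_n(E)$ through $u^*$). (e) For every $n\ge m$, the composition $\mathbf X_n(E)\xrightarrow{\,i^*\,}\mathrm{Hom}_A(N^n,\hat{\mathbb G}_a)\to\mathrm{Hom}_A(N^n,\hat{\mathbb G}_a)/u^*\mathrm{Hom}_A(N^{m-1},\hat{\mathbb G}_a)$ is an isomorphism of $R$-modules. -/

import Mathlib

universe u v

section Curve

open AlgebraicGeometry CategoryTheory

/-- A projective, geometrically connected, smooth curve `X` over the field `k` with a `k`-rational point
`infty`. -/
structure PointedCurve (k : Type v) [Field k] where
  X : Scheme.{v}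
  toSpec : X ⟶ Spec (.of k)
  proper : IsProper toSpec
  smooth : SmoothOfRelativeDimension 1 toSpec
  geomConnected : GeometricallyConnected toSpec
  integral : IsIntegral X
  infty : Spec (.of k) ⟶ X
  infty_toSpec : infty ≫ toSpec = 𝟙 _

namespace PointedCurve
variable {k : Type v} [Field k] (C : PointedCurve k)

attribute [instance] proper smooth geomConnected integral

instance : IsLocallyNoetherian C.X :=
  LocallyOfFiniteType.isLocallyNoetherian C.toSpec

/-- The closed point `∞` of `X`. -/
noncomputable def inftyPt : C.X := C.infty (IsLocalRing.closedPoint k)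

theorem isClosed_infty : IsClosed ({C.inftyPt} : Set C.X) := by
  have h0 : IsClosedImmersion (C.infty ≫ C.toSpec) := by rw [C.infty_toSpec]; infer_instance
  have : IsClosedImmersion C.infty := IsClosedImmersion.of_comp C.infty C.toSpec
  have h : Set.range C.infty = {C.inftyPt} := by
    ext x
    constructor
    · rintro ⟨y, rfl⟩
      have : y = IsLocalRing.closedPoint k := Subsingleton.elim (α := PrimeSpectrum k) _ _
      rw [this]; rfl
    · rintro rfl; exact ⟨_, rfl⟩
  rw [← h]
  exact C.infty.isClosedEmbedding.isClosed_range

/-- The open subscheme `X ∖ {∞}`. -/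
def compl : C.X.Opens := ⟨{C.inftyPt}ᶜ, C.isClosed_infty.isOpen_compl⟩

/-- The coordinate ring of `X ∖ {∞}`. -/
def A : Type v := Γ(C.X, C.compl)

noncomputable instance : CommRing C.A := inferInstanceAs (CommRing Γ(C.X, C.compl))

noncomputable instance : Algebra k C.A :=
  ((Scheme.ΓSpecIso (.of k)).inv ≫ C.toSpec.appLE ⊤ C.compl le_top).hom.toAlgebra

theorem nonempty_compl [Nontrivial C.A] : Nonempty C.compl := by
  by_contra h
  have hb : C.compl = ⊥ := by
    ext x
    simp only [TopologicalSpace.Opens.coe_bot, Set.mem_empty_iff_false, iff_false]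
    exact fun hx => h ⟨⟨x, hx⟩⟩
  have : Subsingleton Γ(C.X, C.compl) := by rw [hb]; infer_instance
  exact not_subsingleton C.A this

/-- The inclusion of `A` in the function field of `X`. -/
noncomputable def toFunctionField [Nontrivial C.A] : C.A →+* C.X.functionField :=
  haveI := C.nonempty_compl
  (C.X.germToFunctionField C.compl).hom

/-- The order of vanishing at `∞`. -/
noncomputable def ordInfty [Nontrivial C.A] (a : C.A) : ℤ :=
  Scheme.ord (C.toFunctionField a) C.inftyPt

/-- The absolute value `|a| = q ^ (-ord_∞ a)` of a nonzero element `a` of `A`, where `k` has `q` elements;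
note that `ord_∞ a ≤ 0`, since `a` is regular away from `∞`. -/
noncomputable def abs [Nontrivial C.A] (a : C.A) : ℕ :=
  Nat.card k ^ (-C.ordInfty a).toNat
end PointedCurve

end Curve

section WittVectors

open Finset

/-- The data on a ring `R` that the Witt vectors depend on: an element `ϖ` that is not a zero divisor, a
power `q` of a prime number that vanishes in `R`, and an endomorphism `φ` of `R` that fixes `ϖ` and lifts
the `q`-power Frobenius of `R / ϖ R`. -/
structure WittBase (R : Type u) [CommRing R] where
  q : ℕ
  ϖ : R
  φ : R →+* R
  q_eq : ∃ p e : ℕ, p.Prime ∧ e ≠ 0 ∧ q = p ^ e ∧ (p : R) = 0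
  torsionFree : ∀ x : R, ϖ * x = 0 → x = 0
  φ_ϖ : φ ϖ = ϖ
  φ_frob : ∀ x : R, ϖ ∣ φ x - x ^ q

namespace WittBase

variable {R : Type u} [CommRing R] (W : WittBase R)

theorem one_lt_q : 1 < W.q := by
  obtain ⟨p, e, hp, he, hq, -⟩ := W.q_eq
  rw [hq]; exact Nat.one_lt_pow he hp.one_lt

theorem lt_q_pow (i : ℕ) : i < W.q ^ i := Nat.lt_pow_self W.one_lt_q

theorem add_pow {B : Type*} [CommRing B] (ρ : R →+* B) (x y : B) (i : ℕ) :
    (x + y) ^ W.q ^ i = x ^ W.q ^ i + y ^ W.q ^ i := by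
  obtain ⟨p, e, hp, -, hq, h0⟩ := W.q_eq
  have hB : (p : B) = 0 := by rw [← map_natCast ρ, h0, map_zero]
  rw [hq, ← pow_mul, add_pow_prime_pow_eq hp, hB]; simp

theorem neg_pow {B : Type*} [CommRing B] (ρ : R →+* B) (x : B) (i : ℕ) :
    (-x) ^ W.q ^ i = - x ^ W.q ^ i := by
  have h := W.add_pow ρ x (-x) i
  rw [add_neg_cancel, zero_pow (Nat.ne_of_gt (Nat.pos_of_ne_zero
    (pow_ne_zero _ (by have := W.one_lt_q; omega))))] at h
  exact (neg_eq_of_add_eq_zero_right h.symm).symm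

theorem sub_pow {B : Type*} [CommRing B] (ρ : R →+* B) (x y : B) (i : ℕ) :
    (x - y) ^ W.q ^ i = x ^ W.q ^ i - y ^ W.q ^ i := by
  rw [sub_eq_add_neg, W.add_pow ρ, W.neg_pow ρ, sub_eq_add_neg]

/-- The `i`-th Witt polynomial `w_i = x_0 ^ (q ^ i) + ϖ x_1 ^ (q ^ (i - 1)) + ⋯ + ϖ ^ i x_i`. -/
def gh {B : Type*} [CommRing B] (ρ : R →+* B) (x : ℕ → B) (i : ℕ) : B :=
  ∑ j ∈ range (i + 1), ρ W.ϖ ^ j * x j ^ W.q ^ (i - j)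

section Dwork

variable {P : Type*} [CommRing P] (ρ : R →+* P) (ψ : P →+* P)

theorem gh_frob (hψ : ψ (ρ W.ϖ) = ρ W.ϖ) (hF : ∀ x, ρ W.ϖ ∣ ψ x - x ^ W.q) (x : ℕ → P) (i : ℕ) :
    ρ W.ϖ ^ (i + 1) ∣ ψ (W.gh ρ x i) - W.gh ρ x (i + 1) := by
  have h1 : ψ (W.gh ρ x i) - W.gh ρ x (i + 1) =
      (∑ j ∈ range (i + 1), ρ W.ϖ ^ j * (ψ (x j) - x j ^ W.q) ^ W.q ^ (i - j))
        - ρ W.ϖ ^ (i + 1) * x (i + 1) := by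
    rw [gh, gh, sum_range_succ _ (i + 1), map_sum, Nat.sub_self, pow_zero, pow_one, ← sub_sub,
      ← sum_sub_distrib]
    congr 1
    refine sum_congr rfl fun j hj => ?_
    have hj' : j ≤ i := by simpa [Nat.lt_succ_iff] using hj
    rw [W.sub_pow ρ, map_mul, map_pow, map_pow, hψ, ← mul_sub, ← pow_mul, ← pow_succ',
      Nat.succ_sub hj']
  rw [h1]
  refine dvd_sub (dvd_sum fun j hj => ?_) (dvd_mul_right _ _)
  have hj' : j ≤ i := by simpa [Nat.lt_succ_iff] using hj
  have h2 : ρ W.ϖ ^ W.q ^ (i - j) ∣ (ψ (x j) - x j ^ W.q) ^ W.q ^ (i - j) := pow_dvd_pow_of_dvd (hF _) _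
  refine dvd_trans ?_ (mul_dvd_mul_left _ h2)
  rw [← pow_add]
  exact pow_dvd_pow _ (by have := W.lt_q_pow (i - j); omega)

theorem dwork (hψ : ψ (ρ W.ϖ) = ρ W.ϖ) (hF : ∀ x, ρ W.ϖ ∣ ψ x - x ^ W.q) (z : ℕ → P)
    (hz : ∀ i, ρ W.ϖ ^ (i + 1) ∣ ψ (z i) - z (i + 1)) (n : ℕ) :
    ∃ x : ℕ → P, ∀ i < n, W.gh ρ x i = z i := by
  induction n with
  | zero => exact ⟨0, by simp⟩
  | succ n ih =>
    obtain ⟨x, hx⟩ := ih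
    have key : ρ W.ϖ ^ n ∣ z n - ∑ j ∈ range n, ρ W.ϖ ^ j * x j ^ W.q ^ (n - j) := by
      cases n with
      | zero => simp
      | succ n =>
        have h1 := W.gh_frob ρ ψ hψ hF x n
        rw [hx n (Nat.lt_succ_self n), gh, sum_range_succ] at h1
        have h2 := hz n
        have h3 := dvd_sub h1 h2
        have h4 := dvd_add h3 (dvd_mul_right (ρ W.ϖ ^ (n + 1)) (x (n + 1)))
        convert h4 using 1
        simp; ring
    obtain ⟨y, hy⟩ := key
    refine ⟨Function.update x n y, fun i hi => ?_⟩
    have hc : ∀ m ≤ n, ∑ j ∈ range m, ρ W.ϖ ^ j * Function.update x n y j ^ W.q ^ (i - j) =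
        ∑ j ∈ range m, ρ W.ϖ ^ j * x j ^ W.q ^ (i - j) := fun m hm =>
      sum_congr rfl fun j hj => by
        rw [Function.update_of_ne (by have := mem_range.1 hj; omega)]
    rcases Nat.lt_succ_iff_lt_or_eq.1 hi with h | rfl
    · rw [← hx i h, gh, gh, hc _ h]
    · rw [gh, sum_range_succ, hc _ le_rfl]
      simp [← hy]

end Dwork

/-- The truncated Witt vectors `W_n(B) = B ^ (n + 1)` of the `R`-algebra `B` with structure map `ρ`. -/
@[ext] structure Witt (W : WittBase R) (n : ℕ) {B : Type*} [CommRing B] (ρ : R →+* B) where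
  coeff : Fin (n + 1) → B

namespace Witt

variable {W} {n : ℕ} {B : Type*} [CommRing B] {ρ : R →+* B}

/-- The `i`-th ghost component of a Witt vector. The ring structure below is the functorial one for which
all of these are ring homomorphisms `W_n(B) → B`. -/
def ghost (W : WittBase R) {n : ℕ} {B : Type*} [CommRing B] {ρ : R →+* B} (x : W.Witt n ρ) (i : Fin (n + 1)) : B :=
  ∑ j ∈ Iic i, ρ W.ϖ ^ (j : ℕ) * x.coeff j ^ W.q ^ (i - j : ℕ)

theorem ghost_eq_gh (x : W.Witt n ρ) (y : ℕ → B) (h : ∀ j : Fin (n + 1), x.coeff j = y j)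
    (i : Fin (n + 1)) : ghost W x i = W.gh ρ y i := by
  rw [ghost, gh]
  refine sum_bij (fun j _ => (j : ℕ)) (fun j hj => ?_) (fun j _ k _ => Fin.ext) (fun j hj => ?_)
    (fun j hj => by rw [h])
  · have : j ≤ i := by simpa using hj
    simp [this]
  · have : j < i + 1 := by simpa using hj
    exact ⟨⟨j, by omega⟩, by simp [Fin.le_def]; omega, rfl⟩

theorem ghost_last (x : W.Witt n ρ) (i : Fin (n + 1)) : ghost W x i =
    (∑ j ∈ Iio i, ρ W.ϖ ^ (j : ℕ) * x.coeff j ^ W.q ^ (i - j : ℕ)) + ρ W.ϖ ^ (i : ℕ) * x.coeff i := by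
  rw [ghost, ← Iio_insert, sum_insert (by simp), add_comm]; simp

theorem ghost_zero_index (x : W.Witt n ρ) : ghost W x 0 = x.coeff 0 := by
  rw [ghost_last, sum_eq_zero (fun j hj => absurd (mem_Iio.1 hj) (Fin.not_lt_zero j))]
  simp

theorem ghost_injective (hB : ∀ x : B, ρ W.ϖ * x = 0 → x = 0) {x y : W.Witt n ρ}
    (h : ∀ i, ghost W x i = ghost W y i) : x = y := by
  have hpow : ∀ k : ℕ, ∀ b : B, ρ W.ϖ ^ k * b = 0 → b = 0 := by
    intro k
    induction k with
    | zero => simp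
    | succ k ih => intro b hb; exact hB _ (ih _ (by rw [← mul_assoc, ← pow_succ]; exact hb))
  have key : ∀ m : ℕ, ∀ i : Fin (n + 1), (i : ℕ) = m → x.coeff i = y.coeff i := by
    intro m
    induction m using Nat.strong_induction_on with
    | _ m ih =>
      intro i hi
      have h1 := h i
      rw [ghost_last, ghost_last, sum_congr rfl (fun j hj => by
        rw [ih j (by have : j < i := by simpa using hj
                     omega) j rfl])] at h1
      have h2 := add_left_cancel h1
      exact sub_eq_zero.1 (hpow _ _ (by rw [mul_sub, h2, sub_self]))
  ext i
  exact key i i rfl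

instance : Zero (W.Witt n ρ) := ⟨⟨0⟩⟩
instance : Add (W.Witt n ρ) := ⟨fun x y => ⟨x.coeff + y.coeff⟩⟩
instance : Neg (W.Witt n ρ) := ⟨fun x => ⟨-x.coeff⟩⟩
instance : Sub (W.Witt n ρ) := ⟨fun x y => ⟨x.coeff - y.coeff⟩⟩
instance : SMul ℕ (W.Witt n ρ) := ⟨fun m x => ⟨m • x.coeff⟩⟩
instance : SMul ℤ (W.Witt n ρ) := ⟨fun m x => ⟨m • x.coeff⟩⟩
instance : One (W.Witt n ρ) := ⟨⟨fun i => if i = 0 then 1 else 0⟩⟩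

theorem coeff_injective : Function.Injective (coeff : W.Witt n ρ → Fin (n + 1) → B) :=
  fun _ _ => Witt.ext

instance : AddCommGroup (W.Witt n ρ) :=
  coeff_injective.addCommGroup _ rfl (fun _ _ => rfl) (fun _ => rfl) (fun _ _ => rfl)
    (fun _ _ => rfl) (fun _ _ => rfl)

@[simp] theorem coeff_zero : (0 : W.Witt n ρ).coeff = 0 := rfl
@[simp] theorem coeff_add (x y : W.Witt n ρ) : (x + y).coeff = x.coeff + y.coeff := rfl

theorem ghost_add (x y : W.Witt n ρ) (i : Fin (n + 1)) :
    ghost W (x + y) i = ghost W x i + ghost W y i := by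
  simp only [ghost, coeff_add, Pi.add_apply, W.add_pow ρ, mul_add, sum_add_distrib]

theorem ghost_zero (i : Fin (n + 1)) : ghost W (0 : W.Witt n ρ) i = 0 := by
  have h := ghost_add (0 : W.Witt n ρ) 0 i
  rw [add_zero] at h
  exact left_eq_add.1 h

theorem ghost_one (i : Fin (n + 1)) : ghost W (1 : W.Witt n ρ) i = 1 := by
  rw [ghost, sum_eq_single 0]
  · change ρ W.ϖ ^ 0 * (if (0 : Fin (n + 1)) = 0 then 1 else 0) ^ _ = _
    simp
  · intro j _ hj
    change _ * (if j = 0 then (1 : B) else 0) ^ _ = _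
    rw [if_neg hj, zero_pow (pow_ne_zero _ (by have := W.one_lt_q; omega)), mul_zero]
  · simp

/-- The map `W_n(B) → W_n(C)` applying `f` to every component. -/
def mapFun {C : Type*} [CommRing C] {σ : R →+* C} (f : B →+* C) (x : W.Witt n ρ) : W.Witt n σ :=
  ⟨fun i => f (x.coeff i)⟩

theorem ghost_mapFun {C : Type*} [CommRing C] {σ : R →+* C} (f : B →+* C) (hf : f.comp ρ = σ)
    (x : W.Witt n ρ) (i : Fin (n + 1)) :
    ghost W (mapFun f x : W.Witt n σ) i = f (ghost W x i) := by
  subst hf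
  simp [ghost, mapFun]

end Witt

section Universal

open MvPolynomial

variable (σ : Type*)

/-- The Frobenius lift on a polynomial ring: `φ` on constants, and the `q`-th power on variables. -/
noncomputable def polyFrob : MvPolynomial σ R →+* MvPolynomial σ R :=
  eval₂Hom (C.comp W.φ) (fun i => X i ^ W.q)

theorem polyFrob_C (r : R) : W.polyFrob σ (C r) = C (W.φ r) := by simp [polyFrob]

theorem polyFrob_frob (f : MvPolynomial σ R) :
    (C W.ϖ : MvPolynomial σ R) ∣ W.polyFrob σ f - f ^ W.q := by
  induction f using MvPolynomial.induction_on with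
  | C a =>
    rw [polyFrob_C, ← C_pow, ← C_sub]
    exact map_dvd C (W.φ_frob a)
  | add f g hf hg =>
    have := W.add_pow (C : R →+* MvPolynomial σ R) f g 1
    rw [pow_one] at this
    rw [map_add, this, add_sub_add_comm]
    exact dvd_add hf hg
  | mul_X f i hf =>
    have : W.polyFrob σ (X i) = X i ^ W.q := by simp [polyFrob]
    rw [map_mul, this, mul_pow, ← sub_mul]
    exact dvd_mul_of_dvd_left hf _

theorem poly_torsionFree (f : MvPolynomial σ R) (h : C W.ϖ * f = 0) : f = 0 := by
  ext m
  have := congrArg (coeff m) h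
  rw [coeff_C_mul, coeff_zero] at this
  simpa using W.torsionFree _ this

variable {σ}

theorem poly_dwork (n : ℕ) (z : ℕ → MvPolynomial σ R)
    (hz : ∀ i, (C W.ϖ) ^ (i + 1) ∣ W.polyFrob σ (z i) - z (i + 1)) :
    ∃ x : W.Witt n (C : R →+* MvPolynomial σ R), ∀ i, Witt.ghost W x i = z i := by
  obtain ⟨x, hx⟩ := W.dwork C (W.polyFrob σ) (by rw [polyFrob_C, W.φ_ϖ]) (W.polyFrob_frob σ) z hz
    (n + 1)
  exact ⟨⟨fun i => x i⟩, fun i => by rw [Witt.ghost_eq_gh _ x (fun _ => rfl), hx _ i.2]⟩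

theorem poly_dwork_gh (x : ℕ → MvPolynomial σ R) (i : ℕ) :
    (C W.ϖ) ^ (i + 1) ∣ W.polyFrob σ (W.gh C x i) - W.gh C x (i + 1) :=
  W.gh_frob C (W.polyFrob σ) (by rw [polyFrob_C, W.φ_ϖ]) (W.polyFrob_frob σ) x i

/-- The sequence of variables indexed by `g`, extended by zero. -/
noncomputable def genericSeq (n : ℕ) (g : Fin (n + 1) → σ) (i : ℕ) : MvPolynomial σ R :=
  if h : i < n + 1 then X (g ⟨i, h⟩) else 0

theorem exists_mulPoly (n : ℕ) :
    ∃ m : W.Witt n (C : R →+* MvPolynomial (Fin (n + 1) ⊕ Fin (n + 1)) R), ∀ i,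
      Witt.ghost W m i = Witt.ghost W (⟨fun j => X (Sum.inl j)⟩ : W.Witt n C) i *
        Witt.ghost W (⟨fun j => X (Sum.inr j)⟩ : W.Witt n C) i := by
  have hl := W.poly_dwork_gh (genericSeq (R := R) n (Sum.inl : _ → Fin (n + 1) ⊕ Fin (n + 1)))
  have hr := W.poly_dwork_gh (genericSeq (R := R) n (Sum.inr : _ → Fin (n + 1) ⊕ Fin (n + 1)))
  obtain ⟨m, hm⟩ := W.poly_dwork n (fun i =>
    W.gh C (genericSeq n (Sum.inl : _ → Fin (n + 1) ⊕ Fin (n + 1))) i *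
      W.gh C (genericSeq n (Sum.inr : _ → Fin (n + 1) ⊕ Fin (n + 1))) i) (fun i => by
    have := dvd_add (dvd_mul_of_dvd_left (hl i) (W.polyFrob _
        (W.gh C (genericSeq n (Sum.inr : _ → Fin (n + 1) ⊕ Fin (n + 1))) i)))
      (dvd_mul_of_dvd_right (hr i)
        (W.gh C (genericSeq n (Sum.inl : _ → Fin (n + 1) ⊕ Fin (n + 1))) (i + 1)))
    convert this using 1
    rw [map_mul]; ring)
  refine ⟨m, fun i => ?_⟩
  rw [hm, Witt.ghost_eq_gh _ (genericSeq n Sum.inl) (fun j => by rw [genericSeq, dif_pos j.2]),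
    Witt.ghost_eq_gh _ (genericSeq n Sum.inr) (fun j => by rw [genericSeq, dif_pos j.2])]

theorem exists_frobPoly (n : ℕ) :
    ∃ m : W.Witt n (C : R →+* MvPolynomial (Fin (n + 2)) R), ∀ i,
      Witt.ghost W m i = Witt.ghost W (⟨fun j => X j⟩ : W.Witt (n + 1) C) i.succ := by
  have h := W.poly_dwork_gh (genericSeq (R := R) (n + 1) (id : _ → Fin (n + 2)))
  obtain ⟨m, hm⟩ := W.poly_dwork n (fun i => W.gh C (genericSeq (n + 1) (id : _ → Fin (n + 2))) (i + 1))
    (fun i => (pow_dvd_pow _ (Nat.le_succ _)).trans (h (i + 1)))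
  refine ⟨m, fun i => ?_⟩
  rw [hm, Witt.ghost_eq_gh _ (genericSeq (n + 1) id) (fun j => by rw [genericSeq, dif_pos j.2]; rfl)]
  simp

theorem exists_const (n : ℕ) (r : R) :
    ∃ x : W.Witt n (RingHom.id R), ∀ i, Witt.ghost W x i = (W.φ^[i]) r := by
  obtain ⟨x, hx⟩ := W.dwork (RingHom.id R) W.φ W.φ_ϖ W.φ_frob (fun i => (W.φ^[i]) r)
    (fun i => by simp [Function.iterate_succ_apply']) (n + 1)
  exact ⟨⟨fun i => x i⟩, fun i => by rw [Witt.ghost_eq_gh _ x (fun _ => rfl), hx _ i.2]⟩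

end Universal

namespace Witt

open MvPolynomial

variable {W} {n : ℕ} {B : Type*} [CommRing B] {ρ : R →+* B}

noncomputable instance : Mul (W.Witt n ρ) :=
  ⟨fun x y => ⟨fun i => eval₂ ρ (Sum.elim x.coeff y.coeff) ((W.exists_mulPoly n).choose.coeff i)⟩⟩

theorem ghost_mul (x y : W.Witt n ρ) (i : Fin (n + 1)) :
    ghost W (x * y) i = ghost W x i * ghost W y i := by
  have h := congrArg (eval₂Hom ρ (Sum.elim x.coeff y.coeff)) ((W.exists_mulPoly n).choose_spec i)
  have hc : (eval₂Hom ρ (Sum.elim x.coeff y.coeff)).comp C = ρ := by ext; simp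
  rw [map_mul, ← ghost_mapFun _ hc, ← ghost_mapFun _ hc, ← ghost_mapFun _ hc] at h
  have hx : (mapFun (eval₂Hom ρ (Sum.elim x.coeff y.coeff)) (⟨fun j => X (Sum.inl j)⟩ : W.Witt n C) :
      W.Witt n ρ) = x := by ext; simp [mapFun]
  have hy : (mapFun (eval₂Hom ρ (Sum.elim x.coeff y.coeff)) (⟨fun j => X (Sum.inr j)⟩ : W.Witt n C) :
      W.Witt n ρ) = y := by ext; simp [mapFun]
  rw [hx, hy] at h
  exact h

theorem mapFun_mul {C : Type*} [CommRing C] {σ : R →+* C} (f : B →+* C) (hf : f.comp ρ = σ)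
    (x y : W.Witt n ρ) : (mapFun f (x * y) : W.Witt n σ) = mapFun f x * mapFun f y := by
  subst hf
  ext i
  change f (eval₂ ρ _ _) = eval₂ (f.comp ρ) _ _
  rw [hom_eval₂]
  congr 1
  ext (j | j) <;> rfl

theorem mapFun_add {C : Type*} [CommRing C] {σ : R →+* C} (f : B →+* C)
    (x y : W.Witt n ρ) : (mapFun f (x + y) : W.Witt n σ) = mapFun f x + mapFun f y := by
  ext i; simp [mapFun]

theorem mapFun_one {C : Type*} [CommRing C] {σ : R →+* C} (f : B →+* C) :
    (mapFun f (1 : W.Witt n ρ) : W.Witt n σ) = 1 := by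
  ext i
  change f (if i = 0 then 1 else 0) = if i = 0 then 1 else 0
  split_ifs <;> simp

/-- The surjection onto `B` from the polynomial ring on the set `B`. -/
noncomputable abbrev cover (ρ : R →+* B) : MvPolynomial B R →+* B := eval₂Hom ρ id

theorem cover_comp : (cover ρ).comp C = ρ := by ext; simp

theorem exists_lift (x : W.Witt n ρ) :
    ∃ y : W.Witt n (C : R →+* MvPolynomial B R), mapFun (cover ρ) y = x :=
  ⟨⟨fun i => X (x.coeff i)⟩, by ext; simp [mapFun]⟩

theorem poly_ghost_injective {σ : Type*} {x y : W.Witt n (C : R →+* MvPolynomial σ R)}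
    (h : ∀ i, ghost W x i = ghost W y i) : x = y :=
  ghost_injective (W.poly_torsionFree σ) h

theorem mul_comm' (x y : W.Witt n ρ) : x * y = y * x := by
  obtain ⟨x, rfl⟩ := exists_lift x
  obtain ⟨y, rfl⟩ := exists_lift y
  rw [← mapFun_mul _ cover_comp, ← mapFun_mul _ cover_comp]
  congr 1
  exact poly_ghost_injective fun i => by simp only [ghost_mul]; ring

theorem mul_assoc' (x y z : W.Witt n ρ) : x * y * z = x * (y * z) := by
  obtain ⟨x, rfl⟩ := exists_lift x
  obtain ⟨y, rfl⟩ := exists_lift y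
  obtain ⟨z, rfl⟩ := exists_lift z
  simp only [← mapFun_mul _ cover_comp]
  congr 1
  exact poly_ghost_injective fun i => by simp only [ghost_mul]; ring

theorem one_mul' (x : W.Witt n ρ) : 1 * x = x := by
  obtain ⟨x, rfl⟩ := exists_lift x
  rw [← mapFun_one (cover ρ), ← mapFun_mul _ cover_comp]
  congr 1
  exact poly_ghost_injective fun i => by simp only [ghost_mul, ghost_one]; ring

theorem mul_add' (x y z : W.Witt n ρ) : x * (y + z) = x * y + x * z := by
  obtain ⟨x, rfl⟩ := exists_lift x
  obtain ⟨y, rfl⟩ := exists_lift y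
  obtain ⟨z, rfl⟩ := exists_lift z
  simp only [← mapFun_mul _ cover_comp, ← mapFun_add]
  congr 1
  exact poly_ghost_injective fun i => by simp only [ghost_mul, ghost_add]; ring

noncomputable instance : CommRing (W.Witt n ρ) :=
  { (inferInstance : AddCommGroup (W.Witt n ρ)) with
    mul := (· * ·)
    one := 1
    mul_comm := mul_comm'
    mul_assoc := mul_assoc'
    one_mul := one_mul'
    mul_one := fun x => by rw [mul_comm', one_mul']
    left_distrib := mul_add'
    right_distrib := fun x y z => by rw [mul_comm', mul_add', mul_comm' z, mul_comm' z]
    zero_mul := fun x => by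
      have h := mul_add' x 0 0
      rw [add_zero] at h
      rw [mul_comm']
      exact left_eq_add.1 h
    mul_zero := fun x => by
      have h := mul_add' x 0 0
      rw [add_zero] at h
      exact left_eq_add.1 h }

/-- The ring homomorphism `W_n(B) → W_n(C)` applying `f` to every component. -/
noncomputable def map {C : Type*} [CommRing C] {σ : R →+* C} (f : B →+* C) (hf : f.comp ρ = σ) :
    W.Witt n ρ →+* W.Witt n σ where
  toFun := mapFun f
  map_one' := mapFun_one f
  map_mul' := mapFun_mul f hf
  map_zero' := by ext; simp [mapFun]
  map_add' := mapFun_add f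

/-- The ring homomorphism `R → W_n(R)` with ghost components `r, φ r, φ (φ r), …`. -/
noncomputable def const (W : WittBase R) (n : ℕ) : R →+* W.Witt n (RingHom.id R) where
  toFun r := (W.exists_const n r).choose
  map_one' := ghost_injective W.torsionFree fun i => by
    rw [(W.exists_const n _).choose_spec, ghost_one, ← RingHom.coe_pow, map_one]
  map_mul' r s := ghost_injective W.torsionFree fun i => by
    rw [ghost_mul, (W.exists_const n _).choose_spec, (W.exists_const n _).choose_spec,
      (W.exists_const n _).choose_spec, ← RingHom.coe_pow, map_mul]
  map_zero' := ghost_injective W.torsionFree fun i => by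
    rw [(W.exists_const n _).choose_spec, ghost_zero, ← RingHom.coe_pow, map_zero]
  map_add' r s := ghost_injective W.torsionFree fun i => by
    rw [ghost_add, (W.exists_const n _).choose_spec, (W.exists_const n _).choose_spec,
      (W.exists_const n _).choose_spec, ← RingHom.coe_pow, map_add]

theorem ghost_const (r : R) (i : Fin (n + 1)) : ghost W (const W n r) i = (W.φ^[i]) r :=
  (W.exists_const n r).choose_spec i

/-- The `R`-algebra structure of `W_n(B)`, given by `R → W_n(R) → W_n(B)`. -/
noncomputable def str (W : WittBase R) (n : ℕ) {B : Type*} [CommRing B] (ρ : R →+* B) :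
    R →+* W.Witt n ρ :=
  (map ρ (RingHom.comp_id ρ)).comp (const W n)

theorem map_comp_str {C : Type*} [CommRing C] {σ : R →+* C} (f : B →+* C) (hf : f.comp ρ = σ) :
    (map f hf).comp (str W n ρ) = str W n σ := by
  subst hf; ext r i; rfl


theorem const_pow_dvd (N M : ℕ) (hM : N + n ≤ M) (i : Fin (n + 1)) :
    W.ϖ ^ N ∣ (const W n (W.ϖ ^ M)).coeff i := by
  have hcancel : ∀ (k : ℕ) (b : R), W.ϖ ^ k * b = 0 → b = 0 := by
    intro k
    induction k with
    | zero => simp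
    | succ k ih => intro b hb; exact W.torsionFree _ (ih _ (by rw [← mul_assoc, ← pow_succ]; exact hb))
  have key : ∀ m : ℕ, ∀ i : Fin (n + 1), (i : ℕ) = m →
      W.ϖ ^ (M - i) ∣ (const W n (W.ϖ ^ M)).coeff i := by
    intro m
    induction m using Nat.strong_induction_on with
    | _ m ih =>
      intro i hi
      have h1 := ghost_const (W := W) (n := n) (W.ϖ ^ M) i
      have hfix : (W.φ^[i]) (W.ϖ ^ M) = W.ϖ ^ M := Function.iterate_fixed (by rw [map_pow, W.φ_ϖ]) _
      rw [hfix, ghost_last] at h1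
      have h2 : W.ϖ ^ M ∣ ∑ j ∈ Iio i, (RingHom.id R) W.ϖ ^ (j : ℕ) *
          (const W n (W.ϖ ^ M)).coeff j ^ W.q ^ (i - j : ℕ) := by
        refine dvd_sum fun j hj => ?_
        have hj' : j < i := by simpa using hj
        have h3 := ih j (by omega) j rfl
        have h4 : W.ϖ ^ (M - j) ∣ (const W n (W.ϖ ^ M)).coeff j ^ W.q ^ (i - j : ℕ) :=
          h3.trans (dvd_pow_self _ (by have := W.lt_q_pow (i - j : ℕ); omega))
        refine dvd_trans ?_ (mul_dvd_mul_left _ h4)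
        rw [RingHom.id_apply, ← pow_add]
        exact pow_dvd_pow _ (by omega)
      have h5 : W.ϖ ^ M ∣ W.ϖ ^ (i : ℕ) * (const W n (W.ϖ ^ M)).coeff i := by
        have := dvd_sub (dvd_refl (W.ϖ ^ M)) h2
        rwa [sub_eq_of_eq_add' h1.symm] at this
      obtain ⟨c, hc⟩ := h5
      refine ⟨c, sub_eq_zero.1 (hcancel i _ ?_)⟩
      rw [mul_sub, hc, ← mul_assoc, ← pow_add, Nat.add_sub_cancel' (by omega), sub_self]
  exact (pow_dvd_pow _ (by omega)).trans (key i i rfl)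

theorem isNilpotent_str (h : IsNilpotent (ρ W.ϖ)) : IsNilpotent (str W n ρ W.ϖ) := by
  obtain ⟨N, hN⟩ := h
  refine ⟨N + n, ?_⟩
  rw [← map_pow]
  ext i
  change ρ ((const W n (W.ϖ ^ (N + n))).coeff i) = 0
  obtain ⟨c, hc⟩ := const_pow_dvd (W := W) (n := n) N (N + n) le_rfl i
  rw [hc, map_mul, map_pow, hN, zero_mul]

/-- The first `m + 1` components of a Witt vector. -/
def truncFun {m n : ℕ} (h : m ≤ n) {B : Type*} [CommRing B] {ρ : R →+* B} (x : W.Witt n ρ) :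
    W.Witt m ρ :=
  ⟨fun i => x.coeff (Fin.castLE (Nat.succ_le_succ h) i)⟩

theorem ghost_truncFun {m n : ℕ} (h : m ≤ n) (x : W.Witt n ρ) (i : Fin (m + 1)) :
    ghost W (truncFun h x) i = ghost W x (Fin.castLE (Nat.succ_le_succ h) i) := by
  rw [ghost_eq_gh (truncFun h x) (fun j => if hj : j < n + 1 then x.coeff ⟨j, hj⟩ else 0),
    ghost_eq_gh x (fun j => if hj : j < n + 1 then x.coeff ⟨j, hj⟩ else 0)]
  · rfl
  · intro j; rw [dif_pos j.2]
  · intro j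
    rw [dif_pos (by omega)]; rfl

/-- The truncation `W_n(B) → W_m(B)`. -/
noncomputable def trunc {m n : ℕ} (h : m ≤ n) : W.Witt n ρ →+* W.Witt m ρ where
  toFun := truncFun h
  map_one' := by
    ext i
    change (if Fin.castLE (Nat.succ_le_succ h) i = 0 then (1 : B) else 0) = if i = 0 then 1 else 0
    simp only [Fin.ext_iff, Fin.val_castLE, Fin.val_zero]
  map_mul' x y := by
    obtain ⟨x, rfl⟩ := exists_lift x
    obtain ⟨y, rfl⟩ := exists_lift y
    rw [← mapFun_mul _ cover_comp]
    change mapFun (cover ρ) (truncFun h (x * y)) =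
      mapFun (cover ρ) (truncFun h x) * mapFun (cover ρ) (truncFun h y)
    rw [← mapFun_mul _ cover_comp]
    congr 1
    exact poly_ghost_injective fun i => by simp only [ghost_mul, ghost_truncFun]
  map_zero' := rfl
  map_add' _ _ := rfl

theorem trunc_comp_str {m n : ℕ} (h : m ≤ n) :
    (trunc h).comp (str W n ρ) = str W m ρ := by
  have : (trunc h).comp (const W n) = const W m := by
    ext r : 1
    refine ghost_injective W.torsionFree fun i => ?_
    change ghost W (truncFun h _) i = _
    rw [ghost_truncFun, ghost_const, ghost_const]; rfl
  ext r : 1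
  change mapFun ρ ((trunc h).comp (const W n) r) = mapFun ρ (const W m r)
  rw [this]

/-- The zeroth component `W_n(B) → B`. -/
noncomputable def head : W.Witt n ρ →+* B where
  toFun x := x.coeff 0
  map_one' := rfl
  map_mul' x y := by
    have h := ghost_mul x y 0
    simpa only [ghost_zero_index] using h
  map_zero' := rfl
  map_add' _ _ := rfl

theorem head_comp_str : (head).comp (str W n ρ) = ρ := by
  ext r
  have h := ghost_const (W := W) (n := n) r 0
  rw [ghost_zero_index] at h
  exact congrArg ρ h

/-- The underlying map of the Frobenius, which shifts the ghost components. -/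
noncomputable def frobFun (x : W.Witt (n + 1) ρ) : W.Witt n (ρ.comp W.φ) :=
  ⟨fun i => eval₂ ρ x.coeff ((W.exists_frobPoly n).choose.coeff i)⟩

theorem ghost_frobFun (x : W.Witt (n + 1) ρ) (i : Fin (n + 1)) :
    ghost W (frobFun x) i = ghost W x i.succ := by
  have h := congrArg (eval₂Hom ρ x.coeff) ((W.exists_frobPoly n).choose_spec i)
  have hc : (eval₂Hom ρ x.coeff).comp C = ρ := by ext; simp
  rw [← ghost_mapFun _ hc, ← ghost_mapFun _ hc] at h
  have hx : (mapFun (eval₂Hom ρ x.coeff) (⟨fun j => X j⟩ : W.Witt (n + 1) C) : W.Witt (n + 1) ρ) = x := by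
    ext; simp [mapFun]
  rw [hx] at h
  rw [← h, ghost, ghost, RingHom.comp_apply, W.φ_ϖ]
  rfl

theorem mapFun_frobFun {C : Type*} [CommRing C] {σ : R →+* C} (f : B →+* C) (hf : f.comp ρ = σ)
    (x : W.Witt (n + 1) ρ) :
    (mapFun f (frobFun x) : W.Witt n (σ.comp W.φ)) = frobFun (mapFun f x : W.Witt (n + 1) σ) := by
  subst hf
  ext i
  change f (eval₂ ρ _ _) = eval₂ (f.comp ρ) _ _
  rw [hom_eval₂]
  rfl

theorem twist_ghost_injective {σ : Type*}
    {x y : W.Witt n ((C : R →+* MvPolynomial σ R).comp W.φ)}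
    (h : ∀ i, ghost W x i = ghost W y i) : x = y :=
  ghost_injective (fun f hf => W.poly_torsionFree σ f (by rwa [RingHom.comp_apply, W.φ_ϖ] at hf)) h

theorem cover_comp_twist : (cover ρ).comp ((C : R →+* MvPolynomial B R).comp W.φ) = ρ.comp W.φ := by
  rw [← RingHom.comp_assoc, cover_comp]

/-- The Frobenius `W_{n+1}(B) → W_n(B)`, which shifts the ghost components. As the ghost components of the
image of `r` in `W_n(B)` are `r, φ r, …`, it becomes a map of `R`-algebras when the structure map of `B` in
the target is precomposed with `φ`; this does not change the ring `W_n(B)`, since `φ` fixes `ϖ`. -/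
noncomputable def frob : W.Witt (n + 1) ρ →+* W.Witt n (ρ.comp W.φ) where
  toFun := frobFun
  map_one' := by
    rw [← mapFun_one (ρ := (C : R →+* MvPolynomial B R)) (cover ρ),
      ← mapFun_frobFun _ cover_comp,
      ← mapFun_one (ρ := (C : R →+* MvPolynomial B R).comp W.φ) (cover ρ)]
    congr 1
    exact twist_ghost_injective fun i => by rw [ghost_frobFun, ghost_one, ghost_one]
  map_mul' x y := by
    obtain ⟨x, rfl⟩ := exists_lift x
    obtain ⟨y, rfl⟩ := exists_lift y
    rw [← mapFun_mul _ cover_comp]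
    simp only [← mapFun_frobFun _ cover_comp]
    rw [← mapFun_mul _ cover_comp_twist]
    congr 1
    exact twist_ghost_injective fun i => by simp only [ghost_mul, ghost_frobFun]
  map_zero' := by
    have h0 : (0 : W.Witt (n + 1) ρ) = mapFun (cover ρ) (0 : W.Witt (n + 1) C) := by
      ext; simp [mapFun]
    have h1 : (0 : W.Witt n (ρ.comp W.φ)) = mapFun (cover ρ) (0 : W.Witt n (C.comp W.φ)) := by
      ext; simp [mapFun]
    rw [h0, ← mapFun_frobFun _ cover_comp, h1]
    congr 1
    refine twist_ghost_injective fun i => ?_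
    rw [ghost_frobFun, ghost_zero, ghost_zero]
  map_add' x y := by
    obtain ⟨x, rfl⟩ := exists_lift x
    obtain ⟨y, rfl⟩ := exists_lift y
    rw [← mapFun_add]
    simp only [← mapFun_frobFun _ cover_comp]
    rw [← mapFun_add]
    congr 1
    exact twist_ghost_injective fun i => by simp only [ghost_add, ghost_frobFun]

theorem frob_comp_str : (frob).comp (str W (n + 1) ρ) = str W n (ρ.comp W.φ) := by
  have h : ∀ r, mapFun (RingHom.id R) (frobFun (const W (n + 1) r)) =
      (mapFun W.φ (const W n r) : W.Witt n ((RingHom.id R).comp W.φ)) := fun r => by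
    refine ghost_injective (fun x hx => W.torsionFree x (by simpa [W.φ_ϖ] using hx)) fun i => ?_
    rw [ghost_mapFun (ρ := (RingHom.id R).comp W.φ) _ (by simp), ghost_frobFun, ghost_const,
      ghost_mapFun (ρ := RingHom.id R) _ (by simp), ghost_const]
    simp [Function.iterate_succ_apply']
  ext r i
  have h1 := congrArg (fun w => ρ (w.coeff i)) (h r)
  change (frobFun (mapFun ρ (const W (n + 1) r) : W.Witt (n + 1) ρ)).coeff i = _
  rw [← mapFun_frobFun ρ (ρ := RingHom.id R) (by simp)]
  exact h1

theorem trunc_frob {m n : ℕ} (h : m ≤ n) (x : W.Witt (n + 1) ρ) :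
    trunc h (frob x) = frob (trunc (Nat.succ_le_succ h) x) := by
  obtain ⟨x, rfl⟩ := exists_lift x
  change truncFun h (frobFun (mapFun (cover ρ) x)) =
    frobFun (mapFun (cover ρ) (truncFun (Nat.succ_le_succ h) x))
  rw [← mapFun_frobFun _ cover_comp, ← mapFun_frobFun _ cover_comp]
  change mapFun (cover ρ) (truncFun h (frobFun x)) = _
  congr 1
  refine twist_ghost_injective fun i => ?_
  rw [ghost_truncFun, ghost_frobFun, ghost_frobFun, ghost_truncFun]
  rfl

end Witt
end WittBase

end WittVectors

/-- An `R`-algebra, with structure map `str`, in which `ϖ` is nilpotent. A formal scheme over `Spf R`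
is identified with its functor of points on these algebras. -/
structure NilAlg {R : Type u} [CommRing R] (W : WittBase R) where
  carrier : Type u
  [commRing : CommRing carrier]
  str : R →+* carrier
  nil : IsNilpotent (str W.ϖ)

namespace NilAlg

attribute [instance] NilAlg.commRing

variable {R : Type u} [CommRing R] {W : WittBase R}

/-- `R`-algebra homomorphisms. -/
structure Hom (B C : NilAlg W) where
  toRingHom : B.carrier →+* C.carrier
  comp_str : toRingHom.comp B.str = C.str

namespace Hom

/-- The identity homomorphism. -/
def id (B : NilAlg W) : Hom B B := ⟨RingHom.id _, RingHom.id_comp _⟩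

/-- Composition of homomorphisms. -/
def comp {B C D : NilAlg W} (g : Hom C D) (f : Hom B C) : Hom B D :=
  ⟨g.toRingHom.comp f.toRingHom, by rw [RingHom.comp_assoc, f.comp_str, g.comp_str]⟩

end Hom

/-- The truncated Witt vectors `W_n(B)` (of length `n + 1`), as an `R`-algebra. -/
noncomputable def witt (n : ℕ) (B : NilAlg W) : NilAlg W :=
  ⟨W.Witt n B.str, WittBase.Witt.str W n B.str, WittBase.Witt.isNilpotent_str B.nil⟩

/-- The algebra `B` with its structure map precomposed with the Frobenius lift of `R`. -/
def tw (B : NilAlg W) : NilAlg W :=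
  ⟨B.carrier, B.str.comp W.φ, by rw [RingHom.comp_apply, W.φ_ϖ]; exact B.nil⟩

/-- The dual numbers `B[ε]`. -/
def dual (B : NilAlg W) : NilAlg W :=
  ⟨TrivSqZeroExt B.carrier B.carrier, (TrivSqZeroExt.inlHom B.carrier B.carrier).comp B.str,
    B.nil.map (TrivSqZeroExt.inlHom B.carrier B.carrier)⟩

/-- The element `b ε` of `B[ε]`. -/
def eps (B : NilAlg W) (b : B.carrier) : B.dual.carrier :=
  (TrivSqZeroExt.inr b : TrivSqZeroExt B.carrier B.carrier)

namespace Hom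

variable {B C : NilAlg W}

/-- The map `W_n(B) → W_n(C)` induced by `B → C`. -/
noncomputable def witt (n : ℕ) (f : Hom B C) : Hom (B.witt n) (C.witt n) :=
  ⟨WittBase.Witt.map f.toRingHom f.comp_str, WittBase.Witt.map_comp_str _ _⟩

/-- A homomorphism stays one after twisting both structure maps. -/
def tw (f : Hom B C) : Hom B.tw C.tw :=
  ⟨f.toRingHom, congrArg (fun g => g.comp W.φ) f.comp_str⟩

/-- The truncation `W_n(B) → W_m(B)`. -/
noncomputable def trunc (B : NilAlg W) {m n : ℕ} (h : m ≤ n) : Hom (B.witt n) (B.witt m) :=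
  ⟨WittBase.Witt.trunc h, WittBase.Witt.trunc_comp_str h⟩

/-- The projection `W_n(B) → B` to the zeroth component. -/
noncomputable def head (B : NilAlg W) (n : ℕ) : Hom (B.witt n) B :=
  ⟨WittBase.Witt.head, WittBase.Witt.head_comp_str⟩

/-- The Frobenius `W_{n+1}(B) → W_n(B)`; it is semilinear over the Frobenius lift of `R`. -/
noncomputable def frob (B : NilAlg W) (n : ℕ) : Hom (B.witt (n + 1)) (B.tw.witt n) :=
  ⟨WittBase.Witt.frob, WittBase.Witt.frob_comp_str⟩

end Hom

end NilAlg

/-- A formal `A`-module scheme over `Spf R`, through its functor of points. -/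
structure FormalModule (A : Type v) [CommRing A] {R : Type u} [CommRing R] (W : WittBase R) where
  obj : NilAlg W → Type u
  [addCommGroup : ∀ B, AddCommGroup (obj B)]
  [module : ∀ B, Module A (obj B)]
  map : ∀ {B C : NilAlg W}, NilAlg.Hom B C → obj B →ₗ[A] obj C
  map_id : ∀ B x, map (NilAlg.Hom.id B) x = x
  map_comp : ∀ {B C D : NilAlg W} (g : NilAlg.Hom C D) (f : NilAlg.Hom B C) x,
    map (g.comp f) x = map g (map f x)

attribute [instance] FormalModule.addCommGroup FormalModule.module

namespace FormalModule

variable {A : Type v} [CommRing A] {R : Type u} [CommRing R] {W : WittBase R}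

/-- A homomorphism of formal `A`-module schemes. -/
structure Hom (M N : FormalModule A W) where
  app : ∀ B, M.obj B →ₗ[A] N.obj B
  naturality : ∀ {B C : NilAlg W} (f : NilAlg.Hom B C) x, app C (M.map f x) = N.map f (app B x)

variable [Algebra A R]

/-- `HomGa M` is `Hom_A(M, Ĝ_a)`, where `A` acts on the additive group `Ĝ_a` by multiplication
through the structure map `A → R`. -/
@[ext] structure HomGa (M : FormalModule A W) where
  toFun : ∀ B : NilAlg W, M.obj B →+ B.carrier
  map_smul : ∀ B (a : A) x, toFun B (a • x) = B.str (algebraMap A R a) * toFun B x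
  naturality : ∀ {B C : NilAlg W} (f : NilAlg.Hom B C) x,
    toFun C (M.map f x) = f.toRingHom (toFun B x)

namespace HomGa

variable {M N : FormalModule A W}

instance : Zero (HomGa M) := ⟨⟨fun _ => 0, by simp, by simp⟩⟩

instance : Add (HomGa M) := ⟨fun Θ Θ' => ⟨fun B => Θ.toFun B + Θ'.toFun B,
  fun B a x => by simp [Θ.map_smul, Θ'.map_smul, mul_add],
  fun f x => by simp [Θ.naturality, Θ'.naturality]⟩⟩

instance : Neg (HomGa M) := ⟨fun Θ => ⟨fun B => -Θ.toFun B,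
  fun B a x => by simp [Θ.map_smul], fun f x => by simp [Θ.naturality]⟩⟩

instance : Sub (HomGa M) := ⟨fun Θ Θ' => ⟨fun B => Θ.toFun B - Θ'.toFun B,
  fun B a x => by simp [Θ.map_smul, Θ'.map_smul, mul_sub],
  fun f x => by simp [Θ.naturality, Θ'.naturality]⟩⟩

/-- Scalar multiplication by `r`, on each `Ĝ_a(B) = B` the multiplication by the image of `r`. -/
instance : SMul R (HomGa M) := ⟨fun r Θ => ⟨fun B => (AddMonoidHom.mulLeft (B.str r)).comp (Θ.toFun B),
  fun B a x => by simp [Θ.map_smul, mul_left_comm],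
  fun {B C} f x => by simp [Θ.naturality, ← f.comp_str]⟩⟩

instance : SMul ℕ (HomGa M) := ⟨fun n Θ => ⟨fun B => n • Θ.toFun B,
  fun B a x => by simp [Θ.map_smul, mul_left_comm],
  fun f x => by simp [Θ.naturality]⟩⟩

instance : SMul ℤ (HomGa M) := ⟨fun n Θ => ⟨fun B => n • Θ.toFun B,
  fun B a x => by simp [Θ.map_smul, mul_left_comm],
  fun f x => by simp [Θ.naturality]⟩⟩

instance : AddCommGroup (HomGa M) :=
  Function.Injective.addCommGroup (HomGa.toFun : HomGa M → _) (fun _ _ => HomGa.ext) rfl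
    (fun _ _ => rfl) (fun _ => rfl) (fun _ _ => rfl) (fun _ _ => rfl) (fun _ _ => rfl)

@[simp] theorem add_apply (Θ Θ' : HomGa M) (B : NilAlg W) (x : M.obj B) :
    (Θ + Θ').toFun B x = Θ.toFun B x + Θ'.toFun B x := rfl

@[simp] theorem zero_apply (B : NilAlg W) (x : M.obj B) : (0 : HomGa M).toFun B x = 0 := rfl

@[simp] theorem smul_apply (r : R) (Θ : HomGa M) (B : NilAlg W) (x : M.obj B) :
    (r • Θ).toFun B x = B.str r * Θ.toFun B x := rfl

theorem ext' {Θ Θ' : HomGa M} (h : ∀ B x, Θ.toFun B x = Θ'.toFun B x) : Θ = Θ' :=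
  HomGa.ext (funext fun B => AddMonoidHom.ext (h B))

instance : Module R (HomGa M) where
  one_smul Θ := ext' fun B x => by simp
  mul_smul r s Θ := ext' fun B x => by simp [mul_assoc]
  smul_zero r := ext' fun B x => by simp
  smul_add r Θ Θ' := ext' fun B x => by simp [mul_add]
  add_smul r s Θ := ext' fun B x => by simp [add_mul]
  zero_smul Θ := ext' fun B x => by simp

/-- The `R`-linear map `Hom_A(N, Ĝ_a) → Hom_A(M, Ĝ_a)` induced by `M → N`. -/
def pullback (g : Hom M N) : HomGa N →ₗ[R] HomGa M where
  toFun Θ := ⟨fun B => (Θ.toFun B).comp (g.app B).toAddMonoidHom,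
    fun B a x => by simp [Θ.map_smul],
    fun f x => by simp [g.naturality, Θ.naturality]⟩
  map_add' _ _ := rfl
  map_smul' _ _ := rfl

end HomGa

end FormalModule

/-- The module `M` with scalars acting through the Frobenius lift: `r` acts as `φ r` does on `M`. -/
def FrobTwist {R : Type u} [CommRing R] (_ : WittBase R) (M : Type*) : Type _ := M

namespace FrobTwist

variable {R : Type u} [CommRing R] (W : WittBase R) (M : Type*) [AddCommGroup M] [Module R M]

instance : AddCommGroup (FrobTwist W M) := inferInstanceAs (AddCommGroup M)

instance : Module R (FrobTwist W M) := Module.compHom M W.φ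

end FrobTwist

/-- The Frobenius lift of `R` is a homomorphism of `A`-algebras. -/
class WittBase.Over (A : Type v) [CommRing A] {R : Type u} [CommRing R] [Algebra A R]
    (W : WittBase R) : Prop where
  φ_algebraMap : ∀ a : A, W.φ (algebraMap A R a) = algebraMap A R a

/-- An admissible formal `A`-module scheme over `Spf R`: the additive group `Ĝ_a` with an action of
`A` by endomorphisms (power series over `R`, here natural additive maps) such that `a` acts on the
tangent space as the image of `a` in `R`. -/
structure AdmissibleModule (A : Type v) [CommRing A] {R : Type u} [CommRing R] [Algebra A R]
    (W : WittBase R) where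
  act : ∀ B : NilAlg W, A →+* AddMonoid.End B.carrier
  naturality : ∀ {B C : NilAlg W} (f : NilAlg.Hom B C) (a : A) (b : B.carrier),
    act C a (f.toRingHom b) = f.toRingHom (act B a b)
  act_eps : ∀ (B : NilAlg W) (a : A) (b : B.carrier),
    act B.dual a (B.eps b) = B.eps (B.str (algebraMap A R a) * b)

namespace AdmissibleModule

variable {A : Type v} [CommRing A] {R : Type u} [CommRing R] [Algebra A R] {W : WittBase R}
  [WittBase.Over A W] (E : AdmissibleModule A W)

/-- `E` is a Drinfeld module of rank `r`, with respect to the absolute value `abs` on `A`: for every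
nonzero `a`, the kernel of `a` on `E` is a finite flat group scheme over `R` of degree `|a| ^ r`,
that is, it is represented by an `R`-algebra `C` that is free of rank `|a| ^ r` as an `R`-module,
`x : C` being the universal point of the kernel. -/
def IsDrinfeld (abs : A → ℕ) (r : ℕ) : Prop :=
  ∀ a : A, a ≠ 0 → ∃ (C : Type u) (_ : CommRing C) (_ : Algebra R C) (x : C),
    Module.Free R C ∧ Module.Finite R C ∧ Module.finrank R C = abs a ^ r ∧
      ∀ B : NilAlg W, Set.BijOn (fun g : C →+* B.carrier => g x)
        {g | g.comp (algebraMap R C) = B.str} {b | E.act B a b = 0}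

/-- `E(B)`: the type `B` with its additive group structure and the given action of `A`. -/
def Points (_ : AdmissibleModule A W) (B : NilAlg W) : Type u := B.carrier

instance (B : NilAlg W) : AddCommGroup (E.Points B) := inferInstanceAs (AddCommGroup B.carrier)

instance (B : NilAlg W) : Module A (E.Points B) :=
  letI : Module (AddMonoid.End B.carrier) (E.Points B) :=
    inferInstanceAs (Module (AddMonoid.End B.carrier) B.carrier)
  Module.compHom (E.Points B) (E.act B)

/-- The `A`-linear map `E(B) → E(C)`. -/
def pointsMap {B C : NilAlg W} (f : NilAlg.Hom B C) : E.Points B →ₗ[A] E.Points C where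
  toFun x := f.toRingHom x
  map_add' x y := map_add f.toRingHom x y
  map_smul' a x := (E.naturality f a x).symm

/-- The arithmetic jet space `J^n E`, the functor `B ↦ E(W_n(B))`. -/
noncomputable def J (n : ℕ) : FormalModule A W where
  obj B := E.Points (B.witt n)
  map f := E.pointsMap (f.witt n)
  map_id _ _ := rfl
  map_comp _ _ _ := rfl

/-- The kernel `N^n` of the projection `J^n E → E`. -/
noncomputable def N (n : ℕ) : FormalModule A W where
  obj B := LinearMap.ker (E.pointsMap (NilAlg.Hom.head B n))
  map {B C} f := ((E.pointsMap (f.witt n)).comp (Submodule.subtype _)).codRestrict _ fun x => by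
    have hx : (E.pointsMap (NilAlg.Hom.head B n)) (x : E.Points (B.witt n)) = 0 := x.2
    have : (E.pointsMap (NilAlg.Hom.head C n)) (E.pointsMap (f.witt n) (x : E.Points (B.witt n))) =
      E.pointsMap f ((E.pointsMap (NilAlg.Hom.head B n)) (x : E.Points (B.witt n))) := rfl
    rw [hx, map_zero] at this
    exact this
  map_id _ _ := rfl
  map_comp _ _ _ := rfl

/-- The inclusion `i : N^n → J^n E`. -/
noncomputable def incl (n : ℕ) : FormalModule.Hom (E.N n) (E.J n) where
  app _ := Submodule.subtype _
  naturality _ _ := rfl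

/-- The projection `u : J^n E → J^m E`. -/
noncomputable def projJ {m n : ℕ} (h : m ≤ n) : FormalModule.Hom (E.J n) (E.J m) where
  app B := E.pointsMap (NilAlg.Hom.trunc B h)
  naturality _ _ := rfl

/-- The projection `u : N^n → N^m`. -/
noncomputable def projN {m n : ℕ} (h : m ≤ n) : FormalModule.Hom (E.N n) (E.N m) where
  app B := ((E.pointsMap (NilAlg.Hom.trunc B h)).comp (Submodule.subtype _)).codRestrict _ fun x => x.2
  naturality _ _ := rfl

/-- The group `X_n(E) = Hom_A(J^n E, Ĝ_a)` of differential characters of order at most `n`. -/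
abbrev X (n : ℕ) : Type _ := (E.J n).HomGa

/-- `u^* : X_m(E) → X_n(E)` for `m ≤ n`. -/
noncomputable def uX {m n : ℕ} (h : m ≤ n) : E.X m →ₗ[R] E.X n :=
  FormalModule.HomGa.pullback (E.projJ h)

/-- `u^* : Hom_A(N^m, Ĝ_a) → Hom_A(N^n, Ĝ_a)` for `m ≤ n`. -/
noncomputable def uN {m n : ℕ} (h : m ≤ n) : (E.N m).HomGa →ₗ[R] (E.N n).HomGa :=
  FormalModule.HomGa.pullback (E.projN h)

/-- `i^* : X_n(E) → Hom_A(N^n, Ĝ_a)`. -/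
noncomputable def iX (n : ℕ) : E.X n →ₗ[R] (E.N n).HomGa :=
  FormalModule.HomGa.pullback (E.incl n)

/-- `φ^* : X_n(E) → X_{n+1}(E)`, composition with `φ : J^{n+1} E → J^n E`; the latter is given by the
Frobenius of Witt vectors and lies over the Frobenius lift of `R`, so `φ^*` is semilinear. -/
noncomputable def frobX (n : ℕ) : E.X n →ₛₗ[W.φ] E.X (n + 1) where
  toFun Θ :=
    { toFun := fun B => (Θ.toFun B.tw).comp (E.pointsMap (NilAlg.Hom.frob B n)).toAddMonoidHom
      map_smul := fun B a x => by
        have h := Θ.map_smul B.tw a (E.pointsMap (NilAlg.Hom.frob B n) x)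
        have h3 := (E.pointsMap (NilAlg.Hom.frob B n)).map_smul a x
        have h2 : B.tw.str (algebraMap A R a) = B.str (algebraMap A R a) :=
          congrArg B.str (WittBase.Over.φ_algebraMap a)
        rw [h2] at h
        exact (congrArg (Θ.toFun B.tw) h3).trans h
      naturality := fun {B C} f x => by
        have h := Θ.naturality f.tw (E.pointsMap (NilAlg.Hom.frob B n) x)
        have h2 : (E.J n).map f.tw (E.pointsMap (NilAlg.Hom.frob B n) x) =
            E.pointsMap (NilAlg.Hom.frob C n) ((E.J (n + 1)).map f x) :=
          WittBase.Witt.mapFun_frobFun f.toRingHom f.comp_str x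
        rw [h2] at h
        exact h }
  map_add' _ _ := rfl
  map_smul' _ _ := rfl

/-- The iterate `(φ^*)^j : X_m(E) → X_{m+j}(E)`. -/
noncomputable def frobXIter (m : ℕ) : ∀ j : ℕ, E.X m → E.X (m + j)
  | 0 => fun Θ => Θ
  | j + 1 => fun Θ => E.frobX (m + j) (frobXIter m j Θ)

/-- The underlying map of the lateral Frobenius `𝔣 : N^{n+2} → N^{n+1}`: a point of `N^{n+2}` is a Witt
vector `(0, y_1, …, y_{n+2})`, and it is sent to `(0, F (y_1, …, y_{n+2}))`, that is, `𝔣` is the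
Frobenius `F : W_{n+1} → W_n` of Witt vectors when `N^{n+1}` is identified with `W_n` by the
Verschiebung. It is semilinear over the Frobenius lift of `R`. -/
noncomputable def lat (n : ℕ) (B : NilAlg W) (x : (E.N (n + 2)).obj B) : (E.N (n + 1)).obj B.tw :=
  ⟨(⟨Fin.cons 0 (WittBase.Witt.frob
      (⟨fun i => (x.1 : W.Witt (n + 2) B.str).coeff i.succ⟩ : W.Witt (n + 1) B.str)).coeff⟩ :
    W.Witt (n + 1) (B.str.comp W.φ)), rfl⟩

/-- `ϑ : N^1 → Ĝ_a` is normalized if it has tangent map `1` in the coordinate `x` of `N^1`, whose points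
are the Witt vectors `(0, x)`. -/
def IsNormalized (ϑ : (E.N 1).HomGa) : Prop :=
  ∀ (B : NilAlg W) (x : (E.N 1).obj B.dual) (b : B.carrier),
    (x.1 : W.Witt 1 B.dual.str).coeff 1 = B.eps b → ϑ.toFun B.dual x = B.eps b

/-- `psi ϑ j` is `ϑ ∘ 𝔣^j : N^{j+1} → Ĝ_a`. -/
noncomputable def psi (ϑ : (E.N 1).HomGa) : ∀ (j : ℕ) (B : NilAlg W), (E.N (j + 1)).obj B → B.carrier
  | 0, B, x => ϑ.toFun B x
  | j + 1, B, x => psi ϑ j B.tw (E.lat j B x)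

/-- The character `Ψ_{j+1} = ϑ ∘ 𝔣^j` of `N^m`, where `j < m`. -/
noncomputable def Psi (ϑ : (E.N 1).HomGa) {m : ℕ} (j : Fin m) (B : NilAlg W) (x : (E.N m).obj B) :
    B.carrier :=
  E.psi ϑ j B ((E.projN j.2).app B x)

/-- `Θ` is a character of order at most `m` with `i^* Θ = Ψ_m - λ_{m-1} Ψ_{m-1} - ⋯ - λ_1 Ψ_1`, for some
`λ_i` in `R`. -/
def IsTheta (ϑ : (E.N 1).HomGa) (m : ℕ) (Θ : E.X m) : Prop :=
  ∃ l : Fin m → R, ∀ (B : NilAlg W) (x : (E.N m).obj B), (E.iX m Θ).toFun B x =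
    ∑ j : Fin m, if (j : ℕ) + 1 = m then E.Psi ϑ j B x else - (B.str (l j) * E.Psi ϑ j B x)

/-- `E` splits at order `m`: `m` is the smallest order of a nonzero differential character. -/
def SplitsAt (m : ℕ) : Prop := Nontrivial (E.X m) ∧ ∀ i < m, Subsingleton (E.X i)

/-- The colimit `X_∞(E)` of the `X_n(E)` along `u^*`. -/
abbrev XInf : Type _ := Module.DirectLimit E.X fun _ _ h => E.uX h

/-- The canonical map `X_n(E) → X_∞(E)`. -/
noncomputable def toXInf (n : ℕ) : E.X n →ₗ[R] E.XInf :=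
  Module.DirectLimit.of R ℕ E.X (fun _ _ h => E.uX h) n

theorem uX_frobX {m n : ℕ} (h : m ≤ n) (Θ : E.X m) :
    E.uX (Nat.succ_le_succ h) (E.frobX m Θ) = E.frobX n (E.uX h Θ) := by
  refine FormalModule.HomGa.ext' fun B x => ?_
  change Θ.toFun B.tw _ = Θ.toFun B.tw _
  congr 1
  exact (WittBase.Witt.trunc_frob h x).symm

/-- The composite of `φ^*` with `X_{n+1}(E) → X_∞(E)`, as a linear map into the twist of `X_∞(E)`. -/
noncomputable def frobToXInf (n : ℕ) : E.X n →ₗ[R] FrobTwist W E.XInf where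
  toFun Θ := (E.toXInf (n + 1) (E.frobX n Θ) : E.XInf)
  map_add' Θ Θ' := by rw [map_add, map_add]; rfl
  map_smul' r Θ := by rw [LinearMap.map_smulₛₗ, map_smul]; rfl

theorem frobToXInf_uX (m n : ℕ) (h : m ≤ n) (Θ : E.X m) :
    E.frobToXInf n (E.uX h Θ) = E.frobToXInf m Θ := by
  change E.toXInf (n + 1) (E.frobX n (E.uX h Θ)) = E.toXInf (m + 1) (E.frobX m Θ)
  rw [← uX_frobX]
  exact Module.DirectLimit.of_f

/-- `φ^*` on `X_∞(E)`, as a linear map into the twist of `X_∞(E)`. -/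
noncomputable def frobXInfLin : E.XInf →ₗ[R] FrobTwist W E.XInf :=
  Module.DirectLimit.lift R ℕ E.X _ E.frobToXInf E.frobToXInf_uX

/-- The additive map `φ^* : X_∞(E) → X_∞(E)`, which is `φ^*` on each `X_n(E)`. -/
noncomputable def frobXInf : AddMonoid.End E.XInf := E.frobXInfLin.toAddMonoidHom

theorem frobXInf_toXInf (n : ℕ) (Θ : E.X n) :
    E.frobXInf (E.toXInf n Θ) = E.toXInf (n + 1) (E.frobX n Θ) :=
  Module.DirectLimit.lift_of E.frobToXInf E.frobToXInf_uX Θ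

theorem frobXInf_smul (r : R) (x : E.XInf) : E.frobXInf (r • x) = W.φ r • E.frobXInf x :=
  E.frobXInfLin.map_smul r x

end AdmissibleModule

/-- The action of `ℕ` on `R` by iterates of the Frobenius lift. -/
@[reducible] def WittBase.frobAction {R : Type u} [CommRing R] (W : WittBase R) :
    MulSemiringAction (Multiplicative ℕ) R :=
  MulSemiringAction.compHom R (powersHom (R →+* R) W.φ)

/-- The twisted polynomial ring `R{φ^*}`: polynomials `∑ r_i (φ^*)^i` with the multiplication
determined by `φ^* r = φ(r) φ^*`. -/
def TwistedPoly {R : Type u} [CommRing R] (_ : WittBase R) : Type u := SkewPolynomial R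

namespace TwistedPoly

variable {R : Type u} [CommRing R] (W : WittBase R)

noncomputable instance : Ring (TwistedPoly W) :=
  letI := W.frobAction
  inferInstanceAs (Ring (SkewPolynomial R))

/-- The inclusion of constants. -/
noncomputable def const : R →+* TwistedPoly W :=
  letI := W.frobAction
  SkewPolynomial.CRingHom

/-- The `R`-module structure of `R{φ^*}` given by right multiplication with constants. -/
noncomputable instance : Module R (TwistedPoly W) where
  smul r P := P * const W r
  one_smul P := by
    change P * const W 1 = P
    rw [map_one, mul_one]
  mul_smul r s P := by
    change P * const W (r * s) = P * const W s * const W r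
    rw [mul_comm r s, map_mul, mul_assoc]
  smul_zero r := zero_mul _
  smul_add r P Q := add_mul _ _ _
  add_smul r s P := by
    change P * const W (r + s) = P * const W r + P * const W s
    rw [map_add, mul_add]
  zero_smul P := by
    change P * const W 0 = 0
    rw [map_zero, mul_zero]

theorem smul_def (r : R) (P : TwistedPoly W) : r • P = P * const W r := rfl

end TwistedPoly

namespace AdmissibleModule

variable {A : Type v} [CommRing A] {R : Type u} [CommRing R] [Algebra A R] {W : WittBase R}
  [WittBase.Over A W] (E : AdmissibleModule A W)

/-- The action of `R{φ^*}` on `X_∞(E)`. -/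
noncomputable def twistedAct : TwistedPoly W →+* AddMonoid.End E.XInf :=
  letI := W.frobAction
  SkewMonoidAlgebra.liftNCRingHom (k := R) (G := Multiplicative ℕ)
    (Module.toAddMonoidEnd R E.XInf) (powersHom (AddMonoid.End E.XInf) E.frobXInf)
    (fun {r g} => by
      have key : ∀ (n : ℕ) (r : R), Module.toAddMonoidEnd R E.XInf ((W.φ ^ n) r) * E.frobXInf ^ n =
          E.frobXInf ^ n * Module.toAddMonoidEnd R E.XInf r := by
        intro n
        induction n with
        | zero => intro r; simp
        | succ n ih =>
          intro r
          have h1 : Module.toAddMonoidEnd R E.XInf (W.φ r) * E.frobXInf =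
              E.frobXInf * Module.toAddMonoidEnd R E.XInf r :=
            AddMonoidHom.ext fun x => (E.frobXInf_smul r x).symm
          rw [pow_succ, RingHom.mul_def, RingHom.comp_apply, pow_succ, ← mul_assoc, ih, mul_assoc, h1,
            mul_assoc]
      exact key g.toAdd r)

theorem twistedAct_const (r : R) (x : E.XInf) : E.twistedAct (TwistedPoly.const W r) x = r • x := by
  let _ := W.frobAction
  have h : E.twistedAct (TwistedPoly.const W r) = Module.toAddMonoidEnd R E.XInf r := by
    refine (SkewMonoidAlgebra.liftNC_single (k := R) (G := Multiplicative ℕ) _ _ _ _).trans ?_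
    simp
  rw [h]; rfl

noncomputable instance : Module (TwistedPoly W) E.XInf := Module.compHom E.XInf E.twistedAct

/-- The canonical map `R{φ^*} ⊗_R X_m(E) → X_∞(E)`, `P ⊗ Θ ↦ P Θ`. -/
noncomputable def canonicalMap (m : ℕ) : TensorProduct R (TwistedPoly W) (E.X m) →+ E.XInf :=
  TensorProduct.liftAddHom
    { toFun := fun P => (E.twistedAct P).comp (E.toXInf m).toAddMonoidHom
      map_zero' := by rw [map_zero]; rfl
      map_add' := fun P Q => by rw [map_add]; rfl }
    (fun r P Θ => by
      change E.twistedAct (r • P) (E.toXInf m Θ) = E.twistedAct P (E.toXInf m (r • Θ))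
      rw [TwistedPoly.smul_def, map_mul, map_smul]
      exact congrArg (E.twistedAct P) (E.twistedAct_const r _))

end AdmissibleModule

/-- The data on the base: `R` is a complete discrete valuation ring that is an algebra over the `𝔭`-adic
completion of `A`, the image of `t`, an element of `𝔭` but not of `𝔭 ^ 2`, generates its maximal ideal, and
`φ` is an endomorphism of the `A`-algebra `R` that lifts the `|A / 𝔭|`-power Frobenius of the residue field. -/
structure FrobeniusBase {A : Type v} [CommRing A] (𝔭 : Ideal A) (R : Type u) [CommRing R] [IsLocalRing R]
    [Algebra A R] where
  t : A
  t_mem : t ∈ 𝔭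
  t_notMem : t ∉ 𝔭 ^ 2
  map_le : 𝔭.map (algebraMap A R) ≤ IsLocalRing.maximalIdeal R
  maximalIdeal_eq : IsLocalRing.maximalIdeal R = Ideal.span {algebraMap A R t}
  complete : IsAdicComplete (IsLocalRing.maximalIdeal R) R
  φ : R →ₐ[A] R
  φ_frob : ∀ x, φ x - x ^ Nat.card (A ⧸ 𝔭) ∈ IsLocalRing.maximalIdeal R

namespace FrobeniusBase

variable {A : Type v} [CommRing A] {𝔭 : Ideal A} {R : Type u} [CommRing R]

theorem card_eq [IsLocalRing R] [Algebra A R] (S : FrobeniusBase 𝔭 R) (k : Type v) [Field k] [Finite k]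
    [Algebra k A] [𝔭.IsMaximal] :
    ∃ p e : ℕ, p.Prime ∧ e ≠ 0 ∧ Nat.card (A ⧸ 𝔭) = p ^ e ∧ (p : R) = 0 := by
  have h0 : Nat.card (A ⧸ 𝔭) ≠ 0 := by
    intro h
    have h1 := S.φ_frob 0
    rw [h, pow_zero, map_zero, zero_sub, neg_mem_iff] at h1
    exact (IsLocalRing.maximalIdeal.isMaximal R).ne_top ((Ideal.eq_top_iff_one _).2 h1)
  have hfin : Finite (A ⧸ 𝔭) := (Nat.card_ne_zero.1 h0).2
  let _ : Field (A ⧸ 𝔭) := Ideal.Quotient.field 𝔭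
  have : Fintype (A ⧸ 𝔭) := Fintype.ofFinite _
  obtain ⟨p, hp⟩ := CharP.exists (A ⧸ 𝔭)
  obtain ⟨e, hprime, hcard⟩ := FiniteField.card (A ⧸ 𝔭) p
  refine ⟨p, e, hprime, e.ne_zero, by rw [Nat.card_eq_fintype_card, hcard], ?_⟩
  have h1 : ((p : k) : k) = 0 := by
    apply (algebraMap k (A ⧸ 𝔭)).injective
    rw [map_natCast, map_zero, CharP.cast_eq_zero]
  rw [← map_natCast ((algebraMap A R).comp (algebraMap k A)), h1, map_zero]

/-- The data that the Witt vectors depend on: `ϖ` is the image `π` of `t`, and `q = |A / 𝔭|`. -/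
noncomputable def witt [IsDomain R] [IsDiscreteValuationRing R] [Algebra A R] (S : FrobeniusBase 𝔭 R)
    (k : Type v) [Field k] [Finite k] [Algebra k A] [𝔭.IsMaximal] : WittBase R where
  q := Nat.card (A ⧸ 𝔭)
  ϖ := algebraMap A R S.t
  φ := S.φ.toRingHom
  q_eq := S.card_eq k
  torsionFree x hx := by
    refine (mul_eq_zero.1 hx).resolve_left fun h => ?_
    have h1 := S.maximalIdeal_eq
    rw [h, Ideal.span_singleton_zero] at h1
    exact IsDiscreteValuationRing.not_a_field R h1
  φ_ϖ := S.φ.commutes _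
  φ_frob x := by
    have h := S.φ_frob x
    rw [S.maximalIdeal_eq] at h
    exact Ideal.mem_span_singleton.1 h

instance [IsDomain R] [IsDiscreteValuationRing R] [Algebra A R] (S : FrobeniusBase 𝔭 R)
    (k : Type v) [Field k] [Finite k] [Algebra k A] [𝔭.IsMaximal] : WittBase.Over A (S.witt k) :=
  ⟨S.φ.commutes⟩

end FrobeniusBase

/-!
Restriction to `N^n` embeds `X_n(E)` in `Hom_A(N^n, Ĝ_a)`, and everything is read off from coordinates there.

Natural additive maps between additive groups are restricted power series `∑ c_j x ^ (p ^ j)`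
(`GaFun.IsEnd.exists_hasCoef`). On the top component of `N^n` an element of `A` acts by a series whose
coefficients are divisible by growing powers of `ϖ`, so a character there is determined by its tangent map
(`HasCoef.eq_zero_of_coef_zero`), and for `N^1` a normalized one exists (`exists_linearization`). The characters
`Ψ_j = ϑ ∘ 𝔣^(j-1)` form a basis of `Hom_A(N^n, Ĝ_a)` (`basisN`): on the top component `Ψ_n` has tangent map
`ϖ ^ (n-1)`, so the `Ψ_j` span after inverting `ϖ`, and on the first component `Ψ_j` is congruent modulo `ϖ` to
a series that begins with `x ^ (q ^ (j-1))`, so they remain independent modulo `ϖ`.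

The kernel of the element `t` on the Drinfeld module `E` is finite, so `t` does not act as zero modulo `ϖ`
(`IsDrinfeld.exists_not_dvd_coef`). As `t` is zero on the additive group modulo `ϖ`, there are no nonzero
characters of `E` itself, the restriction `i^*` is injective (`iX_injective`), and its cokernel has no torsion
(`exists_eq_ϖ_smul`). An element of `X_∞(E)` thus has a finite sequence of coordinates with respect to the
`Ψ_j`. It comes from `X_n(E)` when the coordinates from the index `n` on vanish (`mem_range_toXInf`), and modulo
`ϖ` the Frobenius `φ^*` shifts the coordinates, because `φ` agrees with `𝔣` on `N^n` modulo `ϖ`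
(`dvd_coordInf_frobXInf`).

The crux is that `X_m(E)` contains an element whose leading coordinate is a unit (`exists_coordX_eq_one`). A
nonzero element, divided by a power of `ϖ`, has some unit coordinate; let `a` be the last index of one. If `a`
is less than `m - 1`, then the elements `φ^{*j} y`, whose last unit coordinates have the indices `a + j`, allow
one to remove the coordinates beyond `a` successively modulo all powers of `ϖ`, and the limit is a nonzero
element of `X_{a+1}(E)` (`nontrivial_X_of_isUnit`), which contradicts the minimality of `m`.

With such a `Θ`, the coordinates of `φ^{*j} Θ` form a triangular system with units on the diagonal. An element
whose coordinates from the index `m - 1` on vanish lies in `X_{m-1}(E) = 0`. Elimination then gives all parts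
of the theorem.
-/

/-! ### Natural additive endomorphisms of the additive group -/

/-- The properties of the base that the argument uses: `R` is local with maximal ideal generated by the
non-unit `ϖ`, and it is `ϖ`-adically separated and complete. -/
class WittBase.IsUniformized {R : Type u} [CommRing R] (W : WittBase R) : Prop where
  isUnit_or_dvd : ∀ x : R, IsUnit x ∨ W.ϖ ∣ x
  not_isUnit : ¬ IsUnit W.ϖ
  hausdorff : ∀ x : R, (∀ n : ℕ, W.ϖ ^ n ∣ x) → x = 0
  precomplete : ∀ x : ℕ → R, (∀ n, W.ϖ ^ n ∣ x (n + 1) - x n) → ∃ l, ∀ n, W.ϖ ^ n ∣ l - x n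

namespace WittBase

variable {R : Type u} [CommRing R] (W : WittBase R)

/-- The characteristic of `R`. -/
noncomputable def p : ℕ := W.q_eq.choose

/-- The exponent with `q = p ^ e`. -/
noncomputable def e : ℕ := W.q_eq.choose_spec.choose

theorem p_prime : W.p.Prime := W.q_eq.choose_spec.choose_spec.1

theorem e_ne_zero : W.e ≠ 0 := W.q_eq.choose_spec.choose_spec.2.1

theorem q_eq_pow : W.q = W.p ^ W.e := W.q_eq.choose_spec.choose_spec.2.2.1

theorem natCast_p : (W.p : R) = 0 := W.q_eq.choose_spec.choose_spec.2.2.2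

theorem natCast_p_map {B : Type*} [CommRing B] (ρ : R →+* B) : (W.p : B) = 0 := by
  rw [← map_natCast ρ, W.natCast_p, map_zero]

theorem add_pow_p {B : Type*} [CommRing B] (ρ : R →+* B) (x y : B) (i : ℕ) :
    (x + y) ^ W.p ^ i = x ^ W.p ^ i + y ^ W.p ^ i := by
  rw [add_pow_prime_pow_eq W.p_prime, W.natCast_p_map ρ]; simp

theorem sum_pow_p {B ι : Type*} [CommRing B] (ρ : R →+* B) (s : Finset ι) (f : ι → B) (i : ℕ) :
    (∑ j ∈ s, f j) ^ W.p ^ i = ∑ j ∈ s, f j ^ W.p ^ i := by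
  classical
  induction s using Finset.induction_on with
  | empty => simp [W.p_prime.ne_zero]
  | insert a s ha ih => rw [Finset.sum_insert ha, Finset.sum_insert ha, W.add_pow_p ρ, ih]

theorem lt_p_pow (i : ℕ) : i < W.p ^ i := Nat.lt_pow_self W.p_prime.one_lt

theorem p_pow_injective : Function.Injective (W.p ^ · : ℕ → ℕ) :=
  Nat.pow_right_injective W.p_prime.two_le

theorem ϖ_pow_cancel (n : ℕ) {x : R} (h : W.ϖ ^ n * x = 0) : x = 0 := by
  induction n with
  | zero => simpa using h
  | succ n ih => exact ih (W.torsionFree _ (by rw [← mul_assoc, ← pow_succ', h]))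

theorem ϖ_cancel {x y : R} (h : W.ϖ * x = W.ϖ * y) : x = y :=
  sub_eq_zero.1 (W.torsionFree _ (by rw [mul_sub, h, sub_self]))

theorem φ_ϖ_pow (n : ℕ) : W.φ (W.ϖ ^ n) = W.ϖ ^ n := by rw [map_pow, W.φ_ϖ]

theorem φ_iterate_ϖ (n : ℕ) : (W.φ^[n]) W.ϖ = W.ϖ := Function.iterate_fixed W.φ_ϖ n

/-- Sequences that converge to zero for the `ϖ`-adic topology. -/
def IsNull (c : ℕ → R) : Prop := ∀ n, ∃ N, ∀ j ≥ N, W.ϖ ^ n ∣ c j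

variable {W}

theorem IsNull.of_dvd {c d : ℕ → R} (hc : W.IsNull c) (h : ∀ j, c j ∣ d j) : W.IsNull d := fun n =>
  (hc n).imp fun _ hN j hj => (hN j hj).trans (h j)

theorem IsNull.map_φ {c : ℕ → R} (hc : W.IsNull c) : W.IsNull fun j => W.φ (c j) := fun n =>
  (hc n).imp fun _ hN j hj => by
    have := map_dvd W.φ (hN j hj)
    rwa [W.φ_ϖ_pow] at this

theorem IsNull.map_φ_iterate {c : ℕ → R} (hc : W.IsNull c) (i : ℕ) :
    W.IsNull fun j => (W.φ^[i]) (c j) := by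
  induction i with
  | zero => exact hc
  | succ i ih => simpa only [Function.iterate_succ_apply'] using ih.map_φ

/-- A null sequence vanishes far out in every `R`-algebra in which `ϖ` is nilpotent. -/
theorem IsNull.exists_bound {c : ℕ → R} (hc : W.IsNull c) (B : NilAlg W) :
    ∃ N, ∀ j ≥ N, B.str (c j) = 0 := by
  obtain ⟨n, hn⟩ := B.nil
  refine (hc n).imp fun N hN j hj => ?_
  obtain ⟨d, hd⟩ := hN j hj
  rw [hd, map_mul, map_pow, hn, zero_mul]

variable (W) [W.IsUniformized]

theorem isUnit_or_dvd (x : R) : IsUnit x ∨ W.ϖ ∣ x := IsUniformized.isUnit_or_dvd x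

theorem isUnit_iff {x : R} : IsUnit x ↔ ¬ W.ϖ ∣ x :=
  ⟨fun h h' => IsUniformized.not_isUnit (W := W) (isUnit_of_dvd_unit h' h),
    fun h => (W.isUnit_or_dvd x).resolve_right h⟩

theorem dvd_mul_iff {x y : R} : W.ϖ ∣ x * y ↔ W.ϖ ∣ x ∨ W.ϖ ∣ y := by
  refine ⟨fun h => ?_, fun h => h.elim (fun h => h.mul_right _) (fun h => h.mul_left _)⟩
  by_contra! hc
  rw [← W.isUnit_iff, ← W.isUnit_iff] at hc
  exact W.isUnit_iff.1 (hc.1.mul hc.2) h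

theorem dvd_of_dvd_pow {x : R} {n : ℕ} (h : W.ϖ ∣ x ^ n) : W.ϖ ∣ x := by
  by_contra hc
  rw [← W.isUnit_iff] at hc
  exact W.isUnit_iff.1 (hc.pow n) h

theorem dvd_φ_iff {x : R} : W.ϖ ∣ W.φ x ↔ W.ϖ ∣ x := by
  constructor
  · intro h
    by_contra hc
    rw [← W.isUnit_iff] at hc
    exact W.isUnit_iff.1 (hc.map W.φ) h
  · intro h
    have := map_dvd W.φ h
    rwa [W.φ_ϖ] at this

theorem eq_zero_of_forall_dvd {x : R} (h : ∀ n : ℕ, W.ϖ ^ n ∣ x) : x = 0 := IsUniformized.hausdorff x h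

end WittBase

/-- The additive polynomials in characteristic `p` have only terms of degree a power of `p`. -/
theorem Polynomial.eq_pow_of_coeff_ne_zero {S : Type*} [CommRing S] {p : ℕ} (hp : p.Prime)
    (hS : (p : S) = 0) (P : Polynomial S)
    (hP : P.eval₂ (Polynomial.C.comp Polynomial.C) (Polynomial.X + Polynomial.C Polynomial.X) =
      P.eval₂ (Polynomial.C.comp Polynomial.C) Polynomial.X +
      P.eval₂ (Polynomial.C.comp Polynomial.C) (Polynomial.C Polynomial.X : Polynomial (Polynomial S)))
    {k : ℕ} (hk : P.coeff k ≠ 0) : ∃ j, k = p ^ j := by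
  have key : ∀ i n : ℕ, i ≠ 0 → n ≠ 0 → ((n + i).choose i : S) * P.coeff (n + i) = 0 := by
    intro i n hi hn
    have h1 : P.eval₂ (Polynomial.C.comp Polynomial.C) (Polynomial.X + Polynomial.C Polynomial.X) =
        Polynomial.taylor Polynomial.X (P.map Polynomial.C) := by
      rw [Polynomial.taylor_apply, Polynomial.comp, Polynomial.eval₂_map]
    have h2 : P.eval₂ (Polynomial.C.comp Polynomial.C) Polynomial.X = P.map Polynomial.C := by
      rw [← Polynomial.eval₂_map, Polynomial.eval₂_C_X]
    have h3 : P.eval₂ (Polynomial.C.comp Polynomial.C)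
        (Polynomial.C Polynomial.X : Polynomial (Polynomial S)) = Polynomial.C P := by
      rw [← Polynomial.hom_eval₂, Polynomial.eval₂_C_X]
    rw [h1, h2, h3] at hP
    have h4 := congrArg (fun Q => (Polynomial.coeff Q i).coeff n) hP
    simp only [Polynomial.coeff_add, Polynomial.coeff_map, Polynomial.coeff_C, if_neg hi, if_neg hn,
      Polynomial.taylor_coeff] at h4
    have h5 : Polynomial.hasseDeriv i (P.map Polynomial.C) =
        (Polynomial.hasseDeriv i P).map (Polynomial.C : S →+* Polynomial S) := by
      ext1 j
      simp [Polynomial.hasseDeriv_coeff]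
    rw [h5, Polynomial.eval_map, Polynomial.eval₂_C_X, Polynomial.hasseDeriv_coeff] at h4
    simpa [hn] using h4
  have hk0 : k ≠ 0 := by
    rintro rfl
    have h4 := congrArg (fun Q => (Polynomial.coeff Q 0).coeff 0) hP
    rw [← Polynomial.eval₂_map, ← Polynomial.eval₂_map, ← Polynomial.hom_eval₂,
      Polynomial.eval₂_C_X, Polynomial.eval₂_C_X] at h4
    have h1 : (P.map Polynomial.C).eval₂ Polynomial.C (Polynomial.X + Polynomial.C Polynomial.X) =
        Polynomial.taylor Polynomial.X (P.map Polynomial.C) := by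
      rw [Polynomial.taylor_apply, Polynomial.comp]
    rw [h1] at h4
    simp [Polynomial.taylor_coeff_zero, Polynomial.eval_map, Polynomial.eval₂_C_X] at h4
    exact hk h4
  obtain ⟨v, l, hl, rfl⟩ := Nat.exists_eq_pow_mul_and_not_dvd hk0 p hp.ne_one
  refine ⟨v, ?_⟩
  by_contra hne
  have hl1 : l ≠ 1 := by rintro rfl; simp at hne
  have hl0 : l ≠ 0 := by rintro rfl; simp at hl
  have : Fact p.Prime := ⟨hp⟩
  -- `l - 1` is the number of the remaining factors `p ^ v`.
  have hsplit : p ^ v * l = p ^ v * (l - 1) + p ^ v := by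
    rw [← Nat.mul_succ]; congr 1; omega
  have hpv : p ^ v ≠ 0 := pow_ne_zero _ hp.ne_zero
  have h6 := key (p ^ v) (p ^ v * (l - 1)) hpv (mul_ne_zero hpv (by omega))
  rw [← hsplit] at h6
  have hchoose : ∀ w : ℕ, (p ^ w * l).choose (p ^ w) ≡ l [MOD p] := by
    intro w
    induction w with
    | zero => simp; rfl
    | succ w ih =>
      have := Choose.choose_mul_mul_modEq_choose_nat (p := p) (a := p ^ w * l) (b := p ^ w)
      rw [← mul_assoc, ← pow_succ'] at this
      exact this.trans ih
  have hco : Nat.Coprime ((p ^ v * l).choose (p ^ v)) p := by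
    refine Nat.Coprime.symm ((Nat.Prime.coprime_iff_not_dvd hp).2 fun hd => hl ?_)
    exact (Nat.modEq_zero_iff_dvd.1 ((hchoose v).symm.trans (Nat.modEq_zero_iff_dvd.2 hd)))
  have hu : IsUnit (((p ^ v * l).choose (p ^ v) : ℕ) : S) := by
    have h7 := (Nat.isCoprime_iff_coprime.2 hco)
    obtain ⟨a, b, hab⟩ := h7
    have h8 := congrArg (Int.cast : ℤ → S) hab
    push_cast at h8
    rw [hS, mul_zero, add_zero] at h8
    exact .of_mul_eq_one_right _ h8
  exact hk (hu.mul_right_eq_zero.1 h6)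

namespace NilAlg

variable {R : Type u} [CommRing R] (W : WittBase R)

/-- The polynomial ring in one variable over `R / ϖ ^ n`, which carries the generic point of the affine line
on algebras in which `ϖ ^ n` vanishes. -/
noncomputable abbrev poly (n : ℕ) : NilAlg W :=
  ⟨Polynomial (R ⧸ Ideal.span {W.ϖ ^ n}), Polynomial.C.comp (Ideal.Quotient.mk _), n, by
    rw [← map_pow, RingHom.comp_apply, Ideal.Quotient.mk_singleton_self, map_zero]⟩

/-- The polynomial ring in two variables over `R / ϖ ^ n`. -/
noncomputable abbrev poly₂ (n : ℕ) : NilAlg W :=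
  ⟨Polynomial (Polynomial (R ⧸ Ideal.span {W.ϖ ^ n})),
    (Polynomial.C.comp Polynomial.C).comp (Ideal.Quotient.mk _), n, by
    rw [← map_pow, RingHom.comp_apply, Ideal.Quotient.mk_singleton_self, map_zero]⟩

variable {W}

/-- The structure map of an algebra in which `ϖ ^ n` vanishes, on the quotient `R / ϖ ^ n`. -/
def quotStr (B : NilAlg W) {n : ℕ} (h : B.str W.ϖ ^ n = 0) : R ⧸ Ideal.span {W.ϖ ^ n} →+* B.carrier :=
  Ideal.Quotient.lift _ B.str fun x hx => by
    obtain ⟨y, rfl⟩ := Ideal.mem_span_singleton.1 hx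
    rw [map_mul, map_pow, h, zero_mul]

/-- The homomorphism from the polynomial ring that sends the variable to `b`. -/
noncomputable def evalHom (B : NilAlg W) {n : ℕ} (h : B.str W.ϖ ^ n = 0) (b : B.carrier) :
    Hom (poly W n) B :=
  ⟨Polynomial.eval₂RingHom (B.quotStr h) b, by
    ext r
    exact Polynomial.eval₂_C _ _⟩

theorem evalHom_X (B : NilAlg W) {n : ℕ} (h : B.str W.ϖ ^ n = 0) (b : B.carrier) :
    (B.evalHom h b).toRingHom (Polynomial.X : Polynomial (R ⧸ Ideal.span {W.ϖ ^ n})) = b :=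
  Polynomial.eval₂_X _ _

end NilAlg

/-- A family of self-maps of the points of the additive group. -/
abbrev GaFun {R : Type u} [CommRing R] (W : WittBase R) := ∀ B : NilAlg W, B.carrier → B.carrier

namespace GaFun

open Finset

variable {R : Type u} [CommRing R] {W : WittBase R}

/-- The family `f` is a natural endomorphism of the additive group. -/
structure IsEnd (f : GaFun W) : Prop where
  map_add : ∀ (B : NilAlg W) (x y : B.carrier), f B (x + y) = f B x + f B y
  natural : ∀ {B C : NilAlg W} (g : NilAlg.Hom B C) (x : B.carrier),
    f C (g.toRingHom x) = g.toRingHom (f B x)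

/-- The family `f` is given by the restricted power series `∑ c_j x ^ (p ^ j)`. The sum is finite on each
algebra, and may be cut off wherever the remaining coefficients vanish in the algebra. -/
structure HasCoef (f : GaFun W) (c : ℕ → R) : Prop where
  null : W.IsNull c
  eq_sum : ∀ (B : NilAlg W) (b : B.carrier) (N : ℕ), (∀ j ≥ N, B.str (c j) = 0) →
    f B b = ∑ j ∈ range N, B.str (c j) * b ^ W.p ^ j

theorem sum_range_eq_of_bound {S : Type*} [CommRing S] {c : ℕ → S} {M N : ℕ} (hM : ∀ j ≥ M, c j = 0)
    (hN : ∀ j ≥ N, c j = 0) : ∑ j ∈ range M, c j = ∑ j ∈ range N, c j := by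
  wlog h : M ≤ N generalizing M N
  · exact (this hN hM (le_of_not_ge h)).symm
  refine sum_subset (range_mono h) fun j _ hj => hM j (by simpa using hj)

/-- It suffices to compare with one sufficiently long partial sum on each algebra. -/
theorem HasCoef.of_bound {f : GaFun W} {c : ℕ → R} (hc : W.IsNull c)
    (h : ∀ (B : NilAlg W) (b : B.carrier), ∃ N, (∀ j ≥ N, B.str (c j) = 0) ∧
      f B b = ∑ j ∈ range N, B.str (c j) * b ^ W.p ^ j) : HasCoef f c :=
  ⟨hc, fun B b N hN => by
    obtain ⟨M, hM, h⟩ := h B b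
    rw [h]
    exact sum_range_eq_of_bound (fun j hj => by rw [hM j hj, zero_mul])
      (fun j hj => by rw [hN j hj, zero_mul])⟩

theorem HasCoef.funext {f g : GaFun W} {c : ℕ → R} (hf : HasCoef f c) (hg : HasCoef g c) : f = g := by
  ext B b
  obtain ⟨N, hN⟩ := hf.null.exists_bound B
  rw [hf.eq_sum B b N hN, hg.eq_sum B b N hN]

theorem HasCoef.isEnd {f : GaFun W} {c : ℕ → R} (hf : HasCoef f c) : IsEnd f where
  map_add B x y := by
    obtain ⟨N, hN⟩ := hf.null.exists_bound B
    simp only [hf.eq_sum B _ N hN, W.add_pow_p B.str, mul_add, sum_add_distrib]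
  natural {B C} g x := by
    obtain ⟨N, hN⟩ := hf.null.exists_bound B
    have hC : ∀ r, C.str r = g.toRingHom (B.str r) := fun r => by rw [← g.comp_str]; rfl
    have hN' : ∀ j ≥ N, C.str (c j) = 0 := fun j hj => by
      rw [hC, hN j hj, map_zero]
    rw [hf.eq_sum B x N hN, hf.eq_sum C _ N hN', map_sum]
    refine sum_congr rfl fun j _ => ?_
    rw [hC, map_mul, map_pow]

/-- Every null sequence is a sequence of coefficients. -/
theorem exists_hasCoef_of_isNull {c : ℕ → R} (hc : W.IsNull c) : ∃ f : GaFun W, HasCoef f c := by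
  choose N hN using fun B => hc.exists_bound B
  exact ⟨fun B b => ∑ j ∈ range (N B), B.str (c j) * b ^ W.p ^ j,
    .of_bound hc fun B b => ⟨N B, hN B, rfl⟩⟩

/-- The coefficients can be read off at the generic point. -/
theorem HasCoef.coeff_generic {f : GaFun W} {c : ℕ → R} (hf : HasCoef f c) (n k : ℕ) :
    Polynomial.coeff (f (NilAlg.poly W n) (Polynomial.X : Polynomial (R ⧸ Ideal.span {W.ϖ ^ n})))
      (W.p ^ k) = Ideal.Quotient.mk _ (c k) := by
  obtain ⟨N, hN⟩ := hf.null.exists_bound (NilAlg.poly W n)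
  have hM : ∀ j ≥ max N (k + 1), (NilAlg.poly W n).str (c j) = 0 := fun j hj =>
    hN j ((le_max_left _ _).trans hj)
  rw [hf.eq_sum _ _ _ hM]
  have : ∀ j, (NilAlg.poly W n).str (c j) = Polynomial.C (Ideal.Quotient.mk _ (c j)) := fun _ => rfl
  simp only [this]
  refine (Polynomial.finsetSum_coeff _ _ _).trans ?_
  rw [sum_eq_single_of_mem k (by simp)]
  · rw [Polynomial.coeff_C_mul]; exact (congrArg _ (Polynomial.coeff_X_pow_self _)).trans (mul_one _)
  · intro j _ hj
    rw [Polynomial.coeff_C_mul]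
    refine (congrArg _ (Polynomial.coeff_X_pow _ _)).trans ?_
    rw [if_neg fun h => hj (W.p_pow_injective h).symm, mul_zero]

/-- Two sequences of coefficients agree modulo `ϖ` as soon as the families agree on algebras in which `ϖ`
vanishes. -/
theorem HasCoef.dvd_sub_of_eq {f g : GaFun W} {c d : ℕ → R} (hf : HasCoef f c) (hg : HasCoef g d)
    (h : ∀ B : NilAlg W, B.str W.ϖ = 0 → ∀ b, f B b = g B b) (k : ℕ) : W.ϖ ∣ c k - d k := by
  rw [← Ideal.mem_span_singleton, ← pow_one W.ϖ, ← Ideal.Quotient.eq, ← hf.coeff_generic,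
    ← hg.coeff_generic, h]
  change Polynomial.C (Ideal.Quotient.mk _ W.ϖ) = _
  rw [← map_zero Polynomial.C]
  congr 1
  exact Ideal.Quotient.eq_zero_iff_mem.2 (Ideal.mem_span_singleton.2 (by rw [pow_one]))

variable [W.IsUniformized]

theorem HasCoef.unique {f : GaFun W} {c d : ℕ → R} (hf : HasCoef f c) (hf' : HasCoef f d) : c = d := by
  ext k
  refine sub_eq_zero.1 (W.eq_zero_of_forall_dvd fun n => ?_)
  rw [← Ideal.mem_span_singleton, ← Ideal.Quotient.eq, ← hf.coeff_generic, ← hf'.coeff_generic]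

/-- Natural endomorphisms of the additive group are restricted power series in the powers
`x ^ (p ^ j)`. -/
theorem IsEnd.exists_hasCoef {f : GaFun W} (hf : IsEnd f) : ∃ c, HasCoef f c := by
  let P : ∀ n, Polynomial (R ⧸ Ideal.span {W.ϖ ^ n}) := fun n => f (NilAlg.poly W n) Polynomial.X
  have heval : ∀ (B : NilAlg W) (n : ℕ) (h : B.str W.ϖ ^ n = 0) (b : B.carrier),
      f B b = (P n).eval₂ (B.quotStr h) b := by
    intro B n h b
    conv_lhs => rw [← B.evalHom_X h b, hf.natural]
    rfl
  have hsupp : ∀ n k, (P n).coeff k ≠ 0 → ∃ j, k = W.p ^ j := by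
    intro n k hk
    refine Polynomial.eq_pow_of_coeff_ne_zero W.p_prime
      (W.natCast_p_map (Ideal.Quotient.mk (Ideal.span {W.ϖ ^ n}))) (P n) ?_ hk
    have hn : (NilAlg.poly₂ W n).str W.ϖ ^ n = 0 := by
      rw [← map_pow]
      change (Polynomial.C.comp Polynomial.C) (Ideal.Quotient.mk _ (W.ϖ ^ n)) = 0
      rw [Ideal.Quotient.mk_singleton_self, map_zero]
    have hstr : (NilAlg.poly₂ W n).quotStr hn = Polynomial.C.comp Polynomial.C := by
      refine Ideal.Quotient.ringHom_ext ?_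
      rfl
    have h := hf.map_add (NilAlg.poly₂ W n) Polynomial.X (Polynomial.C Polynomial.X)
    rw [heval _ n hn, heval _ n hn, heval _ n hn, hstr] at h
    exact h
  -- Lifts of the coefficients modulo the powers of `ϖ` form a Cauchy sequence.
  choose x hx using fun (k n : ℕ) => Ideal.Quotient.mk_surjective ((P n).coeff (W.p ^ k))
  have hcomp : ∀ k n, W.ϖ ^ n ∣ x k (n + 1) - x k n := by
    intro k n
    rw [← Ideal.mem_span_singleton, ← Ideal.Quotient.eq, hx]
    have h1 : (NilAlg.poly W n).str W.ϖ ^ (n + 1) = 0 := by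
      rw [← map_pow, pow_succ, map_mul]
      change Polynomial.C (Ideal.Quotient.mk _ (W.ϖ ^ n)) * _ = 0
      rw [Ideal.Quotient.mk_singleton_self, map_zero]; exact zero_mul _
    have h2 := heval (NilAlg.poly W n) (n + 1) h1 Polynomial.X
    have h3 : (NilAlg.poly W n).quotStr h1 = Polynomial.C.comp (Ideal.Quotient.factor
        (Ideal.span_singleton_le_span_singleton.2 (pow_dvd_pow W.ϖ n.le_succ))) := by
      refine Ideal.Quotient.ringHom_ext ?_
      rfl
    rw [h3, ← Polynomial.eval₂_map] at h2
    have h4 : P n = (P (n + 1)).map (Ideal.Quotient.factor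
        (Ideal.span_singleton_le_span_singleton.2 (pow_dvd_pow W.ϖ n.le_succ))) :=
      h2.trans Polynomial.eval₂_C_X
    rw [h4, Polynomial.coeff_map, ← hx]
    rfl
  choose c hc using fun k => WittBase.IsUniformized.precomplete (W := W) (x k) (hcomp k)
  have hcP : ∀ n k, (P n).coeff (W.p ^ k) = Ideal.Quotient.mk _ (c k) := by
    intro n k
    rw [← hx, eq_comm, Ideal.Quotient.eq, Ideal.mem_span_singleton]
    exact hc k n
  have hdeg : ∀ n k, (P n).natDegree ≤ k → (P n).coeff (W.p ^ k) = 0 := fun n k hk =>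
    Polynomial.coeff_eq_zero_of_natDegree_lt (hk.trans_lt (W.lt_p_pow k))
  refine ⟨c, .of_bound (fun n => ⟨(P n).natDegree, fun k hk => ?_⟩) fun B b => ?_⟩
  · rw [← Ideal.mem_span_singleton, ← Ideal.Quotient.eq_zero_iff_mem, ← hcP, hdeg n k hk]
  · obtain ⟨n, hn⟩ := B.nil
    have hB : ∀ k, B.str (c k) = B.quotStr hn ((P n).coeff (W.p ^ k)) := fun k => by rw [hcP]; rfl
    refine ⟨(P n).natDegree, fun k hk => by rw [hB, hdeg n k hk, map_zero], ?_⟩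
    have hP : P n = ∑ j ∈ range (P n).natDegree,
        Polynomial.C ((P n).coeff (W.p ^ j)) * Polynomial.X ^ W.p ^ j := by
      ext k
      simp only [Polynomial.finsetSum_coeff, Polynomial.coeff_C_mul_X_pow]
      by_cases hk : (P n).coeff k = 0
      · rw [hk, sum_eq_zero]
        intro j _
        split_ifs with h
        · rw [← h, hk]
        · rfl
      · obtain ⟨j, rfl⟩ := hsupp n k hk
        rw [sum_eq_single j]
        · simp
        · intro i _ hi
          rw [if_neg fun h => hi (W.p_pow_injective h).symm]
        · intro hj
          rw [if_pos rfl]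
          exact hdeg n j (by simpa using hj)
    rw [heval B n hn b]
    conv_lhs => rw [hP]
    rw [Polynomial.eval₂_finsetSum]
    refine sum_congr rfl fun j _ => ?_
    rw [Polynomial.eval₂_mul, Polynomial.eval₂_C, Polynomial.eval₂_X_pow, hB]

end GaFun

namespace GaFun

open Finset

variable {R : Type u} [CommRing R] {W : WittBase R}

theorem isNull_of_eq_zero {c : ℕ → R} (N : ℕ) (h : ∀ j ≥ N, c j = 0) : W.IsNull c :=
  fun _ => ⟨N, fun j hj => by rw [h j hj]; exact dvd_zero _⟩

theorem HasCoef.add {f g : GaFun W} {c d : ℕ → R} (hf : HasCoef f c) (hg : HasCoef g d) :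
    HasCoef (fun B b => f B b + g B b) (c + d) := by
  refine .of_bound (fun n => ?_) fun B b => ?_
  · obtain ⟨M, hM⟩ := hf.null n
    obtain ⟨N, hN⟩ := hg.null n
    exact ⟨max M N, fun j hj => dvd_add (hM j (le_of_max_le_left hj)) (hN j (le_of_max_le_right hj))⟩
  · obtain ⟨M, hM⟩ := hf.null.exists_bound B
    obtain ⟨N, hN⟩ := hg.null.exists_bound B
    have hM' : ∀ j ≥ max M N, B.str (c j) = 0 := fun j hj => hM j (le_of_max_le_left hj)
    have hN' : ∀ j ≥ max M N, B.str (d j) = 0 := fun j hj => hN j (le_of_max_le_right hj)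
    refine ⟨max M N, fun j hj => by rw [Pi.add_apply, map_add, hM' j hj, hN' j hj, add_zero], ?_⟩
    rw [hf.eq_sum B b _ hM', hg.eq_sum B b _ hN', ← sum_add_distrib]
    exact sum_congr rfl fun j _ => by rw [Pi.add_apply, map_add, add_mul]

theorem HasCoef.smul {f : GaFun W} {c : ℕ → R} (hf : HasCoef f c) (r : R) :
    HasCoef (fun B b => B.str r * f B b) (fun j => r * c j) := by
  refine .of_bound (hf.null.of_dvd fun j => dvd_mul_left _ _) fun B b => ?_
  obtain ⟨N, hN⟩ := hf.null.exists_bound B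
  refine ⟨N, fun j hj => by rw [map_mul, hN j hj, mul_zero], ?_⟩
  rw [hf.eq_sum B b _ hN, mul_sum]
  exact sum_congr rfl fun j _ => by rw [map_mul, mul_assoc]

theorem HasCoef.sub {f g : GaFun W} {c d : ℕ → R} (hf : HasCoef f c) (hg : HasCoef g d) :
    HasCoef (fun B b => f B b - g B b) (c - d) := by
  have h := hf.add (hg.smul (-1))
  convert h using 1
  · ext B b; simp [sub_eq_add_neg]
  · ext j; simp [sub_eq_add_neg]

theorem hasCoef_zero : HasCoef (fun _ _ => 0 : GaFun W) 0 :=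
  .of_bound (isNull_of_eq_zero 0 fun _ _ => rfl) fun B _ => ⟨0, fun _ _ => map_zero _, by simp⟩

/-- The coefficients of the power `x ^ (p ^ i)`. -/
theorem hasCoef_pow (i : ℕ) :
    HasCoef (fun _ b => b ^ W.p ^ i : GaFun W) (fun j => if j = i then 1 else 0) := by
  refine .of_bound (isNull_of_eq_zero (i + 1) fun j hj => if_neg (by omega)) fun B b =>
    ⟨i + 1, fun j hj => by rw [if_neg (by omega), map_zero], ?_⟩
  rw [sum_eq_single_of_mem i (by simp)]
  · simp
  · intro j _ hj; simp [hj]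

/-- The coefficients of the multiplication by `r`. -/
theorem hasCoef_mul (r : R) :
    HasCoef (fun B b => B.str r * b : GaFun W) (fun j => if j = 0 then r else 0) := by
  have h := (hasCoef_pow (W := W) 0).smul r
  convert h using 1
  · ext B b; simp
  · ext j; simp

/-- The twist of a family: its values on the algebras with twisted structure map. -/
theorem HasCoef.tw {f : GaFun W} {c : ℕ → R} (hf : HasCoef f c) :
    HasCoef (fun B b => f B.tw b) (fun j => W.φ (c j)) :=
  ⟨hf.null.map_φ, fun B b N hN => hf.eq_sum B.tw b N hN⟩

theorem IsNull.comp {c d : ℕ → R} (hc : W.IsNull c) (hd : W.IsNull d) :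
    W.IsNull fun k => ∑ x ∈ antidiagonal k, c x.1 * d x.2 ^ W.p ^ x.1 := by
  intro n
  obtain ⟨M, hM⟩ := hc n
  obtain ⟨N, hN⟩ := hd n
  refine ⟨M + N, fun k hk => dvd_sum fun x hx => ?_⟩
  rw [HasAntidiagonal.mem_antidiagonal] at hx
  by_cases h : M ≤ x.1
  · exact (hM _ h).mul_right _
  · refine Dvd.dvd.mul_left ((hN x.2 (by omega)).trans (dvd_pow_self _ ?_)) _
    exact pow_ne_zero _ W.p_prime.ne_zero

/-- The coefficients of a composition are the twisted convolution of the coefficients. -/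
theorem HasCoef.comp {f g : GaFun W} {c d : ℕ → R} (hf : HasCoef f c) (hg : HasCoef g d) :
    HasCoef (fun B b => f B (g B b))
      (fun k => ∑ x ∈ antidiagonal k, c x.1 * d x.2 ^ W.p ^ x.1) := by
  refine .of_bound (IsNull.comp hf.null hg.null) fun B b => ?_
  obtain ⟨M, hM⟩ := hf.null.exists_bound B
  obtain ⟨N, hN⟩ := hg.null.exists_bound B
  have hz : ∀ x : ℕ × ℕ, ¬ (x.1 < M ∧ x.2 < N) → B.str (c x.1 * d x.2 ^ W.p ^ x.1) = 0 := by
    intro x hx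
    rw [map_mul, map_pow]
    by_cases h : x.1 < M
    · rw [hN x.2 (by omega), zero_pow (pow_ne_zero _ W.p_prime.ne_zero), mul_zero]
    · rw [hM x.1 (by omega), zero_mul]
  refine ⟨M + N, fun k hk => ?_, ?_⟩
  · rw [map_sum]
    refine sum_eq_zero fun x hx => hz x ?_
    rw [HasAntidiagonal.mem_antidiagonal] at hx
    omega
  · have h1 : ∀ k ∈ range (M + N), B.str (∑ x ∈ antidiagonal k, c x.1 * d x.2 ^ W.p ^ x.1) *
        b ^ W.p ^ k = ∑ x ∈ antidiagonal k, B.str (c x.1 * d x.2 ^ W.p ^ x.1) * b ^ W.p ^ (x.1 + x.2) := by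
      intro k _
      rw [map_sum, sum_mul]
      exact sum_congr rfl fun x hx => by rw [HasAntidiagonal.mem_antidiagonal.1 hx]
    rw [sum_congr rfl h1, hf.eq_sum B _ M hM, hg.eq_sum B _ N hN, sum_sigma']
    simp only [W.sum_pow_p B.str, mul_sum]
    rw [sum_sigma']
    refine sum_of_injOn (fun x => ⟨x.1 + x.2, (x.1, x.2)⟩) ?_ ?_ ?_ ?_
    · rintro ⟨i, j⟩ _ ⟨i', j'⟩ _ h
      simp only [Sigma.mk.injEq, heq_eq_eq] at h
      grind
    · rintro ⟨i, j⟩ h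
      simp only [coe_sigma, Set.mem_sigma_iff, mem_coe, mem_range, HasAntidiagonal.mem_antidiagonal] at h ⊢
      exact ⟨by omega, trivial⟩
    · rintro ⟨k, i, j⟩ hk h
      rw [mem_sigma, HasAntidiagonal.mem_antidiagonal] at hk
      rw [hz _ fun hx => h ?_, zero_mul]
      refine ⟨⟨i, j⟩, by simpa using hx, ?_⟩
      have hk' : i + j = k := hk.2
      subst hk'
      rfl
    · rintro ⟨i, j⟩ _
      simp only [map_mul, map_pow, mul_pow, ← pow_mul, pow_add]
      rw [mul_assoc, mul_comm (W.p ^ j)]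

/-- On multiples of `ε` only the coefficient of the linear term matters. -/
theorem HasCoef.apply_eps {f : GaFun W} {c : ℕ → R} (hf : HasCoef f c) (B : NilAlg W) (b : B.carrier) :
    f B.dual (B.eps b) = B.eps (B.str (c 0) * b) := by
  obtain ⟨N, hN⟩ := hf.null.exists_bound B.dual
  rw [hf.eq_sum _ _ (N + 1) fun j hj => hN j (by omega), sum_range_succ', sum_eq_zero]
  · rw [zero_add, pow_zero, pow_one]
    exact TrivSqZeroExt.inl_mul_inr _ _
  · intro j _
    have h2 : 2 ≤ W.p ^ (j + 1) := by
      have := W.lt_p_pow (j + 1)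
      omega
    have h0 : B.eps b ^ 2 = 0 := by
      rw [pow_two]; exact TrivSqZeroExt.inr_mul_inr B.carrier b b
    rw [pow_eq_zero_of_le h2 h0, mul_zero]

/-- A family that vanishes on algebras in which `ϖ` does is a multiple of `ϖ`. -/
theorem HasCoef.exists_eq_ϖ_mul {f : GaFun W} {c : ℕ → R} (hf : HasCoef f c) (h : ∀ k, W.ϖ ∣ c k) :
    ∃ (g : GaFun W) (d : ℕ → R), HasCoef g d ∧ ∀ B b, f B b = B.str W.ϖ * g B b := by
  choose d hd using h
  have hnull : W.IsNull d := fun n => (hf.null (n + 1)).imp fun N hN j hj => by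
    obtain ⟨y, hy⟩ := hN j hj
    exact ⟨y, W.ϖ_cancel (by rw [← hd, hy, pow_succ']; ring)⟩
  obtain ⟨g, hg⟩ := exists_hasCoef_of_isNull hnull
  refine ⟨g, d, hg, fun B b => ?_⟩
  have h2 : HasCoef f (fun j => W.ϖ * d j) := by
    convert hf using 1
    ext j; rw [hd]
  rw [h2.funext (hg.smul W.ϖ)]

variable [W.IsUniformized]

/-- The linear coefficient is determined by the values on multiples of `ε`. -/
theorem HasCoef.coef_zero_eq {f : GaFun W} {c : ℕ → R} (hf : HasCoef f c) (r : R)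
    (h : ∀ (B : NilAlg W) (b : B.carrier), f B.dual (B.eps b) = B.eps (B.str r * b)) : c 0 = r := by
  refine sub_eq_zero.1 (W.eq_zero_of_forall_dvd fun n => ?_)
  rw [← Ideal.mem_span_singleton, ← Ideal.Quotient.eq]
  have h1 := h (NilAlg.poly W n) 1
  rw [hf.apply_eps] at h1
  have h2 : (NilAlg.poly W n).str (c 0) * 1 = (NilAlg.poly W n).str r * 1 :=
    TrivSqZeroExt.inr_injective h1
  rw [mul_one, mul_one] at h2
  exact Polynomial.C_injective h2

theorem IsEnd.eq_zero_of_ϖ_mul {f : GaFun W} (hf : IsEnd f) (h : ∀ B b, B.str W.ϖ * f B b = 0) :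
    ∀ B b, f B b = 0 := by
  obtain ⟨c, hc⟩ := hf.exists_hasCoef
  have h1 : HasCoef (fun _ _ => 0 : GaFun W) (fun j => W.ϖ * c j) := by
    convert hc.smul W.ϖ using 1
    ext B b; rw [h]
  have h2 : c = 0 := by
    ext j
    exact W.torsionFree _ (congrFun (h1.unique hasCoef_zero) j)
  subst h2
  intro B b
  rw [hc.funext hasCoef_zero]

/-- If a composition with `T` vanishes modulo `ϖ` and `T` does not, the other factor does. -/
theorem dvd_coef_of_dvd_comp {c a : ℕ → R} (ha : ∃ s, ¬ W.ϖ ∣ a s)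
    (h : ∀ k, W.ϖ ∣ ∑ x ∈ antidiagonal k, c x.1 * a x.2 ^ W.p ^ x.1) : ∀ k, W.ϖ ∣ c k := by
  classical
  by_contra! hc
  -- The product of the lowest terms that are not divisible by `ϖ` is not divisible by `ϖ`.
  let s := Nat.find ha
  let i := Nat.find hc
  have hs : ¬ W.ϖ ∣ a s := Nat.find_spec ha
  have hi : ¬ W.ϖ ∣ c i := Nat.find_spec hc
  have h1 := h (i + s)
  rw [← add_sum_erase _ _ (HasAntidiagonal.mem_antidiagonal.2 rfl : (i, s) ∈ antidiagonal (i + s))] at h1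
  have h2 : W.ϖ ∣ ∑ x ∈ (antidiagonal (i + s)).erase (i, s), c x.1 * a x.2 ^ W.p ^ x.1 := by
    refine dvd_sum fun x hx => ?_
    rw [mem_erase, HasAntidiagonal.mem_antidiagonal] at hx
    by_cases hxi : x.1 < i
    · exact Dvd.dvd.mul_right (not_not.1 (Nat.find_min hc hxi)) _
    · have hxs : x.2 < s := by
        by_contra hxs
        exact hx.1 (Prod.ext (by dsimp only; omega) (by dsimp only; omega))
      exact Dvd.dvd.mul_left ((not_not.1 (Nat.find_min ha hxs)).trans
        (dvd_pow_self _ (pow_ne_zero _ W.p_prime.ne_zero))) _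
  rcases W.dvd_mul_iff.1 ((dvd_add_left h2).1 h1) with h4 | h4
  · exact hi h4
  · exact hs (W.dvd_of_dvd_pow h4)

/-- An endomorphism `f` with `f T = ϖ f` vanishes if `T` does not vanish modulo `ϖ`. -/
theorem IsEnd.eq_zero_of_comp_eq {f T : GaFun W} (hf : IsEnd f) {a : ℕ → R} (hT : HasCoef T a)
    (ha : ∃ s, ¬ W.ϖ ∣ a s) (h : ∀ B b, f B (T B b) = B.str W.ϖ * f B b) : ∀ B b, f B b = 0 := by
  have key : ∀ n : ℕ, ∀ (f : GaFun W) (c : ℕ → R), HasCoef f c →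
      (∀ B b, f B (T B b) = B.str W.ϖ * f B b) → ∀ k, W.ϖ ^ n ∣ c k := by
    intro n
    induction n with
    | zero => intro f c _ _ k; simp
    | succ n ih =>
      intro f c hc h
      have h1 : HasCoef (fun B b => f B (T B b)) (fun j => W.ϖ * c j) := by
        convert hc.smul W.ϖ using 1
        ext B b; rw [h]
      have h2 := dvd_coef_of_dvd_comp ha (c := c) fun k => by
        rw [congrFun ((hc.comp hT).unique h1) k]; exact dvd_mul_right _ _
      obtain ⟨g, d, hd, hg⟩ := hc.exists_eq_ϖ_mul h2
      have h3 := ih g d hd fun B b => by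
        have hcomp : IsEnd fun B b => g B (T B b) - B.str W.ϖ * g B b :=
          ((hd.comp hT).sub (hd.smul W.ϖ)).isEnd
        refine sub_eq_zero.1 (hcomp.eq_zero_of_ϖ_mul (fun B b => ?_) B b)
        have := h B b
        rw [hg, hg] at this
        rw [mul_sub, this, sub_self]
      intro k
      have h4 : HasCoef f (fun j => W.ϖ * d j) := by
        convert hd.smul W.ϖ using 1
        ext B b; rw [hg]
      rw [congrFun (hc.unique h4) k, pow_succ']
      exact mul_dvd_mul_left _ (h3 k)
  obtain ⟨c, hc⟩ := hf.exists_hasCoef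
  have h0 : c = 0 := by
    ext k
    exact W.eq_zero_of_forall_dvd fun n => key n f c hc h k
  subst h0
  intro B b
  rw [hc.funext hasCoef_zero]

end GaFun

/-! ### Linearizing an endomorphism of the additive group -/

namespace WittBase

variable {R : Type u} [CommRing R] (W : WittBase R)

theorem isUnit_one_sub_ϖ_pow [W.IsUniformized] {n : ℕ} (hn : n ≠ 0) : IsUnit (1 - W.ϖ ^ n) := by
  rw [W.isUnit_iff]
  intro h
  have h1 := dvd_add h (dvd_pow_self W.ϖ hn)
  rw [sub_add_cancel] at h1
  exact IsUniformized.not_isUnit (W := W) (isUnit_of_dvd_one h1)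

end WittBase

namespace GaFun

open Finset

variable {R : Type u} [CommRing R] {W : WittBase R} [W.IsUniformized]

/-- An endomorphism without linear term that intertwines an endomorphism with linear coefficient `ϖ` and
the multiplication by `ϖ` vanishes: its lowest coefficient `c_k` satisfies `c_k ϖ ^ (p ^ k) = ϖ c_k`. -/
theorem HasCoef.eq_zero_of_coef_zero {f T : GaFun W} {c t : ℕ → R} (hf : HasCoef f c) (hT : HasCoef T t)
    (ht : t 0 = W.ϖ) (h : ∀ B b, f B (T B b) = B.str W.ϖ * f B b) (h0 : c 0 = 0) :
    ∀ B b, f B b = 0 := by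
  have h1 : HasCoef (fun B b => f B (T B b)) (fun j => W.ϖ * c j) := by
    convert hf.smul W.ϖ using 1
    ext B b; rw [h]
  have hc : ∀ k, c k = 0 := by
    intro k
    induction k using Nat.strong_induction_on with
    | _ k ih =>
      rcases eq_or_ne k 0 with rfl | hk
      · exact h0
      have h2 := congrFun ((hf.comp hT).unique h1) k
      rw [sum_eq_single_of_mem (k, 0) (by simp)] at h2
      · dsimp only at h2
        have hp : W.p ^ k = W.p ^ k - 1 + 1 := by
          have := W.lt_p_pow k
          omega
        rw [ht, hp, pow_succ] at h2
        have h3 : c k * (1 - W.ϖ ^ (W.p ^ k - 1)) = 0 :=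
          W.torsionFree _ (by linear_combination -h2)
        refine (W.isUnit_one_sub_ϖ_pow ?_).mul_left_eq_zero.1 h3
        have := W.lt_p_pow k
        omega
      · rintro ⟨i, l⟩ hx hne
        rw [HasAntidiagonal.mem_antidiagonal] at hx
        dsimp only at hx
        have : i ≠ k := by
          rintro rfl
          exact hne (Prod.ext rfl (by dsimp only; omega))
        rw [ih i (by omega), zero_mul]
  have h4 : c = 0 := _root_.funext hc
  subst h4
  intro B b
  rw [hf.funext hasCoef_zero]

/-- The coefficients `ϑ_0 = 1` and `ϑ_j = u_j ϖ ^ (j - 1) ∑_{i < j} ϑ_i s_{i j}`. -/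
noncomputable def linCoef (W : WittBase R) (u : ℕ → R) (s : ℕ → ℕ → R) : ℕ → R
  | 0 => 1
  | j + 1 => u (j + 1) * W.ϖ ^ j * ∑ i : Fin (j + 1), linCoef W u s i * s i (j + 1)
termination_by j => j
decreasing_by exact i.2

/-- An endomorphism with linear coefficient `ϖ` whose further coefficients are divisible by sufficiently high
powers of `ϖ` is linearized by a restricted power series with linear coefficient `1`. -/
theorem exists_linearization {T : GaFun W} {t : ℕ → R} (hT : HasCoef T t) (h0 : t 0 = W.ϖ)
    (h : ∀ l, W.ϖ ^ l ∣ t l) :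
    ∃ (f : GaFun W) (c : ℕ → R), HasCoef f c ∧ c 0 = 1 ∧ ∀ B b, f B (T B b) = B.str W.ϖ * f B b := by
  have hs : ∀ i j, ∃ s, i < j → t (j - i) ^ W.p ^ i = W.ϖ ^ j * s := by
    intro i j
    by_cases hij : i < j
    · obtain ⟨w, hw⟩ := h (j - i)
      have hexp : j ≤ (j - i) * W.p ^ i := by
        have h1 := W.lt_p_pow i
        have h2 : (j - i - 1) * 1 ≤ (j - i - 1) * W.p ^ i := Nat.mul_le_mul_left _ (by omega)
        have h3 : (j - i) * W.p ^ i = (j - i - 1) * W.p ^ i + W.p ^ i := by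
          rw [← Nat.succ_mul]; congr 1; omega
        omega
      obtain ⟨v, hv⟩ := pow_dvd_pow W.ϖ hexp
      exact ⟨v * w ^ W.p ^ i, fun _ => by rw [hw, mul_pow, ← pow_mul, hv, mul_assoc]⟩
    · exact ⟨0, fun h => absurd h hij⟩
  choose s hs using hs
  have hu : ∀ j, ∃ u, j ≠ 0 → (1 - W.ϖ ^ (W.p ^ j - 1)) * u = 1 := by
    intro j
    rcases eq_or_ne j 0 with rfl | hj
    · exact ⟨0, fun h => absurd rfl h⟩
    · have h1 : W.p ^ j - 1 ≠ 0 := by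
        have := W.lt_p_pow j
        omega
      obtain ⟨u, hu⟩ := (W.isUnit_one_sub_ϖ_pow h1).exists_right_inv
      exact ⟨u, fun _ => hu⟩
  choose u hu using hu
  have hnull : W.IsNull (linCoef W u s) := fun n => ⟨n + 1, fun j hj => by
    obtain ⟨j, rfl⟩ : ∃ i, j = i + 1 := ⟨j - 1, by omega⟩
    rw [linCoef]
    exact ((pow_dvd_pow _ (by omega)).mul_left _).mul_right _⟩
  obtain ⟨f, hf⟩ := exists_hasCoef_of_isNull hnull
  refine ⟨f, _, hf, by rw [linCoef], ?_⟩
  have hcoef : (fun k => ∑ x ∈ antidiagonal k, linCoef W u s x.1 * t x.2 ^ W.p ^ x.1) =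
      fun j => W.ϖ * linCoef W u s j := by
    ext k
    rw [Nat.sum_antidiagonal_eq_sum_range_succ_mk, sum_range_succ, Nat.sub_self, h0]
    rcases k with _ | k
    · simp [mul_comm]
    · have h1 : ∑ i ∈ range (k + 1), linCoef W u s i * t (k + 1 - i) ^ W.p ^ i =
          W.ϖ ^ (k + 1) * ∑ i : Fin (k + 1), linCoef W u s i * s i (k + 1) := by
        rw [mul_sum, ← Fin.sum_univ_eq_sum_range
          (fun i => linCoef W u s i * t (k + 1 - i) ^ W.p ^ i)]
        refine Fintype.sum_congr _ _ fun i => ?_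
        rw [hs i (k + 1) i.2]; ring
      have hp : W.p ^ (k + 1) = W.p ^ (k + 1) - 1 + 1 := by
        have := W.lt_p_pow (k + 1)
        omega
      dsimp only
      rw [h1]
      have h2 := hu (k + 1) k.succ_ne_zero
      generalize hS : ∑ i : Fin (k + 1), linCoef W u s i * s i (k + 1) = S
      have h3 : linCoef W u s (k + 1) = u (k + 1) * W.ϖ ^ k * S := by rw [linCoef, hS]
      rw [h3]
      conv_lhs => rw [hp, pow_succ W.ϖ (W.p ^ (k + 1) - 1)]
      linear_combination (-(W.ϖ ^ (k + 1) * S)) * h2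
  have h1 := hf.comp hT
  rw [hcoef] at h1
  exact fun B b => congrFun (congrFun (h1.funext (hf.smul W.ϖ)) B) b

end GaFun

/-! ### Verschiebung, top components, and the Frobenius modulo `ϖ` -/

namespace WittBase.Witt

open Finset MvPolynomial

variable {R : Type u} [CommRing R] {W : WittBase R} {n : ℕ} {B : Type*} [CommRing B] {ρ : R →+* B}

theorem ghost_str (r : R) (i : Fin (n + 1)) : ghost W (str W n ρ r) i = ρ ((W.φ^[i]) r) := by
  rw [← ghost_const, ← ghost_mapFun ρ (RingHom.comp_id ρ)]
  rfl

/-- The Witt vector with the component `x` in position `i` and all others zero. -/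
def single (i : Fin (n + 1)) (x : B) : W.Witt n ρ := ⟨Pi.single i x⟩

theorem single_add (i : Fin (n + 1)) (x y : B) :
    (single i (x + y) : W.Witt n ρ) = single i x + single i y := by
  ext1; exact Pi.single_add (f := fun _ => B) i x y

theorem sum_single (x : W.Witt n ρ) : ∑ i, single i (x.coeff i) = x := by
  have h : ∀ (s : Finset (Fin (n + 1))) (f : Fin (n + 1) → W.Witt n ρ),
      (∑ i ∈ s, f i).coeff = ∑ i ∈ s, (f i).coeff := by
    intro s f
    induction s using Finset.cons_induction with
    | empty => rfl
    | cons a s ha ih => rw [sum_cons, sum_cons, coeff_add, ih]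
  ext1
  rw [h]
  exact Finset.univ_sum_single x.coeff

theorem mapFun_single {D : Type*} [CommRing D] {σ : R →+* D} (f : B →+* D) (i : Fin (n + 1)) (x : B) :
    (mapFun f (single i x : W.Witt n ρ) : W.Witt n σ) = single i (f x) := by
  ext j
  exact (Pi.apply_single (fun _ => f) (fun _ => map_zero f) i x j)

theorem ghost_single_last (x : B) (i : Fin (n + 1)) :
    ghost W (single (Fin.last n) x : W.Witt n ρ) i = if i = Fin.last n then ρ W.ϖ ^ n * x else 0 := by
  have hq : ∀ k, W.q ^ k ≠ 0 := fun k => pow_ne_zero _ (by have := W.one_lt_q; omega)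
  rw [ghost_last, sum_eq_zero, zero_add]
  · by_cases h : i = Fin.last n
    · subst h; simp [single]
    · simp [single, h]
  · intro j hj
    have hj' : j ≠ Fin.last n := ((mem_Iio.1 hj).trans_le (Fin.le_last i)).ne
    simp [single, hj', zero_pow (hq _)]

/-- The ideal of Witt vectors with only a top component is a module over the last ghost component. -/
theorem mul_single_last (w : W.Witt n ρ) (x : B) :
    w * single (Fin.last n) x = single (Fin.last n) (ghost W w (Fin.last n) * x) := by
  obtain ⟨w, rfl⟩ := exists_lift w
  have hx : cover ρ (X x) = x := by simp
  rw [ghost_mapFun _ cover_comp, ← hx, ← map_mul,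
    ← mapFun_single (ρ := (C : R →+* MvPolynomial B R)) (cover ρ),
    ← mapFun_single (ρ := (C : R →+* MvPolynomial B R)) (cover ρ), ← mapFun_mul _ cover_comp]
  congr 1
  refine poly_ghost_injective fun i => ?_
  rw [ghost_mul, ghost_single_last, ghost_single_last]
  split_ifs with h
  · rw [h]; ring
  · ring

theorem single_last_pow (x : B) (k : ℕ) : (single (Fin.last n) x : W.Witt n ρ) ^ (k + 1) =
    single (Fin.last n) ((ρ W.ϖ ^ n) ^ k * x ^ (k + 1)) := by
  induction k with
  | zero => simp
  | succ k ih =>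
    rw [pow_succ, ih, mul_single_last, ghost_single_last, if_pos rfl]
    congr 1; ring

/-- The Verschiebung `W_n → W_{n+1}`, which shifts the components. Dually to the Frobenius, it starts at the
algebra with twisted structure map. -/
def versch (x : W.Witt n (ρ.comp W.φ)) : W.Witt (n + 1) ρ := ⟨Fin.cons 0 x.coeff⟩

theorem versch_add (x y : W.Witt n (ρ.comp W.φ)) : versch (x + y) = versch x + versch y := by
  ext i
  refine Fin.cases ?_ (fun j => ?_) i
  · exact (add_zero 0).symm
  · rfl

theorem versch_single (i : Fin (n + 1)) (x : B) :
    versch (single i x : W.Witt n (ρ.comp W.φ)) = single i.succ x := by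
  ext j
  refine Fin.cases ?_ (fun j => ?_) j
  · exact (Pi.single_eq_of_ne (M := fun _ => B) (Fin.succ_ne_zero i).symm x).symm
  · change (Pi.single i x : Fin (n + 1) → B) j = (Pi.single i.succ x : Fin (n + 2) → B) j.succ
    by_cases h : j = i
    · subst h; simp
    · rw [Pi.single_eq_of_ne h, Pi.single_eq_of_ne fun h' => h (Fin.succ_injective _ h')]

theorem mapFun_versch {D : Type*} [CommRing D] {σ : R →+* D} (f : B →+* D)
    (x : W.Witt n (ρ.comp W.φ)) :
    (mapFun f (versch x) : W.Witt (n + 1) σ) = versch (mapFun f x) := by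
  ext i
  refine Fin.cases ?_ (fun j => ?_) i
  · exact map_zero f
  · rfl

theorem exists_lift_twist (x : W.Witt n (ρ.comp W.φ)) :
    ∃ y : W.Witt n ((C : R →+* MvPolynomial B R).comp W.φ), mapFun (cover ρ) y = x :=
  ⟨⟨fun i => X (x.coeff i)⟩, by ext; simp [mapFun]⟩

theorem ghost_versch_zero (x : W.Witt n (ρ.comp W.φ)) : ghost W (versch x) 0 = 0 := by
  rw [ghost_zero_index]; rfl

theorem ghost_versch_succ (x : W.Witt n (ρ.comp W.φ)) (i : Fin (n + 1)) :
    ghost W (versch x) i.succ = ρ W.ϖ * ghost W x i := by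
  let y : ℕ → B := fun j => if h : j < n + 1 then x.coeff ⟨j, h⟩ else 0
  have hy : ∀ j : Fin (n + 1), x.coeff j = y j := fun j => by rw [show y j = _ from dif_pos j.2]
  rw [ghost_eq_gh x y hy, ghost_eq_gh (versch x) (fun j => if j = 0 then 0 else y (j - 1)),
    gh, gh, Fin.val_succ, sum_range_succ', mul_sum]
  · rw [if_pos rfl, zero_pow (pow_ne_zero _ (by have := W.one_lt_q; omega)), mul_zero, add_zero]
    refine sum_congr rfl fun j _ => ?_
    rw [if_neg j.succ_ne_zero, RingHom.comp_apply, W.φ_ϖ, Nat.add_sub_add_right, Nat.add_sub_add_right,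
      Nat.sub_zero, pow_succ']
    ring
  · intro j
    refine Fin.cases ?_ (fun j => ?_) j
    · rfl
    · rw [Fin.val_succ, if_neg (Nat.succ_ne_zero _), Nat.add_sub_cancel, ← hy]
      rfl

/-- The projection formula `V(x) w = V(x F(w))`. -/
theorem versch_mul (x : W.Witt n (ρ.comp W.φ)) (w : W.Witt (n + 1) ρ) :
    versch x * w = versch (x * frob w) := by
  obtain ⟨x, rfl⟩ := exists_lift_twist x
  obtain ⟨w, rfl⟩ := exists_lift w
  change versch (mapFun _ x) * mapFun _ w = versch (mapFun _ x * frobFun (mapFun _ w))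
  rw [← mapFun_frobFun _ cover_comp, ← mapFun_mul _ cover_comp_twist, ← mapFun_versch,
    ← mapFun_versch, ← mapFun_mul _ cover_comp]
  congr 1
  refine poly_ghost_injective fun i => ?_
  rw [ghost_mul]
  refine Fin.cases ?_ (fun j => ?_) i
  · rw [ghost_versch_zero, ghost_versch_zero, zero_mul]
  · rw [ghost_versch_succ, ghost_versch_succ, ghost_mul, ghost_frobFun, mul_assoc]

/-- The composition `F V` is the multiplication by `ϖ`. -/
theorem frob_versch (x : W.Witt n (ρ.comp W.φ)) :
    frob (versch x) = str W n (ρ.comp W.φ) W.ϖ * x := by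
  obtain ⟨x, rfl⟩ := exists_lift_twist x
  change frobFun (versch (mapFun _ x)) = _
  have h : str W n (ρ.comp W.φ) W.ϖ =
      mapFun (cover ρ) (str W n ((C : R →+* MvPolynomial B R).comp W.φ) W.ϖ) :=
    (congrFun (congrArg DFunLike.coe (map_comp_str (cover ρ) cover_comp_twist)) W.ϖ).symm
  rw [h, ← mapFun_mul _ cover_comp_twist, ← mapFun_versch, ← mapFun_frobFun _ cover_comp]
  congr 1
  refine twist_ghost_injective fun i => ?_
  rw [ghost_mul, ghost_frobFun, ghost_versch_succ, ghost_str, φ_iterate_ϖ, RingHom.comp_apply, W.φ_ϖ]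

theorem versch_pow (x : W.Witt n (ρ.comp W.φ)) (k : ℕ) :
    versch x ^ (k + 1) = versch (str W n (ρ.comp W.φ) W.ϖ ^ k * x ^ (k + 1)) := by
  induction k with
  | zero => simp
  | succ k ih =>
    rw [pow_succ, ih, versch_mul, frob_versch]
    congr 1; ring

theorem str_mul_versch (r : R) (x : W.Witt n (ρ.comp W.φ)) :
    str W (n + 1) ρ r * versch x = versch (str W n (ρ.comp W.φ) r * x) := by
  rw [mul_comm, versch_mul, mul_comm]
  congr 2
  exact congrFun (congrArg DFunLike.coe (frob_comp_str (W := W) (n := n) (ρ := ρ))) r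

/-- The Frobenius does not depend on the structure map, only on the image of `ϖ`. -/
theorem frobFun_twist (x : W.Witt (n + 1) ρ) :
    (frobFun (⟨x.coeff⟩ : W.Witt (n + 1) (ρ.comp W.φ))).coeff = (frobFun x).coeff := by
  obtain ⟨x, rfl⟩ := exists_lift x
  have h1 : (⟨(mapFun (cover ρ) x : W.Witt (n + 1) ρ).coeff⟩ : W.Witt (n + 1) (ρ.comp W.φ)) =
      mapFun (cover ρ) (⟨x.coeff⟩ : W.Witt (n + 1) ((C : R →+* MvPolynomial B R).comp W.φ)) := rfl
  rw [h1, ← mapFun_frobFun _ cover_comp_twist, ← mapFun_frobFun _ cover_comp]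
  have h2 : (⟨(frobFun (⟨x.coeff⟩ : W.Witt (n + 1) ((C : R →+* MvPolynomial B R).comp W.φ))).coeff⟩ :
      W.Witt n ((C : R →+* MvPolynomial B R).comp W.φ)) = frobFun x := by
    refine twist_ghost_injective fun i => ?_
    have hg : ∀ (m : ℕ) (σ τ : R →+* MvPolynomial B R), σ W.ϖ = τ W.ϖ → ∀ (c : Fin (m + 1) → _) j,
        ghost W (⟨c⟩ : W.Witt m σ) j = ghost W (⟨c⟩ : W.Witt m τ) j := by
      intro m σ τ h c j
      simp only [ghost, h]
    rw [ghost_frobFun, hg n _ (((C : R →+* MvPolynomial B R).comp W.φ).comp W.φ) (by simp [W.φ_ϖ]),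
      ghost_frobFun, hg (n + 1) _ C (by simp [W.φ_ϖ])]
  rw [← h2]
  rfl

theorem frob_single_last (x : B) : frob (single (Fin.last (n + 1)) x : W.Witt (n + 1) ρ) =
    single (Fin.last n) (ρ W.ϖ * x) := by
  have hx : cover ρ (X x) = x := by simp
  have hϖ : ρ W.ϖ = cover ρ (C W.ϖ) := by simp
  change frobFun _ = _
  rw [← hx, hϖ, ← map_mul, ← mapFun_single (ρ := (C : R →+* MvPolynomial B R)) (cover ρ),
    ← mapFun_single (ρ := (C : R →+* MvPolynomial B R).comp W.φ) (cover ρ),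
    ← mapFun_frobFun _ cover_comp]
  congr 1
  refine twist_ghost_injective fun i => ?_
  rw [ghost_frobFun, ghost_single_last, ghost_single_last, RingHom.comp_apply, W.φ_ϖ, pow_succ,
    mul_assoc]
  exact if_congr (by rw [← Fin.succ_last, Fin.succ_inj]) rfl rfl

theorem dvd_frobFun_sub {P : Type*} [CommRing P] {ρ : R →+* P} (hP : ∀ x : P, ρ W.ϖ * x = 0 → x = 0)
    (x : W.Witt (n + 1) ρ) (i : Fin (n + 1)) :
    ρ W.ϖ ∣ (frobFun x).coeff i - x.coeff i.castSucc ^ W.q := by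
  have hcancel : ∀ (k : ℕ) (b : P), ρ W.ϖ ^ k * b = 0 → b = 0 := by
    intro k
    induction k with
    | zero => simp
    | succ k ih => intro b hb; exact hP _ (ih _ (by rw [← mul_assoc, ← pow_succ]; exact hb))
  let y : ℕ → P := fun j => if h : j < n + 2 then x.coeff ⟨j, h⟩ else 0
  let z : ℕ → P := fun j => if h : j < n + 1 then (frobFun x).coeff ⟨j, h⟩ else 0
  have hy : ∀ j : Fin (n + 2), x.coeff j = y j := fun j => by rw [show y j = _ from dif_pos j.2]
  have hz : ∀ j : Fin (n + 1), (frobFun x).coeff j = z j := fun j => by rw [show z j = _ from dif_pos j.2]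
  have hgh : ∀ j : Fin (n + 1), W.gh ρ z j = W.gh ρ y (j + 1) := by
    intro j
    have h := ghost_frobFun x j
    rw [ghost_eq_gh _ z hz, ghost_eq_gh _ y hy] at h
    rw [← Fin.val_succ, ← h, gh, gh, RingHom.comp_apply, W.φ_ϖ]
  have key : ∀ m : ℕ, m < n + 1 → ρ W.ϖ ∣ z m - y m ^ W.q := by
    intro m
    induction m using Nat.strong_induction_on with
    | _ m ih =>
      intro hm
      have h1 := hgh ⟨m, hm⟩
      have h2 : ∑ j ∈ range (m + 1), ρ W.ϖ ^ j * (z j - y j ^ W.q) ^ W.q ^ (m - j) =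
          ρ W.ϖ ^ (m + 1) * y (m + 1) := by
        simp only [gh] at h1
        rw [sum_range_succ _ (m + 1), Nat.sub_self, pow_zero, pow_one] at h1
        rw [← sub_eq_iff_eq_add', ← sum_sub_distrib] at h1
        rw [← h1]
        refine sum_congr rfl fun j hj => ?_
        have hj' : j ≤ m := by simpa [Nat.lt_succ_iff] using hj
        rw [W.sub_pow ρ, ← mul_sub, ← pow_mul, ← pow_succ', Nat.succ_sub hj']
      rw [sum_range_succ, Nat.sub_self, pow_zero, pow_one] at h2
      have h3 : ρ W.ϖ ^ (m + 1) ∣ ∑ j ∈ range m, ρ W.ϖ ^ j * (z j - y j ^ W.q) ^ W.q ^ (m - j) := by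
        refine dvd_sum fun j hj => ?_
        have hj' : j < m := mem_range.1 hj
        have h4 := pow_dvd_pow_of_dvd (ih j hj' (by omega)) (W.q ^ (m - j))
        refine dvd_trans ?_ (mul_dvd_mul_left _ h4)
        rw [← pow_add]
        exact pow_dvd_pow _ (by have := W.lt_q_pow (m - j); omega)
      obtain ⟨c, hc⟩ := h3
      refine ⟨y (m + 1) - c, sub_eq_zero.1 (hcancel m _ ?_)⟩
      rw [hc] at h2
      linear_combination h2
  rw [hz, hy]
  exact key i i.2

/-- On algebras in which `ϖ` vanishes, the Witt vector Frobenius is the `q`-power map on components. -/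
theorem frob_coeff_of_ϖ_eq_zero (h : ρ W.ϖ = 0) (x : W.Witt (n + 1) ρ) (i : Fin (n + 1)) :
    (frob x).coeff i = x.coeff i.castSucc ^ W.q := by
  obtain ⟨x, rfl⟩ := exists_lift x
  obtain ⟨c, hc⟩ := dvd_frobFun_sub (W.poly_torsionFree B) x i
  have h1 := congrArg (cover ρ) hc
  have h2 : cover ρ (C W.ϖ) = 0 := by simp [h]
  rw [map_sub, map_mul, h2, zero_mul, sub_eq_zero, map_pow] at h1
  change (frobFun (mapFun (cover ρ) x)).coeff i = _
  rw [← mapFun_frobFun _ cover_comp]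
  exact h1

end WittBase.Witt

/-! ### The action of `A` on Witt vectors -/

namespace AdmissibleModule

open Finset GaFun WittBase

variable {A : Type v} [CommRing A] {R : Type u} [CommRing R] [Algebra A R] {W : WittBase R}
  (E : AdmissibleModule A W)

theorem isEnd_act (a : A) : GaFun.IsEnd (fun B b => E.act B a b : GaFun W) where
  map_add B := map_add (E.act B a)
  natural g x := E.naturality g a x

theorem act_comm (B : NilAlg W) (a b : A) (x : B.carrier) :
    E.act B a (E.act B b x) = E.act B b (E.act B a x) := by
  have h := congrArg (E.act B) (mul_comm a b)
  rw [map_mul, map_mul] at h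
  exact congrArg (fun f : AddMonoid.End B.carrier => f x) h

/-- The point `(0, y_0, …, y_n)` of `N^{n+1}`. -/
def nV {n : ℕ} {B : NilAlg W} (y : W.Witt n (B.str.comp W.φ)) : (E.N (n + 1)).obj B :=
  ⟨(Witt.versch y : W.Witt (n + 1) B.str), rfl⟩

theorem nV_add {n : ℕ} {B : NilAlg W} (y z : W.Witt n (B.str.comp W.φ)) :
    E.nV (y + z) = E.nV y + E.nV z := Subtype.ext (Witt.versch_add y z)

theorem exists_eq_nV {n : ℕ} {B : NilAlg W} (x : (E.N (n + 1)).obj B) :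
    ∃ y : W.Witt n (B.str.comp W.φ), x = E.nV y := by
  refine ⟨⟨fun i => (x.1 : W.Witt (n + 1) B.str).coeff i.succ⟩, Subtype.ext (Witt.ext ?_)⟩
  ext i
  refine Fin.cases ?_ (fun j => ?_) i
  · exact x.2
  · rfl

theorem map_nV {n : ℕ} {B C : NilAlg W} (g : NilAlg.Hom B C) (y : W.Witt n (B.str.comp W.φ)) :
    (E.N (n + 1)).map g (E.nV y) =
      E.nV (Witt.mapFun g.toRingHom y : W.Witt n (C.str.comp W.φ)) :=
  Subtype.ext (Witt.mapFun_versch g.toRingHom y)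

theorem lat_nV (n : ℕ) (B : NilAlg W) (y : W.Witt (n + 1) (B.str.comp W.φ)) :
    E.lat n B (E.nV y) = E.nV (B := B.tw) (Witt.frob y) := by
  refine Subtype.ext (Witt.ext ?_)
  have h := Witt.frobFun_twist (⟨y.coeff⟩ : W.Witt (n + 1) B.str)
  ext i
  refine Fin.cases rfl (fun j => ?_) i
  exact (congrFun h j).symm

theorem lat_add (n : ℕ) (B : NilAlg W) (x y : (E.N (n + 2)).obj B) :
    E.lat n B (x + y) = E.lat n B x + E.lat n B y := by
  obtain ⟨x, rfl⟩ := E.exists_eq_nV x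
  obtain ⟨y, rfl⟩ := E.exists_eq_nV y
  rw [← nV_add, lat_nV, lat_nV, lat_nV]
  exact (congrArg (E.nV (B := B.tw)) (map_add Witt.frob x y)).trans (E.nV_add (B := B.tw) _ _)

theorem lat_map (n : ℕ) {B C : NilAlg W} (f : NilAlg.Hom B C) (x : (E.N (n + 2)).obj B) :
    E.lat n C ((E.N (n + 2)).map f x) = (E.N (n + 1)).map f.tw (E.lat n B x) := by
  obtain ⟨x, rfl⟩ := E.exists_eq_nV x
  rw [map_nV, lat_nV, lat_nV]
  exact (congrArg (E.nV (B := C.tw)) (Witt.mapFun_frobFun f.toRingHom f.tw.comp_str x)).symm.trans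
    (E.map_nV f.tw (Witt.frob x : W.Witt n ((B.str.comp W.φ).comp W.φ))).symm

variable [W.IsUniformized]

/-- The coefficients of the power series by which `a` acts. -/
noncomputable def coef (a : A) : ℕ → R := (E.isEnd_act a).exists_hasCoef.choose

theorem hasCoef_act (a : A) : HasCoef (fun B b => E.act B a b) (E.coef a) :=
  (E.isEnd_act a).exists_hasCoef.choose_spec

theorem coef_zero (a : A) : E.coef a 0 = algebraMap A R a :=
  (E.hasCoef_act a).coef_zero_eq _ fun B b => E.act_eps B a b

theorem isNull_topCoef (n : ℕ) (a : A) :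
    W.IsNull fun j => (W.φ^[n]) (E.coef a j) * (W.ϖ ^ n) ^ (W.p ^ j - 1) :=
  ((E.hasCoef_act a).null.map_φ_iterate n).of_dvd fun _ => dvd_mul_right _ _

/-- The action of `a` on the top component of Witt vectors of length `n + 1`. -/
noncomputable def topOp (n : ℕ) (a : A) : GaFun W :=
  (exists_hasCoef_of_isNull (E.isNull_topCoef n a)).choose

theorem hasCoef_topOp (n : ℕ) (a : A) : HasCoef (E.topOp n a)
    fun j => (W.φ^[n]) (E.coef a j) * (W.ϖ ^ n) ^ (W.p ^ j - 1) :=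
  (exists_hasCoef_of_isNull (E.isNull_topCoef n a)).choose_spec

theorem isNull_verschCoef (a : A) : W.IsNull fun j => E.coef a j * W.ϖ ^ (W.p ^ j - 1) :=
  (E.hasCoef_act a).null.of_dvd fun _ => dvd_mul_right _ _

/-- The action `x ↦ ϖ⁻¹ E_a(ϖ x)` of `a`, to which the Verschiebung relates the given one. -/
noncomputable def verschOp (a : A) : GaFun W :=
  (exists_hasCoef_of_isNull (E.isNull_verschCoef a)).choose

theorem hasCoef_verschOp (a : A) : HasCoef (E.verschOp a)
    fun j => E.coef a j * W.ϖ ^ (W.p ^ j - 1) :=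
  (exists_hasCoef_of_isNull (E.isNull_verschCoef a)).choose_spec

theorem p_pow_eq (W : WittBase R) (j : ℕ) : W.p ^ j = W.p ^ j - 1 + 1 := by
  have := W.lt_p_pow j
  omega

theorem act_single_last (n : ℕ) (B : NilAlg W) (a : A) (x : B.carrier) :
    E.act (B.witt n) a (Witt.single (Fin.last n) x : W.Witt n B.str) =
      (Witt.single (Fin.last n) (E.topOp n a B x) : W.Witt n B.str) := by
  obtain ⟨M, hM⟩ := (E.hasCoef_act a).null.exists_bound (B.witt n)
  obtain ⟨N, hN⟩ := (E.hasCoef_topOp n a).null.exists_bound B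
  have h1 := (E.hasCoef_act a).eq_sum (B.witt n) (Witt.single (Fin.last n) x : W.Witt n B.str)
    (max M N) fun j hj => hM j (le_of_max_le_left hj)
  have h2 := (E.hasCoef_topOp n a).eq_sum B x (max M N) fun j hj => hN j (le_of_max_le_right hj)
  rw [h2]
  refine h1.trans ?_
  let S : B.carrier →+ W.Witt n B.str := AddMonoidHom.mk' (Witt.single (Fin.last n)) (Witt.single_add _)
  change _ = S _
  rw [map_sum]
  refine sum_congr rfl fun j _ => ?_
  change Witt.str W n B.str (E.coef a j) * (Witt.single (Fin.last n) x : W.Witt n B.str) ^ W.p ^ j =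
    Witt.single (Fin.last n) _
  rw [p_pow_eq W j, Witt.single_last_pow, Witt.mul_single_last, Witt.ghost_str, Fin.val_last,
    Nat.add_sub_cancel, map_mul, map_pow, map_pow, mul_assoc]

/-- The Verschiebung intertwines the given action of `a` with its conjugate under `ϖ`. -/
theorem act_versch (n : ℕ) (B : NilAlg W) (a : A) (y : W.Witt n (B.str.comp W.φ)) :
    E.act (B.witt (n + 1)) a (Witt.versch y : W.Witt (n + 1) B.str) =
      Witt.versch (E.verschOp a (B.tw.witt n) y : W.Witt n (B.str.comp W.φ)) := by
  obtain ⟨M, hM⟩ := (E.hasCoef_act a).null.exists_bound (B.witt (n + 1))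
  obtain ⟨N, hN⟩ := (E.hasCoef_verschOp a).null.exists_bound (B.tw.witt n)
  have h1 := (E.hasCoef_act a).eq_sum (B.witt (n + 1)) (Witt.versch y : W.Witt (n + 1) B.str)
    (max M N) fun j hj => hM j (le_of_max_le_left hj)
  have h2 := (E.hasCoef_verschOp a).eq_sum (B.tw.witt n) y (max M N)
    fun j hj => hN j (le_of_max_le_right hj)
  rw [h2]
  refine h1.trans ?_
  let S : W.Witt n (B.str.comp W.φ) →+ W.Witt (n + 1) B.str := AddMonoidHom.mk' _ Witt.versch_add
  refine Eq.trans ?_ (map_sum S _ _).symm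
  refine sum_congr rfl fun j _ => ?_
  change Witt.str W (n + 1) B.str (E.coef a j) * (Witt.versch y : W.Witt (n + 1) B.str) ^ W.p ^ j =
    Witt.versch (Witt.str W n (B.str.comp W.φ) (E.coef a j * W.ϖ ^ (W.p ^ j - 1)) * y ^ W.p ^ j)
  rw [p_pow_eq W j, Witt.versch_pow, Witt.str_mul_versch, map_mul, map_pow,
    Nat.add_sub_cancel, mul_assoc]

/-! ### The lateral Frobenius on characters -/

theorem smul_nV {n : ℕ} {B : NilAlg W} (a : A) (y : W.Witt n (B.str.comp W.φ)) :
    a • E.nV y = E.nV (E.verschOp a (B.tw.witt n) y : W.Witt n (B.str.comp W.φ)) :=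
  Subtype.ext (E.act_versch n B a y)

/-- The Verschiebung identifies the lateral Frobenius with the Frobenius of Witt vectors, and the action of
`A` on `N^n` with a natural one on Witt vectors. -/
theorem lat_smul (n : ℕ) (B : NilAlg W) (a : A) (x : (E.N (n + 2)).obj B) :
    E.lat n B (a • x) = a • E.lat n B x := by
  obtain ⟨x, rfl⟩ := E.exists_eq_nV x
  have h := (E.hasCoef_verschOp a).isEnd.natural (NilAlg.Hom.frob B.tw n) x
  have h1 := (congrArg (E.lat n B) (E.smul_nV a x)).trans
    (E.lat_nV n B (E.verschOp a (B.tw.witt (n + 1)) x : W.Witt (n + 1) (B.str.comp W.φ)))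
  rw [h1, lat_nV]
  exact (congrArg (E.nV (B := B.tw)) h).symm.trans (E.smul_nV (n := n) (B := B.tw) a (Witt.frob x)).symm

variable [WittBase.Over A W]

omit [W.IsUniformized] in
theorem tw_str_algebraMap (B : NilAlg W) (a : A) :
    B.tw.str (algebraMap A R a) = B.str (algebraMap A R a) :=
  congrArg B.str (WittBase.Over.φ_algebraMap a)

/-- Composition with the lateral Frobenius. -/
noncomputable def latStar (n : ℕ) (ψ : (E.N (n + 1)).HomGa) : (E.N (n + 2)).HomGa where
  toFun B := AddMonoidHom.mk' (fun x => ψ.toFun B.tw (E.lat n B x)) fun x y =>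
    (congrArg (ψ.toFun B.tw) (E.lat_add n B x y)).trans (map_add (ψ.toFun B.tw) _ _)
  map_smul B a x := by
    refine (congrArg (ψ.toFun B.tw) (E.lat_smul n B a x)).trans ((ψ.map_smul B.tw a _).trans ?_)
    rw [tw_str_algebraMap]
    rfl
  naturality f x := (congrArg (ψ.toFun _) (E.lat_map n f x)).trans (ψ.naturality f.tw _)

end AdmissibleModule

namespace WittBase.Witt

variable {R : Type u} [CommRing R] {W : WittBase R} {B : Type*} [CommRing B] {ρ : R →+* B}

/-- The extension of a Witt vector by zero components. It is additive, and a section of the truncation. -/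
def extZ {m n : ℕ} (x : W.Witt m ρ) : W.Witt n ρ :=
  ⟨fun i => if h : (i : ℕ) < m + 1 then x.coeff ⟨i, h⟩ else 0⟩

theorem extZ_add {m n : ℕ} (x y : W.Witt m ρ) : (extZ (x + y) : W.Witt n ρ) = extZ x + extZ y := by
  ext i
  simp only [extZ, coeff_add, Pi.add_apply]
  split_ifs <;> simp

theorem truncFun_extZ {m n : ℕ} (h : m ≤ n) (x : W.Witt m ρ) :
    truncFun h (extZ x : W.Witt n ρ) = x := by
  ext i
  exact dif_pos i.2

theorem mapFun_extZ {m n : ℕ} {D : Type*} [CommRing D] {σ : R →+* D} (f : B →+* D) (x : W.Witt m ρ) :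
    (mapFun f (extZ x : W.Witt n ρ) : W.Witt n σ) = extZ (mapFun f x : W.Witt m σ) := by
  ext i
  simp only [extZ, mapFun]
  split_ifs <;> simp

theorem extZ_coeff_zero {m n : ℕ} (x : W.Witt m ρ) : (extZ x : W.Witt n ρ).coeff 0 = x.coeff 0 := by
  exact dif_pos (c := ((0 : Fin (n + 1)) : ℕ) < m + 1) (t := fun h => x.coeff ⟨_, h⟩)
    (e := fun _ => 0) (Nat.succ_pos m)

theorem single_injective {n : ℕ} (i : Fin (n + 1)) :
    Function.Injective (single i : B → W.Witt n ρ) := fun x y h => by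
  have := congrFun (congrArg coeff h) i
  simpa [single] using this

end WittBase.Witt

theorem GaFun.hasCoef_sum {R : Type u} [CommRing R] {W : WittBase R} {ι : Type*} (s : Finset ι)
    (f : ι → GaFun W) (c : ι → ℕ → R) (h : ∀ i ∈ s, GaFun.HasCoef (f i) (c i)) :
    GaFun.HasCoef (fun B b => ∑ i ∈ s, f i B b) (fun k => ∑ i ∈ s, c i k) := by
  induction s using Finset.cons_induction with
  | empty => exact GaFun.hasCoef_zero
  | cons a s ha ih =>
    simp only [Finset.sum_cons]
    exact (h a (Finset.mem_cons_self _ _)).add (ih fun i hi => h i (Finset.mem_cons_of_mem hi))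

namespace FormalModule.HomGa

variable {A : Type v} [CommRing A] {R : Type u} [CommRing R] [Algebra A R] {W : WittBase R}
  {M : FormalModule A W}

/-- The evaluation at a point, as an additive map. -/
def evalAt (B : NilAlg W) (x : M.obj B) : M.HomGa →+ B.carrier :=
  AddMonoidHom.mk' (fun Θ => Θ.toFun B x) fun _ _ => rfl

theorem sum_apply {ι : Type*} (s : Finset ι) (f : ι → M.HomGa) (B : NilAlg W) (x : M.obj B) :
    (∑ i ∈ s, f i).toFun B x = ∑ i ∈ s, (f i).toFun B x :=
  map_sum (evalAt B x) f s

theorem sub_apply (Θ Θ' : M.HomGa) (B : NilAlg W) (x : M.obj B) :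
    (Θ - Θ').toFun B x = Θ.toFun B x - Θ'.toFun B x := rfl

theorem ϖ_smul_apply (ψ : M.HomGa) {B : NilAlg W} (hB : B.str W.ϖ = 0)
    (x : M.obj B) : (W.ϖ • ψ).toFun B x = 0 := by
  rw [smul_apply, hB, zero_mul]

end FormalModule.HomGa

namespace AdmissibleModule

open Finset GaFun WittBase

variable {A : Type v} [CommRing A] {R : Type u} [CommRing R] [Algebra A R] {W : WittBase R}
  (E : AdmissibleModule A W)

/-! ### Components of characters of `N^n` -/

variable {E} in
/-- The restriction of a character of `N^{n+1}` to the `i`-th component of the points `(0, y_0, …, y_n)`. -/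
noncomputable def comp {n : ℕ} (ψ : (E.N (n + 1)).HomGa) (i : Fin (n + 1)) : GaFun W :=
  fun B b => ψ.toFun B (E.nV (Witt.single i b))

theorem isEnd_comp {n : ℕ} (ψ : (E.N (n + 1)).HomGa) (i : Fin (n + 1)) : IsEnd (comp ψ i) where
  map_add B x y := by
    rw [comp, Witt.single_add, nV_add, map_add]; rfl
  natural {B C} g x := by
    have h := ψ.naturality g (E.nV (Witt.single i x))
    rw [map_nV, Witt.mapFun_single] at h
    exact h

theorem toFun_nV {n : ℕ} (ψ : (E.N (n + 1)).HomGa) (B : NilAlg W) (y : W.Witt n (B.str.comp W.φ)) :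
    ψ.toFun B (E.nV y) = ∑ i, comp ψ i B (y.coeff i) := by
  let S : W.Witt n (B.str.comp W.φ) →+ B.carrier :=
    (ψ.toFun B).comp (AddMonoidHom.mk' E.nV (E.nV_add))
  have h := map_sum S (fun i => Witt.single i (y.coeff i)) univ
  rw [Witt.sum_single] at h
  exact h

theorem ext_comp {n : ℕ} {ψ ψ' : (E.N (n + 1)).HomGa} (h : ∀ i B b, comp ψ i B b = comp ψ' i B b) :
    ψ = ψ' := by
  refine FormalModule.HomGa.ext' fun B x => ?_
  obtain ⟨y, rfl⟩ := E.exists_eq_nV x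
  rw [toFun_nV, toFun_nV]
  exact sum_congr rfl fun i _ => h i B _

theorem subsingleton_N_zero (B : NilAlg W) : Subsingleton ((E.N 0).obj B) := by
  refine ⟨fun x y => Subtype.ext (Witt.ext ?_)⟩
  ext i
  have : i = 0 := Subsingleton.elim (α := Fin 1) _ _
  subst this
  exact x.2.trans y.2.symm

theorem subsingleton_homGa_N_zero : Subsingleton ((E.N 0).HomGa) := by
  refine ⟨fun ψ ψ' => FormalModule.HomGa.ext' fun B x => ?_⟩
  have := E.subsingleton_N_zero B
  rw [Subsingleton.elim x 0, map_zero, map_zero]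

theorem comp_uN_zero {m n : ℕ} (h : m + 1 ≤ n + 1) (ψ : (E.N (m + 1)).HomGa) :
    comp (E.uN h ψ) 0 = comp ψ 0 := by
  ext B b
  change ψ.toFun B ((E.projN h).app B (E.nV (Witt.single 0 b))) = _
  congr 1
  refine Subtype.ext (Witt.ext ?_)
  ext i
  refine Fin.cases ?_ (fun j => ?_) i
  · rfl
  · change (Pi.single 0 b : Fin (n + 1) → B.carrier) _ = (Pi.single 0 b : Fin (m + 1) → B.carrier) j
    simp only [Pi.single_apply, Fin.ext_iff]
    rfl

/-- The extension by zero of the points of `N^m`. -/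
noncomputable def extN {m n : ℕ} {B : NilAlg W} (x : (E.N m).obj B) : (E.N n).obj B :=
  ⟨(Witt.extZ (x.1 : W.Witt m B.str) : W.Witt n B.str), by
    have h := Witt.extZ_coeff_zero (n := n) (x.1 : W.Witt m B.str)
    exact h.trans x.2⟩

theorem extN_add {m n : ℕ} {B : NilAlg W} (x y : (E.N m).obj B) :
    (E.extN (x + y) : (E.N n).obj B) = E.extN x + E.extN y :=
  have h := Witt.extZ_add (n := n) (x.1 : W.Witt m B.str) (y.1 : W.Witt m B.str)
  Subtype.ext h

theorem projN_extN {m n : ℕ} (h : m ≤ n) {B : NilAlg W} (x : (E.N m).obj B) :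
    (E.projN h).app B (E.extN x) = x :=
  Subtype.ext (Witt.truncFun_extZ h _)

theorem map_extN {m n : ℕ} {B C : NilAlg W} (g : NilAlg.Hom B C) (x : (E.N m).obj B) :
    (E.N n).map g (E.extN x) = E.extN ((E.N m).map g x) :=
  Subtype.ext (Witt.mapFun_extZ g.toRingHom _)

/-- A character that vanishes on the kernel of a projection factors through the projection. -/
theorem exists_eq_uN {m n : ℕ} (h : m ≤ n) (ψ : (E.N n).HomGa)
    (hψ : ∀ B (x : (E.N n).obj B), (E.projN h).app B x = 0 → ψ.toFun B x = 0) :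
    ∃ ψ' : (E.N m).HomGa, E.uN h ψ' = ψ := by
  have key : ∀ B (x y : (E.N n).obj B), (E.projN h).app B x = (E.projN h).app B y →
      ψ.toFun B x = ψ.toFun B y := by
    intro B x y hxy
    rw [← sub_eq_zero, ← map_sub]
    exact hψ B _ (by rw [map_sub, hxy, sub_self])
  refine ⟨⟨fun B => AddMonoidHom.mk' (fun x => ψ.toFun B (E.extN x)) fun x y => ?_, fun B a x => ?_,
    fun {B C} f x => ?_⟩, FormalModule.HomGa.ext' fun B x => ?_⟩
  · rw [extN_add, map_add]
  · change ψ.toFun B _ = _ * ψ.toFun B _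
    rw [← ψ.map_smul]
    refine key B _ _ ?_
    rw [map_smul, projN_extN, projN_extN]
  · change ψ.toFun C _ = f.toRingHom (ψ.toFun B _)
    rw [← map_extN, ψ.naturality]
  · exact key B _ _ (E.projN_extN h _)

theorem nV_coeff_one (B : NilAlg W) (x : (E.N 1).obj B) :
    x = E.nV (Witt.single 0 ((x.1 : W.Witt 1 B.str).coeff 1)) := by
  obtain ⟨y, rfl⟩ := E.exists_eq_nV x
  congr 1
  ext i
  have : i = 0 := Subsingleton.elim (α := Fin 1) _ _
  subst this
  exact (Pi.single_eq_same (M := fun _ => B.carrier) (0 : Fin 1) _).symm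

/-- A point of `N^{n+1}` over zero in `N^n` has only a top component. -/
theorem eq_nV_single_last {n : ℕ} {B : NilAlg W} {x : (E.N (n + 1)).obj B}
    (h : (E.projN n.le_succ).app B x = 0) : ∃ b, x = E.nV (Witt.single (Fin.last n) b) := by
  obtain ⟨y, rfl⟩ := E.exists_eq_nV x
  refine ⟨y.coeff (Fin.last n), congrArg E.nV (Witt.ext (funext fun i => ?_))⟩
  refine Fin.lastCases ?_ (fun i => ?_) i
  · exact (Pi.single_eq_same (M := fun _ => B.carrier) (Fin.last n) _).symm
  · have h1 := congrFun (congrArg (fun z => Witt.coeff z.1) h) i.succ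
    exact h1.trans (Pi.single_eq_of_ne (M := fun _ => B.carrier) (Fin.castSucc_lt_last i).ne _).symm

variable [W.IsUniformized]

theorem eq_zero_of_ϖ_smul {n : ℕ} {ψ : (E.N n).HomGa} (h : W.ϖ • ψ = 0) : ψ = 0 := by
  cases n with
  | zero => exact E.subsingleton_homGa_N_zero.elim _ _
  | succ n =>
    refine E.ext_comp fun i => (E.isEnd_comp ψ i).eq_zero_of_ϖ_mul fun B b => ?_
    exact congrArg (fun ψ' => comp ψ' i B b) h

theorem coef_topOp_zero (n : ℕ) (a : A) : (W.φ^[n]) (E.coef a 0) * (W.ϖ ^ n) ^ (W.p ^ 0 - 1) =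
    (W.φ^[n]) (algebraMap A R a) := by
  rw [coef_zero]; simp

theorem smul_nV_single_last (n : ℕ) (B : NilAlg W) (a : A) (b : B.carrier) :
    a • E.nV (Witt.single (Fin.last n) b : W.Witt n (B.str.comp W.φ)) =
      E.nV (Witt.single (Fin.last n) (E.topOp (n + 1) a B b)) := by
  refine Subtype.ext ?_
  have h := E.act_single_last (n + 1) B a b
  rw [← Fin.succ_last, ← Witt.versch_single, ← Witt.versch_single] at h
  exact h

theorem comp_last_topOp {n : ℕ} (ψ : (E.N (n + 1)).HomGa) (a : A) (B : NilAlg W) (b : B.carrier) :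
    comp ψ (Fin.last n) B (E.topOp (n + 1) a B b) =
      B.str (algebraMap A R a) * comp ψ (Fin.last n) B b := by
  rw [comp, comp, ← ψ.map_smul, smul_nV_single_last]

theorem topOp_comm (n : ℕ) (a b : A) (B : NilAlg W) (x : B.carrier) :
    E.topOp n a B (E.topOp n b B x) = E.topOp n b B (E.topOp n a B x) := by
  refine Witt.single_injective (W := W) (ρ := B.str) (Fin.last n) ?_
  have h : ∀ a b, E.act (B.witt n) a (E.act (B.witt n) b (Witt.single (Fin.last n) x : W.Witt n B.str)) =
      (Witt.single (Fin.last n) (E.topOp n a B (E.topOp n b B x)) : W.Witt n B.str) := fun a b =>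
    (congrArg (E.act (B.witt n) a) (E.act_single_last n B b x)).trans (E.act_single_last n B a _)
  rw [← h, ← h]
  exact E.act_comm (B.witt n) a b _

/-- A character of `N^{n+1}` is determined on the top component by its tangent map there. -/
theorem comp_last_eq_zero {t : A} (ht : algebraMap A R t = W.ϖ) {n : ℕ} (ψ : (E.N (n + 1)).HomGa)
    {c : ℕ → R} (hc : HasCoef (comp ψ (Fin.last n)) c) (h0 : c 0 = 0) :
    ∀ B b, comp ψ (Fin.last n) B b = 0 := by
  refine hc.eq_zero_of_coef_zero (E.hasCoef_topOp (n + 1) t) ?_ (fun B b => ?_) h0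
  · rw [coef_topOp_zero, ht, φ_iterate_ϖ]
  · rw [comp_last_topOp, ht]

/-! ### The normalized character of `N^1` -/

section Normalized

theorem isNormalized_iff (ϑ : (E.N 1).HomGa) {c : ℕ → R} (hc : HasCoef (comp ϑ 0) c) :
    E.IsNormalized ϑ ↔ c 0 = 1 := by
  constructor
  · intro h
    refine hc.coef_zero_eq 1 fun B b => ?_
    rw [map_one, one_mul]
    exact h B _ b rfl
  · intro h B x b hx
    rw [E.nV_coeff_one B.dual x, hx]
    have := hc.apply_eps B b
    rw [h, map_one, one_mul] at this
    exact this

variable [WittBase.Over A W]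

/-- The normalized character of `N^1` is the linearization of the action of `t`; it is compatible with all of
`A` since `A` is commutative. -/
theorem existsUnique_isNormalized {t : A} (ht : algebraMap A R t = W.ϖ) :
    ∃! ϑ : (E.N 1).HomGa, E.IsNormalized ϑ := by
  refine existsUnique_of_exists_of_unique ?_ fun ϑ ϑ' h h' => ?_
  · obtain ⟨f, c, hf, hc, hft⟩ := exists_linearization (E.hasCoef_topOp 1 t)
      (by rw [coef_topOp_zero, ht, φ_iterate_ϖ]) (fun l => by
        refine Dvd.dvd.mul_left ?_ _
        rw [pow_one]
        exact pow_dvd_pow _ (by have := W.lt_p_pow l; omega))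
    have hfa : ∀ (a : A) B b, f B (E.topOp 1 a B b) = B.str (algebraMap A R a) * f B b := by
      intro a B b
      have h1 := (hf.comp (E.hasCoef_topOp 1 a)).sub (hf.smul (algebraMap A R a))
      refine sub_eq_zero.1 (h1.eq_zero_of_coef_zero (E.hasCoef_topOp 1 t) ?_ (fun B b => ?_) ?_ B b)
      · rw [coef_topOp_zero, ht, φ_iterate_ϖ]
      · rw [topOp_comm, hft, hft]; ring
      · rw [Pi.sub_apply, Finset.Nat.antidiagonal_zero, sum_singleton]
        dsimp only
        rw [coef_topOp_zero, hc, Function.iterate_one, WittBase.Over.φ_algebraMap]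
        simp
    have hsmul : ∀ (B : NilAlg W) (a : A) (x : (E.N 1).obj B),
        ((a • x).1 : W.Witt 1 B.str).coeff 1 = E.topOp 1 a B ((x.1 : W.Witt 1 B.str).coeff 1) := by
      intro B a x
      have h1 := E.smul_nV_single_last 0 B a ((x.1 : W.Witt 1 B.str).coeff 1)
      have h2 : a • x = E.nV (Witt.single (Fin.last 0)
          (E.topOp (0 + 1) a B ((x.1 : W.Witt 1 B.str).coeff 1))) := by
        rw [← h1]; congr 1; exact E.nV_coeff_one B x
      rw [h2]
      exact Pi.single_eq_same (M := fun _ => B.carrier) (Fin.last 0) _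
    let ϑ : (E.N 1).HomGa :=
      { toFun := fun B => AddMonoidHom.mk' (fun x => f B ((x.1 : W.Witt 1 B.str).coeff 1))
          fun x y => hf.isEnd.map_add B _ _
        map_smul := fun B a x => (congrArg (f B) (hsmul B a x)).trans (hfa a B _)
        naturality := fun g x => hf.isEnd.natural g _ }
    refine ⟨ϑ, (E.isNormalized_iff ϑ (c := c) ?_).2 hc⟩
    exact hf
  · obtain ⟨c, hc⟩ := (E.isEnd_comp ϑ 0).exists_hasCoef
    obtain ⟨c', hc'⟩ := (E.isEnd_comp ϑ' 0).exists_hasCoef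
    rw [E.isNormalized_iff ϑ hc] at h
    rw [E.isNormalized_iff ϑ' hc'] at h'
    refine E.ext_comp fun i B b => ?_
    have : i = Fin.last 0 := Subsingleton.elim (α := Fin 1) _ _
    subst this
    have h1 := E.comp_last_eq_zero ht (ϑ - ϑ') (c := c - c') (hc.sub hc')
      (by rw [Pi.sub_apply, h, h', sub_self]) B b
    exact sub_eq_zero.1 h1

end Normalized

end AdmissibleModule

namespace AdmissibleModule

open Finset GaFun WittBase

variable {A : Type v} [CommRing A] {R : Type u} [CommRing R] [Algebra A R] {W : WittBase R}
  (E : AdmissibleModule A W) [W.IsUniformized] [WittBase.Over A W]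

/-! ### The basis of the characters of `N^n` -/

/-- The character `ϑ ∘ 𝔣^j` of `N^{j+1}`. -/
noncomputable def psiHom (ϑ : (E.N 1).HomGa) : ∀ j : ℕ, (E.N (j + 1)).HomGa
  | 0 => ϑ
  | j + 1 => E.latStar j (psiHom ϑ j)

theorem psiHom_toFun (ϑ : (E.N 1).HomGa) (j : ℕ) (B : NilAlg W) (x : (E.N (j + 1)).obj B) :
    (E.psiHom ϑ j).toFun B x = E.psi ϑ j B x := by
  induction j generalizing B with
  | zero => rfl
  | succ j ih => exact ih B.tw (E.lat j B x)

/-- The character `Ψ_{j+1}` of `N^n`. -/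
noncomputable def psiN (ϑ : (E.N 1).HomGa) (n : ℕ) (j : Fin n) : (E.N n).HomGa :=
  E.uN j.2 (E.psiHom ϑ j)

theorem psiN_toFun (ϑ : (E.N 1).HomGa) {n : ℕ} (j : Fin n) (B : NilAlg W) (x : (E.N n).obj B) :
    (E.psiN ϑ n j).toFun B x = E.Psi ϑ j B x := E.psiHom_toFun ϑ j B _

theorem uN_psiN (ϑ : (E.N 1).HomGa) {m n : ℕ} (h : m ≤ n) (j : Fin m) :
    E.uN h (E.psiN ϑ m j) = E.psiN ϑ n (Fin.castLE h j) := rfl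

/-- The lateral Frobenius scales the top component by `ϖ`. -/
theorem comp_latStar_last {n : ℕ} (ψ : (E.N (n + 1)).HomGa) (B : NilAlg W) (b : B.carrier) :
    comp (E.latStar n ψ) (Fin.last (n + 1)) B b =
      comp ψ (Fin.last n) B.tw (B.str W.ϖ * b) := by
  change ψ.toFun B.tw (E.lat n B (E.nV (Witt.single (Fin.last (n + 1)) b))) = _
  rw [lat_nV]
  have h := Witt.frob_single_last (W := W) (ρ := B.str.comp W.φ) (n := n) b
  rw [RingHom.comp_apply, W.φ_ϖ] at h
  exact congrArg (fun y => ψ.toFun B.tw (E.nV (B := B.tw) y)) h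

/-- Modulo `ϖ`, the lateral Frobenius is the `q`-power map on the first component. -/
theorem comp_latStar_zero {n : ℕ} (ψ : (E.N (n + 1)).HomGa) (B : NilAlg W) (hB : B.str W.ϖ = 0)
    (b : B.carrier) : comp (E.latStar n ψ) 0 B b = comp ψ 0 B.tw (b ^ W.q) := by
  change ψ.toFun B.tw (E.lat n B (E.nV (Witt.single 0 b))) = _
  rw [lat_nV]
  have h : Witt.frob (Witt.single 0 b : W.Witt (n + 1) (B.str.comp W.φ)) = Witt.single 0 (b ^ W.q) := by
    ext i
    rw [Witt.frob_coeff_of_ϖ_eq_zero (by rw [RingHom.comp_apply, W.φ_ϖ, hB])]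
    have hq : W.q ≠ 0 := by have := W.one_lt_q; omega
    simp only [Witt.single, Pi.single_apply, Fin.ext_iff, Fin.val_castSucc, Fin.val_zero]
    split_ifs <;> simp [hq]
  exact congrArg (fun y => ψ.toFun B.tw (E.nV (B := B.tw) y)) h

theorem exists_hasCoef_psiHom_last (ϑ : (E.N 1).HomGa) (hϑ : E.IsNormalized ϑ) (j : ℕ) :
    ∃ c, HasCoef (comp (E.psiHom ϑ j) (Fin.last j)) c ∧ c 0 = W.ϖ ^ j := by
  induction j with
  | zero =>
    obtain ⟨c, hc⟩ := (E.isEnd_comp ϑ 0).exists_hasCoef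
    exact ⟨c, hc, by rw [(E.isNormalized_iff ϑ hc).1 hϑ, pow_zero]⟩
  | succ j ih =>
    obtain ⟨c, hc, h0⟩ := ih
    have h1 := hc.tw.comp (hasCoef_mul W.ϖ)
    refine ⟨fun k => ∑ x ∈ antidiagonal k, W.φ (c x.1) * (if x.2 = 0 then W.ϖ else 0) ^ W.p ^ x.1,
      ?_, ?_⟩
    · have h2 : comp (E.psiHom ϑ (j + 1)) (Fin.last (j + 1)) =
          fun (B : NilAlg W) (b : B.carrier) => comp (E.psiHom ϑ j) (Fin.last j) B.tw (B.str W.ϖ * b) :=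
        _root_.funext fun B => _root_.funext fun b =>
          E.comp_latStar_last (E.psiHom ϑ j) B b
      rwa [h2]
    · dsimp only
      rw [Finset.Nat.antidiagonal_zero, sum_singleton]
      simp [h0, W.φ_ϖ, pow_succ]

/-- On the first component, `ϑ ∘ 𝔣^j` modulo `ϖ` begins with the power `x ^ (q ^ j)`. -/
theorem exists_hasCoef_psiHom_zero (ϑ : (E.N 1).HomGa) (hϑ : E.IsNormalized ϑ) (j : ℕ) :
    ∃ c, HasCoef (comp (E.psiHom ϑ j) 0) c ∧ (∀ k < W.e * j, W.ϖ ∣ c k) ∧ ¬ W.ϖ ∣ c (W.e * j) := by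
  induction j with
  | zero =>
    obtain ⟨c, hc⟩ := (E.isEnd_comp ϑ 0).exists_hasCoef
    refine ⟨c, hc, fun k hk => absurd hk (by simp), ?_⟩
    rw [mul_zero, (E.isNormalized_iff ϑ hc).1 hϑ]
    exact W.isUnit_iff.1 isUnit_one
  | succ j ih =>
    obtain ⟨c, hc, h0, h1⟩ := ih
    obtain ⟨d, hd⟩ := (E.isEnd_comp (E.psiHom ϑ (j + 1)) 0).exists_hasCoef
    have h2 := hc.tw.comp (hasCoef_pow (W := W) W.e)
    have h3 := fun k => hd.dvd_sub_of_eq h2 (fun B hB b => by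
      rw [← W.q_eq_pow]
      exact E.comp_latStar_zero _ B hB b) k
    have h4 : ∀ k, W.e ≤ k → ∑ x ∈ antidiagonal k, W.φ (c x.1) *
        (if x.2 = W.e then (1 : R) else 0) ^ W.p ^ x.1 = W.φ (c (k - W.e)) := by
      intro k hk
      rw [sum_eq_single_of_mem (k - W.e, W.e)
        (HasAntidiagonal.mem_antidiagonal.2 (Nat.sub_add_cancel hk))]
      · simp
      · rintro ⟨i, l⟩ hx hne
        rw [HasAntidiagonal.mem_antidiagonal] at hx
        dsimp only at hx ⊢
        rw [if_neg, zero_pow (pow_ne_zero _ W.p_prime.ne_zero), mul_zero]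
        rintro rfl
        exact hne (Prod.ext (by dsimp only; omega) rfl)
    have h5 : ∀ k, k < W.e → ∑ x ∈ antidiagonal k, W.φ (c x.1) *
        (if x.2 = W.e then (1 : R) else 0) ^ W.p ^ x.1 = 0 := by
      intro k hk
      refine sum_eq_zero fun x hx => ?_
      rw [HasAntidiagonal.mem_antidiagonal] at hx
      rw [if_neg (by omega), zero_pow (pow_ne_zero _ W.p_prime.ne_zero), mul_zero]
    refine ⟨d, hd, fun k hk => ?_, fun h => ?_⟩
    · have h6 := h3 k
      by_cases hke : k < W.e
      · rwa [h5 k hke, sub_zero] at h6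
      · rw [h4 k (not_lt.1 hke)] at h6
        refine (dvd_sub_left ?_).1 h6
        rw [W.dvd_φ_iff]
        refine h0 _ ?_
        rw [Nat.mul_succ] at hk
        omega
    · have h6 := h3 (W.e * (j + 1))
      rw [h4 _ (by rw [Nat.mul_succ]; omega), dvd_sub_right h, W.dvd_φ_iff, Nat.mul_succ,
        Nat.add_sub_cancel] at h6
      exact h1 h6

/-- The characters `Ψ_j` are linearly independent modulo `ϖ`. -/
theorem dvd_of_sum_psiN_eq_zero (ϑ : (E.N 1).HomGa) (hϑ : E.IsNormalized ϑ) {n : ℕ} (b : Fin n → R)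
    (h : ∀ B : NilAlg W, B.str W.ϖ = 0 → ∀ x, (∑ j, b j • E.psiN ϑ n j).toFun B x = 0) (j : Fin n) :
    W.ϖ ∣ b j := by
  cases n with
  | zero => exact j.elim0
  | succ n =>
    choose c hc hlow hlead using fun j : Fin (n + 1) => E.exists_hasCoef_psiHom_zero ϑ hϑ j
    have hsum : HasCoef (comp (∑ j, b j • E.psiN ϑ (n + 1) j) 0) (fun k => ∑ j, b j * c j k) := by
      have h1 := hasCoef_sum univ _ _ fun j _ => (hc j).smul (b j)
      convert h1 using 1
      ext B x
      rw [comp, FormalModule.HomGa.sum_apply]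
      refine sum_congr rfl fun j _ => ?_
      rw [← E.comp_uN_zero (Nat.succ_le_succ (Nat.le_of_lt_succ j.2))]
      rfl
    have hdvd : ∀ k, W.ϖ ∣ ∑ j, b j * c j k := fun k => by
      have := hsum.dvd_sub_of_eq hasCoef_zero (fun B hB x => h B hB _) k
      rwa [Pi.zero_apply, sub_zero] at this
    by_contra hj
    -- The least index with a coefficient not divisible by `ϖ`.
    obtain ⟨i, hi, hmin⟩ : ∃ i, ¬ W.ϖ ∣ b i ∧ ∀ l < i, W.ϖ ∣ b l := by
      obtain ⟨i, hi, hmin⟩ := WellFounded.has_min (wellFounded_lt (α := Fin (n + 1)))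
        {i | ¬ W.ϖ ∣ b i} ⟨j, hj⟩
      exact ⟨i, hi, fun l hl => not_not.1 fun hn => hmin l hn hl⟩
    have h1 := hdvd (W.e * i)
    rw [← add_sum_erase _ _ (mem_univ i)] at h1
    have h2 : W.ϖ ∣ ∑ l ∈ univ.erase i, b l * c l (W.e * i) := by
      refine dvd_sum fun l hl => ?_
      rcases lt_or_gt_of_ne (ne_of_mem_erase hl) with h | h
      · exact (hmin l h).mul_right _
      · exact (hlow l _ (Nat.mul_lt_mul_of_pos_left h (Nat.pos_of_ne_zero W.e_ne_zero))).mul_left _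
    rcases W.dvd_mul_iff.1 ((dvd_add_left h2).1 h1) with h | h
    · exact hi h
    · exact hlead i h

theorem mem_span_of_ϖ_pow_smul_mem (ϑ : (E.N 1).HomGa) (hϑ : E.IsNormalized ϑ) {n : ℕ} (k : ℕ)
    (ψ : (E.N n).HomGa) (h : W.ϖ ^ k • ψ ∈ Submodule.span R (Set.range (E.psiN ϑ n))) :
    ψ ∈ Submodule.span R (Set.range (E.psiN ϑ n)) := by
  induction k with
  | zero => simpa using h
  | succ k ih =>
    refine ih ?_
    obtain ⟨b, hb⟩ := Submodule.mem_span_range_iff_exists_fun R |>.1 h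
    have hdvd := E.dvd_of_sum_psiN_eq_zero ϑ hϑ b fun B hB x => by
      rw [hb, pow_succ', mul_smul, FormalModule.HomGa.ϖ_smul_apply _ hB]
    choose d hd using hdvd
    have h1 : ∑ j, d j • E.psiN ϑ n j = W.ϖ ^ k • ψ := by
      refine sub_eq_zero.1 (E.eq_zero_of_ϖ_smul ?_)
      rw [smul_sub, ← mul_smul, ← pow_succ', ← hb, sub_eq_zero, smul_sum]
      exact sum_congr rfl fun j _ => by rw [hd j, mul_smul]
    rw [← h1]
    exact Submodule.sum_mem _ fun j _ => Submodule.smul_mem _ _ (Submodule.subset_span ⟨j, rfl⟩)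

theorem span_psiN {t : A} (ht : algebraMap A R t = W.ϖ) (ϑ : (E.N 1).HomGa) (hϑ : E.IsNormalized ϑ)
    (n : ℕ) : Submodule.span R (Set.range (E.psiN ϑ n)) = ⊤ := by
  induction n with
  | zero =>
    have := E.subsingleton_homGa_N_zero
    exact Subsingleton.elim _ _
  | succ n ih =>
    refine eq_top_iff.2 fun ψ _ => E.mem_span_of_ϖ_pow_smul_mem ϑ hϑ n ψ ?_
    -- Subtract the multiple of `Ψ_{n+1}` that has the same tangent map on the top component.
    obtain ⟨c, hc⟩ := (E.isEnd_comp ψ (Fin.last n)).exists_hasCoef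
    obtain ⟨d, hd, hd0⟩ := E.exists_hasCoef_psiHom_last ϑ hϑ n
    have h1 := E.comp_last_eq_zero ht (W.ϖ ^ n • ψ - c 0 • E.psiHom ϑ n)
      ((hc.smul (W.ϖ ^ n)).sub (hd.smul (c 0))) (by rw [Pi.sub_apply, hd0]; ring)
    obtain ⟨ψ', hψ'⟩ := E.exists_eq_uN n.le_succ (W.ϖ ^ n • ψ - c 0 • E.psiHom ϑ n) (fun B x hx => by
      obtain ⟨b, rfl⟩ := E.eq_nV_single_last hx
      exact h1 B b)
    have h2 : ψ' ∈ Submodule.span R (Set.range (E.psiN ϑ n)) := by rw [ih]; trivial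
    have h3 : E.uN n.le_succ ψ' ∈ Submodule.span R (Set.range (E.psiN ϑ (n + 1))) := by
      have := Submodule.mem_map_of_mem (f := E.uN n.le_succ) h2
      rw [Submodule.map_span] at this
      refine Submodule.span_mono ?_ this
      rintro _ ⟨_, ⟨j, rfl⟩, rfl⟩
      exact ⟨_, (E.uN_psiN ϑ n.le_succ j).symm⟩
    have h4 : W.ϖ ^ n • ψ = E.uN n.le_succ ψ' + c 0 • E.psiN ϑ (n + 1) (Fin.last n) := by
      rw [hψ', sub_add_eq_add_sub]
      exact (add_sub_cancel_right _ _).symm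
    rw [h4]
    exact add_mem h3 (Submodule.smul_mem _ _ (Submodule.subset_span ⟨_, rfl⟩))

theorem linearIndependent_psiN (ϑ : (E.N 1).HomGa) (hϑ : E.IsNormalized ϑ) (n : ℕ) :
    LinearIndependent R (E.psiN ϑ n) := by
  rw [Fintype.linearIndependent_iff]
  intro b hb j
  refine W.eq_zero_of_forall_dvd fun k => ?_
  have key : ∀ k : ℕ, ∃ d : Fin n → R, (∀ j, b j = W.ϖ ^ k * d j) ∧ ∑ j, d j • E.psiN ϑ n j = 0 := by
    intro k
    induction k with
    | zero => exact ⟨b, fun j => by simp, hb⟩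
    | succ k ih =>
      obtain ⟨d, hd, hd0⟩ := ih
      choose d' hd' using E.dvd_of_sum_psiN_eq_zero ϑ hϑ d fun B _ x => by rw [hd0]; rfl
      refine ⟨d', fun j => by rw [hd, hd', pow_succ]; ring, E.eq_zero_of_ϖ_smul ?_⟩
      rw [← hd0, smul_sum]
      exact sum_congr rfl fun j _ => by rw [hd' j, mul_smul]
  obtain ⟨d, hd, -⟩ := key k
  exact ⟨d j, hd j⟩

/-- The characters `Ψ_1, …, Ψ_n` form a basis of `Hom_A(N^n, Ĝ_a)`. -/
noncomputable def basisN {t : A} (ht : algebraMap A R t = W.ϖ) (ϑ : (E.N 1).HomGa)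
    (hϑ : E.IsNormalized ϑ) (n : ℕ) : Module.Basis (Fin n) R (E.N n).HomGa :=
  Module.Basis.mk (E.linearIndependent_psiN ϑ hϑ n) (E.span_psiN ht ϑ hϑ n).ge

end AdmissibleModule

namespace AdmissibleModule

open Finset GaFun WittBase

variable {A : Type v} [CommRing A] {R : Type u} [CommRing R] [Algebra A R] {W : WittBase R}
  (E : AdmissibleModule A W)

/-! ### Restriction of differential characters to `N^n` -/

/-- A character that vanishes on the kernel of a truncation factors through the truncation. -/
theorem exists_eq_uX {m n : ℕ} (h : m ≤ n) (Θ : E.X n)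
    (hΘ : E.iX n Θ ∈ LinearMap.range (E.uN h)) : ∃ Θ' : E.X m, E.uX h Θ' = Θ := by
  obtain ⟨ψ, hψ⟩ := hΘ
  have hker : ∀ B (x : (E.J n).obj B), (E.projJ h).app B x = 0 → Θ.toFun B x = 0 := by
    intro B x hx
    have hx0 : (x : W.Witt n B.str).coeff 0 = 0 :=
      congrFun (congrArg (fun z : W.Witt m B.str => z.coeff) hx) 0
    have h1 := congrArg (fun ψ' => FormalModule.HomGa.toFun ψ' B (⟨x, hx0⟩ : (E.N n).obj B)) hψ
    have h2 : (E.projN h).app B (⟨x, hx0⟩ : (E.N n).obj B) = 0 := Subtype.ext hx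
    refine h1.symm.trans ?_
    change ψ.toFun B ((E.projN h).app B (⟨x, hx0⟩ : (E.N n).obj B)) = 0
    rw [h2, map_zero]
  have key : ∀ B (x y : (E.J n).obj B), (E.projJ h).app B x = (E.projJ h).app B y →
      Θ.toFun B x = Θ.toFun B y := by
    intro B x y hxy
    rw [← sub_eq_zero, ← map_sub]
    exact hker B _ (by rw [map_sub, hxy, sub_self])
  have hproj : ∀ (B : NilAlg W) (x : W.Witt m B.str),
      (E.projJ h).app B (Witt.extZ x : W.Witt n B.str) = x :=
    fun B x => Witt.truncFun_extZ h x
  refine ⟨⟨fun B => AddMonoidHom.mk' (fun x : W.Witt m B.str => Θ.toFun B (Witt.extZ x : W.Witt n B.str))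
    fun x y => ?_, fun B a x => ?_, fun {B C} f x => ?_⟩, FormalModule.HomGa.ext' fun B x => ?_⟩
  · exact (congrArg (Θ.toFun B) (Witt.extZ_add (x : W.Witt m B.str) y)).trans
      (map_add (Θ.toFun B) _ _)
  · refine Eq.trans ?_ (Θ.map_smul B a _)
    refine key B _ _ ?_
    exact ((hproj B _).trans (congrArg (a • ·) (hproj B x).symm)).trans
      (((E.projJ h).app B).map_smul a _).symm
  · refine Eq.trans ?_ (Θ.naturality f _)
    exact congrArg (Θ.toFun C) (Witt.mapFun_extZ f.toRingHom (x : W.Witt m B.str)).symm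
  · exact key B _ _ (hproj B _)

/-- The point `(0, x_1, …, x_n)` of `N^n`. -/
noncomputable def tail {n : ℕ} {B : NilAlg W} (x : W.Witt n B.str) : (E.N n).obj B :=
  ⟨x - Witt.single 0 (x.coeff 0), by
    change x.coeff 0 - (Pi.single 0 (x.coeff 0) : Fin (n + 1) → B.carrier) 0 = 0
    rw [Pi.single_eq_same, sub_self]⟩

theorem tail_add {n : ℕ} {B : NilAlg W} (x y : W.Witt n B.str) :
    E.tail (x + y) = E.tail x + E.tail y := by
  refine Subtype.ext ?_
  have h : (x + y) - Witt.single 0 ((x + y).coeff 0) =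
      (x - Witt.single 0 (x.coeff 0)) + (y - Witt.single 0 (y.coeff 0)) := by
    rw [Witt.coeff_add, Pi.add_apply, Witt.single_add]
    abel
  exact h

theorem map_tail {n : ℕ} {B C : NilAlg W} (g : NilAlg.Hom B C) (x : W.Witt n B.str) :
    (E.N n).map g (E.tail x) = E.tail (Witt.mapFun g.toRingHom x : W.Witt n C.str) := by
  refine Subtype.ext ?_
  have h := map_sub (Witt.map (n := n) g.toRingHom g.comp_str) x (Witt.single 0 (x.coeff 0))
  refine h.trans ?_
  exact congrArg (fun z => Witt.mapFun g.toRingHom x - z) (Witt.mapFun_single g.toRingHom 0 _)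

variable {E} in
/-- The restriction of a character of `J^n E` to the component in degree `0`. -/
noncomputable def comp0 {n : ℕ} (Θ : E.X n) : GaFun W :=
  fun B b => Θ.toFun B (Witt.single 0 b : W.Witt n B.str)

theorem isEnd_comp0 {n : ℕ} (Θ : E.X n) : IsEnd (comp0 Θ) where
  map_add B x y := by
    rw [comp0, Witt.single_add]
    exact map_add (Θ.toFun B) _ _
  natural {B C} g x := by
    have h := Θ.naturality g (Witt.single 0 x : W.Witt n B.str)
    exact (congrArg (Θ.toFun C) (Witt.mapFun_single g.toRingHom 0 x)).symm.trans h

theorem toFun_eq_add {n : ℕ} (Θ : E.X n) (B : NilAlg W) (x : W.Witt n B.str) :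
    Θ.toFun B x = comp0 Θ B (x.coeff 0) + (E.iX n Θ).toFun B (E.tail x) := by
  have h := map_add (Θ.toFun B) (Witt.single 0 (x.coeff 0) : W.Witt n B.str)
    (x - Witt.single 0 (x.coeff 0) : W.Witt n B.str)
  refine Eq.trans ?_ h
  exact congrArg (Θ.toFun B) (add_sub_cancel (Witt.single 0 (x.coeff 0)) x).symm

/-- The failure of the degree `0` component of a character to commute with the action of `a` is measured by
the restriction of the character to `N^n`. -/
theorem comp0_act {n : ℕ} (Θ : E.X n) (a : A) (B : NilAlg W) (b : B.carrier) :
    B.str (algebraMap A R a) * comp0 Θ B b = comp0 Θ B (E.act B a b) +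
      (E.iX n Θ).toFun B (E.tail (E.act (B.witt n) a (Witt.single 0 b : W.Witt n B.str))) := by
  have h := Θ.map_smul B a (Witt.single 0 b : W.Witt n B.str)
  refine h.symm.trans ((E.toFun_eq_add Θ B _).trans ?_)
  have h1 := E.naturality (NilAlg.Hom.head B n) a (Witt.single 0 b : W.Witt n B.str)
  have h2 : (NilAlg.Hom.head B n).toRingHom (Witt.single 0 b : W.Witt n B.str) = b := by
    change (Pi.single 0 b : Fin (n + 1) → B.carrier) 0 = b
    exact Pi.single_eq_same ..
  rw [h2] at h1
  exact congrArg (fun z => comp0 Θ B z + (E.iX n Θ).toFun B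
    (E.tail (E.act (B.witt n) a (Witt.single 0 b : W.Witt n B.str)))) h1.symm

theorem toXInf_uX {m n : ℕ} (h : m ≤ n) (Θ : E.X m) : E.toXInf n (E.uX h Θ) = E.toXInf m Θ :=
  Module.DirectLimit.of_f

/-- Every element of the colimit comes from a level above any given one. -/
theorem exists_toXInf (m : ℕ) (y : E.XInf) : ∃ n, m ≤ n ∧ ∃ Θ : E.X n, E.toXInf n Θ = y := by
  have : DirectedSystem E.X (fun _ _ h => E.uX h) := ⟨fun _ _ => rfl, fun _ _ _ _ _ _ => rfl⟩
  obtain ⟨n, Θ, rfl⟩ := Module.DirectLimit.exists_of y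
  exact ⟨max m n, le_max_left _ _, E.uX (le_max_right _ _) Θ, E.toXInf_uX _ Θ⟩

theorem toXInf_frobXIter [WittBase.Over A W] {m : ℕ} (Θ : E.X m) (j : ℕ) :
    E.toXInf (m + j) (E.frobXIter m j Θ) = E.frobXInf^[j] (E.toXInf m Θ) := by
  induction j with
  | zero => rfl
  | succ j ih =>
    rw [Function.iterate_succ_apply', ← ih, frobXInf_toXInf]
    rfl

variable [W.IsUniformized]

/-- The restriction of differential characters to `N^n` is injective: a character that vanishes on `N^n` is
an `A`-linear map `E → Ĝ_a`, and there are none. -/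
theorem iX_injective {t : A} (ht : algebraMap A R t = W.ϖ) (hT : ∃ s, ¬ W.ϖ ∣ E.coef t s) (n : ℕ) :
    Function.Injective (E.iX n) := by
  rw [injective_iff_map_eq_zero]
  intro Θ hΘ
  have h0 := (E.isEnd_comp0 Θ).eq_zero_of_comp_eq (E.hasCoef_act t) hT fun B b => by
    have h := E.comp0_act Θ t B b
    rw [hΘ, ht] at h
    rw [h]; exact (add_zero _).symm
  refine FormalModule.HomGa.ext' fun B x => ?_
  refine (E.toFun_eq_add Θ B x).trans ?_
  rw [h0, hΘ, zero_add]
  rfl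

theorem subsingleton_X_zero {t : A} (ht : algebraMap A R t = W.ϖ) (hT : ∃ s, ¬ W.ϖ ∣ E.coef t s) :
    Subsingleton (E.X 0) :=
  have := E.subsingleton_homGa_N_zero
  (E.iX_injective ht hT 0).subsingleton

/-- Natural additive functionals on Witt vectors have no `ϖ`-torsion. -/
theorem eq_zero_of_ϖ_mul_witt {n : ℕ} (Λ : ∀ B : NilAlg W, W.Witt n B.str → B.carrier)
    (hadd : ∀ B x y, Λ B (x + y) = Λ B x + Λ B y)
    (hnat : ∀ {B C : NilAlg W} (g : NilAlg.Hom B C) x, Λ C (Witt.mapFun g.toRingHom x) =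
      g.toRingHom (Λ B x))
    (h : ∀ B x, B.str W.ϖ * Λ B x = 0) (B : NilAlg W) (x : W.Witt n B.str) : Λ B x = 0 := by
  have h1 : ∀ i (b : B.carrier), Λ B (Witt.single i b) = 0 := fun i =>
    IsEnd.eq_zero_of_ϖ_mul (f := fun B b => Λ B (Witt.single i b))
      { map_add := fun B x y => by rw [Witt.single_add, hadd]
        natural := fun {B C} g x => by rw [← hnat, Witt.mapFun_single] } (fun B b => h B _) B
  have h2 := map_sum (AddMonoidHom.mk' (Λ B) (hadd B)) (fun i => Witt.single i (x.coeff i)) univ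
  rw [Witt.sum_single] at h2
  exact h2.trans (sum_eq_zero fun i _ => h1 i _)

/-- The restriction of differential characters to `N^n` has torsion-free cokernel. -/
theorem exists_eq_ϖ_smul {t : A} (ht : algebraMap A R t = W.ϖ) (hT : ∃ s, ¬ W.ϖ ∣ E.coef t s) {n : ℕ}
    (Θ : E.X n) (ψ : (E.N n).HomGa) (h : E.iX n Θ = W.ϖ • ψ) : ∃ Θ' : E.X n, Θ = W.ϖ • Θ' := by
  obtain ⟨c, hc⟩ := (E.isEnd_comp0 Θ).exists_hasCoef
  have hdvd : ∀ k, W.ϖ ∣ c k := dvd_coef_of_dvd_comp hT fun k => by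
    have h1 := (hc.comp (E.hasCoef_act t)).dvd_sub_of_eq hasCoef_zero (fun B hB b => by
      have h2 := E.comp0_act Θ t B b
      rw [h, ht, hB, zero_mul, FormalModule.HomGa.ϖ_smul_apply _ hB, add_zero] at h2
      exact h2.symm) k
    rwa [Pi.zero_apply, sub_zero] at h1
  obtain ⟨g, d, hg, hgc⟩ := hc.exists_eq_ϖ_mul hdvd
  let Λ : ∀ B : NilAlg W, W.Witt n B.str → B.carrier := fun B x =>
    g B (x.coeff 0) + ψ.toFun B (E.tail x)
  have hΛ : ∀ (B : NilAlg W) (x : W.Witt n B.str), Θ.toFun B x = B.str W.ϖ * Λ B x := by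
    intro B x
    refine (E.toFun_eq_add Θ B x).trans ?_
    rw [hgc, h]
    exact (mul_add _ _ _).symm
  have hadd : ∀ (B : NilAlg W) (x y : W.Witt n B.str), Λ B (x + y) = Λ B x + Λ B y := by
    intro B x y
    simp only [Λ]
    rw [tail_add, map_add, Witt.coeff_add, Pi.add_apply, hg.isEnd.map_add]
    abel
  have hnat : ∀ {B C : NilAlg W} (f : NilAlg.Hom B C) (x : W.Witt n B.str),
      Λ C (Witt.mapFun f.toRingHom x) = f.toRingHom (Λ B x) := by
    intro B C f x
    simp only [Λ]
    rw [← map_tail, ψ.naturality, map_add, ← hg.isEnd.natural]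
    rfl
  have hact : ∀ (a : A) (B : NilAlg W) (x y : W.Witt n B.str),
      E.act (B.witt n) a (x + y : W.Witt n B.str) = (E.act (B.witt n) a x + E.act (B.witt n) a y :
        W.Witt n B.str) := fun a B x y => map_add (E.act (B.witt n) a) _ _
  have hlin : ∀ (a : A) (B : NilAlg W) (x : W.Witt n B.str),
      Λ B (E.act (B.witt n) a x) = B.str (algebraMap A R a) * Λ B x := by
    intro a B x
    refine sub_eq_zero.1 (eq_zero_of_ϖ_mul_witt
      (fun B x => Λ B (E.act (B.witt n) a x) - B.str (algebraMap A R a) * Λ B x)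
      (fun B x y => ?_) (fun {B C} f x => ?_) (fun B x => ?_) B x)
    · have h1 := (congrArg (Λ B) (hact a B x y)).trans (hadd B _ _)
      have h2 : ∀ p q r s c : B.carrier, p = q + r → p - c * (s + (Λ B y)) =
          (q - c * s) + (r - c * Λ B y) := by
        intro p q r s c hp
        rw [hp]; ring
      exact (congrArg (fun z => _ - B.str (algebraMap A R a) * z) (hadd B x y)).trans (h2 _ _ _ _ _ h1)
    · have h1 := E.naturality (f.witt n) a x
      have h2 : E.act (C.witt n) a (Witt.mapFun f.toRingHom x : W.Witt n C.str) =
        (Witt.mapFun f.toRingHom (E.act (B.witt n) a x : W.Witt n B.str) : W.Witt n C.str) := h1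
      have h3 : C.str (algebraMap A R a) = f.toRingHom (B.str (algebraMap A R a)) := by
        rw [← f.comp_str]; rfl
      have h4 := (congrArg (Λ C) h2).trans (hnat f _)
      have h5 := hnat f x
      refine (congrArg₂ (fun y z => y - C.str (algebraMap A R a) * z) h4 h5).trans ?_
      rw [h3, map_sub, map_mul]
    · have h1 := Θ.map_smul B a x
      have h2 := hΛ B (E.act (B.witt n) a x)
      have h3 : Θ.toFun B (E.act (B.witt n) a x) = B.str (algebraMap A R a) * Θ.toFun B x := h1
      have h4 := h2.symm.trans (h3.trans (congrArg (B.str (algebraMap A R a) * ·) (hΛ B x)))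
      exact (mul_sub _ _ _).trans (sub_eq_zero.2 (h4.trans (by ring)))
  exact ⟨⟨fun B => AddMonoidHom.mk' (Λ B) (hadd B), fun B a x => hlin a B x, fun f x => hnat f x⟩,
    FormalModule.HomGa.ext' hΛ⟩

variable [WittBase.Over A W]

/-- Modulo `ϖ`, restriction to `N^n` turns the Frobenius into the lateral Frobenius. -/
theorem iX_frobX_apply {n : ℕ} (Θ : E.X (n + 1)) {B : NilAlg W} (hB : B.str W.ϖ = 0)
    (x : (E.N (n + 2)).obj B) : (E.iX (n + 2) (E.frobX (n + 1) Θ)).toFun B x =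
      (E.latStar n (E.iX (n + 1) Θ)).toFun B x := by
  obtain ⟨y, rfl⟩ := E.exists_eq_nV x
  have h : Witt.frob (Witt.versch y : W.Witt (n + 2) B.str) =
      (Witt.versch (Witt.frob y) : W.Witt (n + 1) (B.str.comp W.φ)) := by
    have hq : W.q ≠ 0 := by have := W.one_lt_q; omega
    ext i
    rw [Witt.frob_coeff_of_ϖ_eq_zero hB]
    refine Fin.cases ?_ (fun j => ?_) i
    · exact zero_pow hq
    · exact (Witt.frob_coeff_of_ϖ_eq_zero (by rw [RingHom.comp_apply, W.φ_ϖ, hB]) y j).symm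
  have h1 := congrArg (Subtype.val) (E.lat_nV n B y)
  change Θ.toFun B.tw _ = Θ.toFun B.tw _
  exact (congrArg (Θ.toFun B.tw) h).trans (congrArg (Θ.toFun B.tw) h1).symm

end AdmissibleModule

namespace AdmissibleModule

open Finset GaFun WittBase

variable {A : Type v} [CommRing A] {R : Type u} [CommRing R] [Algebra A R] {W : WittBase R}
  (E : AdmissibleModule A W) [W.IsUniformized] [WittBase.Over A W]
  {t : A} (ht : algebraMap A R t = W.ϖ) (ϑ : (E.N 1).HomGa) (hϑ : E.IsNormalized ϑ)

/-! ### Coordinates with respect to the characters `Ψ_j` -/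

/-- The coordinates of a character of `N^n` with respect to `Ψ_1, …, Ψ_n`, as a sequence that is extended
by zero; the coordinate of `Ψ_{k+1}` has the index `k`. -/
noncomputable def coord (n : ℕ) : (E.N n).HomGa →ₗ[R] (ℕ → R) where
  toFun ψ k := if h : k < n then (E.basisN ht ϑ hϑ n).repr ψ ⟨k, h⟩ else 0
  map_add' ψ ψ' := by
    ext k
    simp only [map_add, Finsupp.add_apply, Pi.add_apply]
    split_ifs <;> simp
  map_smul' r ψ := by
    ext k
    simp only [map_smul, Finsupp.smul_apply, Pi.smul_apply, RingHom.id_apply]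
    split_ifs <;> simp

theorem coord_apply_fin {n : ℕ} (ψ : (E.N n).HomGa) (j : Fin n) :
    E.coord ht ϑ hϑ n ψ j = (E.basisN ht ϑ hϑ n).repr ψ j := dif_pos j.2

theorem coord_of_le {n k : ℕ} (h : n ≤ k) (ψ : (E.N n).HomGa) : E.coord ht ϑ hϑ n ψ k = 0 :=
  dif_neg (not_lt.2 h)

theorem basisN_apply (n : ℕ) (j : Fin n) : E.basisN ht ϑ hϑ n j = E.psiN ϑ n j :=
  Module.Basis.mk_apply ..

theorem sum_coord {n : ℕ} (ψ : (E.N n).HomGa) :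
    ∑ j : Fin n, E.coord ht ϑ hϑ n ψ j • E.psiN ϑ n j = ψ := by
  simpa only [coord_apply_fin, basisN_apply] using (E.basisN ht ϑ hϑ n).sum_repr ψ

theorem coord_sum_psiN {n : ℕ} (b : Fin n → R) (j : Fin n) :
    E.coord ht ϑ hϑ n (∑ i, b i • E.psiN ϑ n i) j = b j := by
  simp only [coord_apply_fin, ← E.basisN_apply ht ϑ hϑ]
  exact congrFun ((E.basisN ht ϑ hϑ n).repr_sum_self b) j

theorem coord_psiN {n : ℕ} (j : Fin n) (k : ℕ) :
    E.coord ht ϑ hϑ n (E.psiN ϑ n j) k = if k = j then 1 else 0 := by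
  by_cases h : k < n
  · rw [show k = ((⟨k, h⟩ : Fin n) : ℕ) from rfl, coord_apply_fin, ← E.basisN_apply ht ϑ hϑ,
      Module.Basis.repr_self, Finsupp.single_apply]
    simp [Fin.ext_iff, eq_comm]
  · rw [coord_of_le _ _ _ _ (not_lt.1 h), if_neg]
    have := j.2
    omega

theorem coord_injective (n : ℕ) : Function.Injective (E.coord ht ϑ hϑ n) := by
  rw [injective_iff_map_eq_zero]
  intro ψ hψ
  rw [← E.sum_coord ht ϑ hϑ ψ, hψ]
  simp

theorem coord_uN {m n : ℕ} (h : m ≤ n) (ψ : (E.N m).HomGa) :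
    E.coord ht ϑ hϑ n (E.uN h ψ) = E.coord ht ϑ hϑ m ψ := by
  have : (E.coord ht ϑ hϑ n).comp (E.uN h) = E.coord ht ϑ hϑ m := by
    refine (E.basisN ht ϑ hϑ m).ext fun j => ?_
    ext k
    rw [LinearMap.comp_apply, basisN_apply, uN_psiN, coord_psiN, coord_psiN]
    rfl
  exact DFunLike.congr_fun this ψ

theorem mem_range_uN {m n : ℕ} (h : m ≤ n) (ψ : (E.N n).HomGa)
    (hψ : ∀ k, m ≤ k → E.coord ht ϑ hϑ n ψ k = 0) : ψ ∈ LinearMap.range (E.uN h) := by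
  refine ⟨∑ j : Fin m, E.coord ht ϑ hϑ n ψ j • E.psiN ϑ m j, E.coord_injective ht ϑ hϑ n ?_⟩
  ext k
  rw [coord_uN]
  by_cases hk : k < m
  · exact E.coord_sum_psiN ht ϑ hϑ _ ⟨k, hk⟩
  · rw [coord_of_le _ _ _ _ (not_lt.1 hk), hψ k (not_lt.1 hk)]

/-- The coordinates can be read off modulo `ϖ` from the values on algebras over `R / ϖ`. -/
theorem dvd_coord {n : ℕ} (ψ : (E.N n).HomGa)
    (h : ∀ B : NilAlg W, B.str W.ϖ = 0 → ∀ x, ψ.toFun B x = 0) (k : ℕ) :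
    W.ϖ ∣ E.coord ht ϑ hϑ n ψ k := by
  by_cases hk : k < n
  · exact E.dvd_of_sum_psiN_eq_zero ϑ hϑ (fun j : Fin n => E.coord ht ϑ hϑ n ψ j)
      (fun B hB x => by rw [sum_coord]; exact h B hB x) ⟨k, hk⟩
  · rw [coord_of_le _ _ _ _ (not_lt.1 hk)]
    exact dvd_zero _

/-! ### The lateral Frobenius in coordinates -/

/-- The pullback along the lateral Frobenius, as a semilinear map. -/
noncomputable def latStarₛₗ (n : ℕ) : (E.N (n + 1)).HomGa →ₛₗ[W.φ] (E.N (n + 2)).HomGa where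
  toFun := E.latStar n
  map_add' _ _ := rfl
  map_smul' _ _ := rfl

theorem latStar_uN {m n : ℕ} (h : m + 1 ≤ n + 1) (ψ : (E.N (m + 1)).HomGa) :
    E.latStar n (E.uN h ψ) = E.uN (Nat.succ_le_succ h) (E.latStar m ψ) := by
  refine FormalModule.HomGa.ext' fun B x => congrArg (ψ.toFun B.tw) ?_
  obtain ⟨y, rfl⟩ := E.exists_eq_nV x
  have h1 := E.lat_nV n B y
  have h2 : (E.projN (Nat.succ_le_succ h)).app B (E.nV y) =
      E.nV (Witt.trunc h y) := by
    refine Subtype.ext (Witt.ext (funext fun i => ?_))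
    exact Fin.cases rfl (fun _ => rfl) i
  have h3 := E.lat_nV m B (Witt.trunc h y)
  refine (congrArg ((E.projN h).app B.tw) h1).trans (Eq.trans ?_
    (((congrArg (E.lat m B) h2).trans h3).symm))
  have h4 := Witt.trunc_frob (Nat.le_of_succ_le_succ h) y
  refine Subtype.ext (Witt.ext (funext fun i => ?_))
  refine Fin.cases rfl (fun j => ?_) i
  exact congrFun (congrArg Witt.coeff h4) j

theorem latStar_psiN {n : ℕ} (j : Fin (n + 1)) :
    E.latStar n (E.psiN ϑ (n + 1) j) = E.psiN ϑ (n + 2) j.succ :=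
  E.latStar_uN (Nat.succ_le_succ (Nat.le_of_lt_succ j.2)) (E.psiHom ϑ j)

theorem coord_latStar {n : ℕ} (ψ : (E.N (n + 1)).HomGa) (k : ℕ) :
    E.coord ht ϑ hϑ (n + 2) (E.latStar n ψ) k =
      ∑ j : Fin (n + 1), W.φ (E.coord ht ϑ hϑ (n + 1) ψ j) * if k = j + 1 then 1 else 0 := by
  have h : E.latStar n ψ =
      ∑ j : Fin (n + 1), W.φ (E.coord ht ϑ hϑ (n + 1) ψ j) • E.psiN ϑ (n + 2) j.succ := by
    have h1 := congrArg (E.latStarₛₗ n) (E.sum_coord ht ϑ hϑ ψ)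
    rw [map_sum] at h1
    refine h1.symm.trans (sum_congr rfl fun j _ => ?_)
    rw [LinearMap.map_smulₛₗ]
    exact congrArg _ (E.latStar_psiN ϑ j)
  rw [h, map_sum, Finset.sum_apply]
  refine sum_congr rfl fun j _ => ?_
  rw [map_smul, Pi.smul_apply, coord_psiN, smul_eq_mul, Fin.val_succ]

theorem coord_latStar_zero {n : ℕ} (ψ : (E.N (n + 1)).HomGa) :
    E.coord ht ϑ hϑ (n + 2) (E.latStar n ψ) 0 = 0 := by
  rw [coord_latStar]
  simp

theorem coord_latStar_succ {n : ℕ} (ψ : (E.N (n + 1)).HomGa) (k : ℕ) :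
    E.coord ht ϑ hϑ (n + 2) (E.latStar n ψ) (k + 1) = W.φ (E.coord ht ϑ hϑ (n + 1) ψ k) := by
  rw [coord_latStar]
  by_cases hk : k < n + 1
  · rw [sum_eq_single (⟨k, hk⟩ : Fin (n + 1))]
    · simp
    · intro j _ hj
      rw [if_neg, mul_zero]
      intro h
      exact hj (Fin.ext (by dsimp only; omega))
    · simp
  · rw [coord_of_le _ _ _ _ (not_lt.1 hk), map_zero]
    refine sum_eq_zero fun j _ => ?_
    rw [if_neg (by have := j.2; omega), mul_zero]

/-! ### Coordinates of differential characters -/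

/-- The coordinates of the restriction of a character of `J^n E` to `N^n`. -/
noncomputable def coordX (n : ℕ) : E.X n →ₗ[R] (ℕ → R) := (E.coord ht ϑ hϑ n).comp (E.iX n)

theorem coordX_of_le {n k : ℕ} (h : n ≤ k) (Θ : E.X n) : E.coordX ht ϑ hϑ n Θ k = 0 :=
  E.coord_of_le ht ϑ hϑ h _

theorem coordX_uX {m n : ℕ} (h : m ≤ n) (Θ : E.X m) :
    E.coordX ht ϑ hϑ n (E.uX h Θ) = E.coordX ht ϑ hϑ m Θ :=
  E.coord_uN ht ϑ hϑ h (E.iX m Θ)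

/-- The coordinates of an element of the colimit `X_∞(E)`. -/
noncomputable def coordInf : E.XInf →ₗ[R] (ℕ → R) :=
  Module.DirectLimit.lift R ℕ E.X _ (E.coordX ht ϑ hϑ) fun _ _ h => E.coordX_uX ht ϑ hϑ h

theorem coordInf_toXInf {n : ℕ} (Θ : E.X n) :
    E.coordInf ht ϑ hϑ (E.toXInf n Θ) = E.coordX ht ϑ hϑ n Θ :=
  Module.DirectLimit.lift_of _ _ _

theorem exists_coordInf_eq_zero (y : E.XInf) : ∃ N, ∀ k, N ≤ k → E.coordInf ht ϑ hϑ y k = 0 := by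
  obtain ⟨n, -, Θ, rfl⟩ := E.exists_toXInf 0 y
  exact ⟨n, fun k hk => by rw [coordInf_toXInf, coordX_of_le _ _ _ _ hk]⟩

/-- The order of an element of `X_∞(E)` is bounded by the length of its sequence of coordinates. -/
theorem mem_range_toXInf {m : ℕ} {y : E.XInf} (hy : ∀ k, m ≤ k → E.coordInf ht ϑ hϑ y k = 0) :
    ∃ Θ : E.X m, E.toXInf m Θ = y := by
  obtain ⟨n, hmn, Θ, rfl⟩ := E.exists_toXInf m y
  rw [coordInf_toXInf] at hy
  obtain ⟨Θ', rfl⟩ := E.exists_eq_uX hmn Θ (E.mem_range_uN ht ϑ hϑ hmn _ hy)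
  exact ⟨Θ', (E.toXInf_uX hmn Θ').symm⟩

/-- The Frobenius raises the index of the coordinates, up to multiples of `ϖ`. -/
theorem dvd_coordInf_frobXInf (y : E.XInf) : W.ϖ ∣ E.coordInf ht ϑ hϑ (E.frobXInf y) 0 ∧
    ∀ k, W.ϖ ∣ E.coordInf ht ϑ hϑ (E.frobXInf y) (k + 1) - W.φ (E.coordInf ht ϑ hϑ y k) := by
  obtain ⟨n, hn, Θ, rfl⟩ := E.exists_toXInf 1 y
  obtain ⟨n, rfl⟩ : ∃ l, n = l + 1 := ⟨n - 1, by omega⟩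
  have h := E.dvd_coord ht ϑ hϑ
    (E.iX (n + 2) (E.frobX (n + 1) Θ) - E.latStar n (E.iX (n + 1) Θ)) fun B hB x => by
      rw [FormalModule.HomGa.sub_apply, iX_frobX_apply _ _ hB, sub_self]
  rw [map_sub] at h
  rw [frobXInf_toXInf, coordInf_toXInf, coordInf_toXInf]
  refine ⟨?_, fun k => ?_⟩
  · have := h 0
    rwa [Pi.sub_apply, coord_latStar_zero, sub_zero] at this
  · have := h (k + 1)
    rwa [Pi.sub_apply, coord_latStar_succ] at this

theorem coordX_injective (hT : ∃ s, ¬ W.ϖ ∣ E.coef t s) (n : ℕ) :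
    Function.Injective (E.coordX ht ϑ hϑ n) :=
  (E.coord_injective ht ϑ hϑ n).comp (E.iX_injective ht hT n)

theorem coordInf_injective (hT : ∃ s, ¬ W.ϖ ∣ E.coef t s) :
    Function.Injective (E.coordInf ht ϑ hϑ) := by
  rw [injective_iff_map_eq_zero]
  intro y hy
  obtain ⟨n, -, Θ, rfl⟩ := E.exists_toXInf 0 y
  rw [coordInf_toXInf] at hy
  rw [E.coordX_injective ht ϑ hϑ hT n (hy.trans (map_zero _).symm), map_zero]

/-- An element of `X_∞(E)` is divisible by `ϖ` if its coordinates are. -/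
theorem exists_eq_ϖ_smul_of_dvd_coordInf (hT : ∃ s, ¬ W.ϖ ∣ E.coef t s) {y : E.XInf}
    (h : ∀ k, W.ϖ ∣ E.coordInf ht ϑ hϑ y k) : ∃ y', y = W.ϖ • y' := by
  obtain ⟨n, -, Θ, rfl⟩ := E.exists_toXInf 0 y
  rw [coordInf_toXInf] at h
  choose d hd using h
  obtain ⟨Θ', rfl⟩ := E.exists_eq_ϖ_smul ht hT Θ (∑ j : Fin n, d j • E.psiN ϑ n j) (by
    rw [← E.sum_coord ht ϑ hϑ (E.iX n Θ), smul_sum]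
    refine sum_congr rfl fun j _ => ?_
    rw [← mul_smul, ← hd]
    rfl)
  exact ⟨_, map_smul ..⟩

end AdmissibleModule

/-- Elimination with a sequence of vectors `M j`, each with a unit at the index `a + j` and with entries in the
ideal `I` beyond it: a vector `d` with entries in `I` from the index `a + s` on agrees modulo `I`, from the
index `a` on, with a combination of the first `s` vectors. -/
theorem exists_sub_sum_mul_mem {R : Type*} [CommRing R] (I : Ideal R) (a : ℕ) (M : ℕ → ℕ → R)
    (hu : ∀ j, IsUnit (M j (a + j))) (hM : ∀ j l, a + j < l → M j l ∈ I) (s : ℕ) (d : ℕ → R)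
    (hd : ∀ l, a + s ≤ l → d l ∈ I) :
    ∃ c : ℕ → R, ∀ l, a ≤ l → d l - ∑ j ∈ Finset.range s, c j * M j l ∈ I := by
  induction s generalizing d with
  | zero => exact ⟨0, fun l hl => by simpa using hd l (by omega)⟩
  | succ s ih =>
    obtain ⟨v, hv⟩ := (hu s).exists_left_inv
    obtain ⟨c, hc⟩ := ih (fun l => d l - d (a + s) * v * M s l) (fun l hl => by
      rcases hl.eq_or_lt with rfl | hl
      · rw [mul_assoc, hv, mul_one, sub_self]; exact I.zero_mem
      · exact I.sub_mem (hd l (by omega)) (I.mul_mem_left _ (hM s l hl)))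
    refine ⟨Function.update c s (d (a + s) * v), fun l hl => ?_⟩
    rw [Finset.sum_range_succ, Function.update_self, Finset.sum_congr rfl (fun j hj => by
      rw [Function.update_of_ne (Finset.mem_range.1 hj).ne]), ← sub_sub, sub_right_comm]
    exact hc l hl

namespace AdmissibleModule

open Finset GaFun WittBase

variable {A : Type v} [CommRing A] {R : Type u} [CommRing R] [Algebra A R] {W : WittBase R}
  (E : AdmissibleModule A W)

/-! ### Evaluation of elements of `X_∞(E)` -/

/-- The evaluation of the elements of `X_∞(E)` at a Witt vector of finite length, extended by zero. -/
noncomputable def evInf (n : ℕ) (B : NilAlg W) (x : W.Witt n B.str) : E.XInf →+ B.carrier :=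
  letI : Module R B.carrier := Module.compHom B.carrier B.str
  (Module.DirectLimit.lift R ℕ E.X (fun _ _ h => E.uX h)
    (fun N => ({ toFun := fun Θ => Θ.toFun B (Witt.extZ x : W.Witt N B.str)
                 map_add' := fun _ _ => rfl
                 map_smul' := fun _ _ => rfl } : E.X N →ₗ[R] B.carrier))
    fun _ _ _ _ => rfl).toAddMonoidHom

theorem evInf_toXInf {n : ℕ} (B : NilAlg W) (x : W.Witt n B.str) {N : ℕ} (Θ : E.X N) :
    E.evInf n B x (E.toXInf N Θ) = Θ.toFun B (Witt.extZ x : W.Witt N B.str) := by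
  let _ : Module R B.carrier := Module.compHom B.carrier B.str
  exact Module.DirectLimit.lift_of (R := R) (ι := ℕ) (G := E.X) (f := fun _ _ h => E.uX h)
    (P := B.carrier) (fun N => ({ toFun := fun Θ => Θ.toFun B (Witt.extZ x : W.Witt N B.str)
                                  map_add' := fun _ _ => rfl
                                  map_smul' := fun _ _ => rfl } : E.X N →ₗ[R] B.carrier))
    (fun _ _ _ _ => rfl) Θ

theorem evInf_smul {n : ℕ} (B : NilAlg W) (x : W.Witt n B.str) (r : R) (y : E.XInf) :
    E.evInf n B x (r • y) = B.str r * E.evInf n B x y := by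
  obtain ⟨N, -, Θ, rfl⟩ := E.exists_toXInf 0 y
  rw [← map_smul, evInf_toXInf, evInf_toXInf]
  rfl

theorem evInf_add {n : ℕ} (B : NilAlg W) (x x' : W.Witt n B.str) (y : E.XInf) :
    E.evInf n B (x + x') y = E.evInf n B x y + E.evInf n B x' y := by
  obtain ⟨N, -, Θ, rfl⟩ := E.exists_toXInf 0 y
  rw [evInf_toXInf, evInf_toXInf, evInf_toXInf]
  exact (congrArg (Θ.toFun B) (Witt.extZ_add x x')).trans (map_add (Θ.toFun B) _ _)

theorem evInf_mapFun {n : ℕ} {B C : NilAlg W} (g : NilAlg.Hom B C) (x : W.Witt n B.str) (y : E.XInf) :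
    E.evInf n C (Witt.mapFun g.toRingHom x) y = g.toRingHom (E.evInf n B x y) := by
  obtain ⟨N, -, Θ, rfl⟩ := E.exists_toXInf 0 y
  rw [evInf_toXInf, evInf_toXInf]
  refine Eq.trans ?_ (Θ.naturality g _)
  exact congrArg (Θ.toFun C) (Witt.mapFun_extZ g.toRingHom x).symm

variable [W.IsUniformized] [WittBase.Over A W]
  {t : A} (ht : algebraMap A R t = W.ϖ) (ϑ : (E.N 1).HomGa) (hϑ : E.IsNormalized ϑ)

/-- If the coordinates from the index `n` on vanish in `B`, then a character on `B`-valued points depends only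
on the truncation to `J^n E`. -/
theorem toFun_eq_evInf {n N : ℕ} (h : n ≤ N) (Θ : E.X N) (B : NilAlg W)
    (hB : ∀ k, n ≤ k → B.str (E.coordX ht ϑ hϑ N Θ k) = 0) (x : W.Witt N B.str) :
    Θ.toFun B x = E.evInf n B (Witt.truncFun h x) (E.toXInf N Θ) := by
  rw [evInf_toXInf]
  have h0 : (x - Witt.extZ (Witt.truncFun h x) : W.Witt N B.str).coeff 0 = 0 := by
    have h1 := Witt.extZ_coeff_zero (n := N) (Witt.truncFun h x)
    exact (congrArg (x.coeff 0 - ·) h1).trans (sub_self _)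
  have h1 : (E.projN h).app B ⟨(x - Witt.extZ (Witt.truncFun h x) : W.Witt N B.str), h0⟩ = 0 := by
    refine Subtype.ext ?_
    have h2 := map_sub (Witt.trunc (ρ := B.str) (W := W) h) x (Witt.extZ (Witt.truncFun h x))
    refine h2.trans (sub_eq_zero.2 ?_)
    exact (Witt.truncFun_extZ h (Witt.truncFun h x)).symm
  have h3 : ∀ z : (E.N N).obj B, (E.projN h).app B z = 0 → (E.iX N Θ).toFun B z = 0 := by
    intro z hz
    rw [← E.sum_coord ht ϑ hϑ (E.iX N Θ), FormalModule.HomGa.sum_apply]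
    refine sum_eq_zero fun j _ => ?_
    rw [FormalModule.HomGa.smul_apply]
    by_cases hj : (j : ℕ) < n
    · have h4 : E.psiN ϑ N j = E.uN h (E.psiN ϑ n ⟨j, hj⟩) := (E.uN_psiN ϑ h ⟨j, hj⟩).symm
      have h5 : (E.uN h (E.psiN ϑ n ⟨j, hj⟩)).toFun B z = 0 :=
        (congrArg ((E.psiN ϑ n ⟨j, hj⟩).toFun B) hz).trans (map_zero _)
      rw [h4, h5, mul_zero]
    · exact (congrArg (· * _) (hB j (not_lt.1 hj))).trans (zero_mul _)
  exact sub_eq_zero.1 ((map_sub (Θ.toFun B) x (Witt.extZ (Witt.truncFun h x) : W.Witt N B.str)).symm.trans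
    (h3 _ h1))

theorem evInf_act {n : ℕ} (y : E.XInf) (B : NilAlg W)
    (hB : ∀ k, n ≤ k → B.str (E.coordInf ht ϑ hϑ y k) = 0) (a : A) (x : W.Witt n B.str) :
    E.evInf n B (E.act (B.witt n) a x) y = B.str (algebraMap A R a) * E.evInf n B x y := by
  obtain ⟨N, hN, Θ, rfl⟩ := E.exists_toXInf n y
  rw [coordInf_toXInf] at hB
  have h1 := E.toFun_eq_evInf ht ϑ hϑ hN Θ B hB
    (E.act (B.witt N) a (Witt.extZ x : W.Witt N B.str))
  have h2 : (Witt.truncFun hN (E.act (B.witt N) a (Witt.extZ x : W.Witt N B.str)) : W.Witt n B.str) =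
      E.act (B.witt n) a x :=
    (E.naturality (NilAlg.Hom.trunc B hN) a (Witt.extZ x : W.Witt N B.str)).symm.trans
      (congrArg (E.act (B.witt n) a) (Witt.truncFun_extZ hN x))
  have h3 := Θ.map_smul B a (Witt.extZ x : W.Witt N B.str)
  rw [evInf_toXInf E B x]
  exact (congrArg (fun z => E.evInf n B z (E.toXInf N Θ)) h2).symm.trans (h1.symm.trans h3)

/-! ### Limits of characters -/

/-- A `ϖ`-adic limit of elements of `X_∞(E)` whose coordinates from the index `n` on tend to zero is a
character of `J^n E`: its value on an algebra in which `ϖ ^ K = 0` is that of the `K`-th term. -/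
theorem exists_limit {n : ℕ} (y z : ℕ → E.XInf) (hyz : ∀ k, y (k + 1) = y k + W.ϖ ^ (k + 1) • z k)
    (hy : ∀ k i, n ≤ i → W.ϖ ^ (k + 1) ∣ E.coordInf ht ϑ hϑ (y k) i) :
    ∃ Θ : E.X n, ∀ B : NilAlg W, B.str W.ϖ = 0 → ∀ x : W.Witt n B.str,
      Θ.toFun B x = E.evInf n B x (y 0) := by
  have hstep : ∀ (B : NilAlg W) (x : W.Witt n B.str) (k l : ℕ), B.str W.ϖ ^ (k + 1) = 0 →
      E.evInf n B x (y (k + l)) = E.evInf n B x (y k) := by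
    intro B x k l hB
    induction l with
    | zero => rfl
    | succ l ih =>
      rw [← add_assoc, hyz, map_add, evInf_smul, ih, map_pow,
        pow_eq_zero_of_le (by omega : k + 1 ≤ k + l + 1) hB, zero_mul, add_zero]
  have hstat : ∀ (B : NilAlg W) (x : W.Witt n B.str) (k l : ℕ), B.str W.ϖ ^ (k + 1) = 0 →
      B.str W.ϖ ^ (l + 1) = 0 → E.evInf n B x (y k) = E.evInf n B x (y l) := by
    intro B x k l hk hl
    rw [← hstep B x k l hk, ← hstep B x l k hl, add_comm]
  choose K hK using fun B : NilAlg W => B.nil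
  have hK' : ∀ B : NilAlg W, B.str W.ϖ ^ (K B + 1) = 0 := fun B => by rw [pow_succ, hK, zero_mul]
  refine ⟨⟨fun B => AddMonoidHom.mk' (fun x : W.Witt n B.str => E.evInf n B x (y (K B)))
    fun x x' => E.evInf_add B x x' _, fun B a x => ?_, fun {B C} g x => ?_⟩, fun B hB x => ?_⟩
  · refine E.evInf_act ht ϑ hϑ (y (K B)) B (fun k hk => ?_) a x
    obtain ⟨c, hc⟩ := hy (K B) k hk
    rw [hc, map_mul, map_pow, hK', zero_mul]
  · refine (hstat C _ (K C) (K B) (hK' C) ?_).trans (E.evInf_mapFun g x _)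
    rw [← g.comp_str, RingHom.comp_apply, ← map_pow, hK', map_zero]
  · exact hstat B x _ 0 (hK' B) (by simpa using hB)

end AdmissibleModule

namespace AdmissibleModule

open Finset GaFun WittBase

variable {A : Type v} [CommRing A] {R : Type u} [CommRing R] [Algebra A R] {W : WittBase R}
  (E : AdmissibleModule A W) [W.IsUniformized] [WittBase.Over A W]
  {t : A} (ht : algebraMap A R t = W.ϖ) (ϑ : (E.N 1).HomGa) (hϑ : E.IsNormalized ϑ)

/-! ### The leading coordinate -/

/-- The Frobenius shifts the last coordinate that is a unit. -/
theorem isUnit_coordInf_iterate {y : E.XInf} {a : ℕ} (hu : IsUnit (E.coordInf ht ϑ hϑ y a))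
    (hy : ∀ l, a < l → W.ϖ ∣ E.coordInf ht ϑ hϑ y l) (j : ℕ) :
    IsUnit (E.coordInf ht ϑ hϑ (E.frobXInf^[j] y) (a + j)) ∧
      ∀ l, a + j < l → W.ϖ ∣ E.coordInf ht ϑ hϑ (E.frobXInf^[j] y) l := by
  induction j with
  | zero => exact ⟨hu, hy⟩
  | succ j ih =>
    rw [Function.iterate_succ_apply']
    have h := (E.dvd_coordInf_frobXInf ht ϑ hϑ (E.frobXInf^[j] y)).2
    constructor
    · rw [W.isUnit_iff, ← add_assoc]
      intro hd
      have h1 := (dvd_sub_right hd).1 (h (a + j))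
      rw [W.dvd_φ_iff] at h1
      exact W.isUnit_iff.1 ih.1 h1
    · intro l hl
      obtain ⟨l, rfl⟩ : ∃ i, l = i + 1 := ⟨l - 1, by omega⟩
      refine (dvd_sub_left ?_).1 (h l)
      rw [W.dvd_φ_iff]
      exact ih.2 l (by omega)

theorem coordInf_sum {s : ℕ} (c : ℕ → R) (z : ℕ → E.XInf) (l : ℕ) :
    E.coordInf ht ϑ hϑ (∑ j ∈ range s, c j • z j) l =
      ∑ j ∈ range s, c j * E.coordInf ht ϑ hϑ (z j) l := by
  rw [map_sum, Finset.sum_apply]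
  exact sum_congr rfl fun j _ => by rw [map_smul]; rfl

/-- If the last unit coordinate of an element of `X_∞(E)` has the index `a`, then there is a nonzero character
of order `a + 1`. The Frobenius provides elements whose last unit coordinates have the indices `a + 1`, `a + 2`,
…; they serve to eliminate the coordinates beyond `a` modulo all powers of `ϖ`, and the limit is the character
in question. -/
theorem nontrivial_X_of_isUnit {y : E.XInf} {a : ℕ} (hu : IsUnit (E.coordInf ht ϑ hϑ y a))
    (hy : ∀ l, a < l → W.ϖ ∣ E.coordInf ht ϑ hϑ y l) : Nontrivial (E.X (a + 1)) := by
  have hcor : ∀ d : ℕ → R, (∃ N, ∀ l, N ≤ l → d l = 0) →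
      ∃ Ξ : E.XInf, ∀ l, a < l → W.ϖ ∣ d l - E.coordInf ht ϑ hϑ Ξ l := by
    rintro d ⟨N, hN⟩
    obtain ⟨c, hc⟩ := exists_sub_sum_mul_mem (Ideal.span {W.ϖ}) (a + 1)
      (fun j l => E.coordInf ht ϑ hϑ (E.frobXInf^[j + 1] y) l)
      (fun j => by
        have := (E.isUnit_coordInf_iterate ht ϑ hϑ hu hy (j + 1)).1
        rwa [← add_assoc, add_right_comm] at this)
      (fun j l hl => Ideal.mem_span_singleton.2
        ((E.isUnit_coordInf_iterate ht ϑ hϑ hu hy (j + 1)).2 l (by omega)))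
      N d (fun l hl => by rw [hN l (by omega)]; exact Ideal.zero_mem _)
    refine ⟨∑ j ∈ range N, c j • E.frobXInf^[j + 1] y, fun l hl => ?_⟩
    rw [coordInf_sum]
    exact Ideal.mem_span_singleton.1 (hc l hl)
  have hstep : ∀ (k : ℕ) (z : E.XInf),
      (∀ l, a < l → W.ϖ ^ (k + 1) ∣ E.coordInf ht ϑ hϑ z l) →
      ∃ Ξ : E.XInf, ∀ l, a < l → W.ϖ ^ (k + 2) ∣
        E.coordInf ht ϑ hϑ (z + W.ϖ ^ (k + 1) • Ξ) l := by
    intro k z hz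
    choose! d hd using hz
    obtain ⟨N, hN⟩ := E.exists_coordInf_eq_zero ht ϑ hϑ z
    obtain ⟨Ξ, hΞ⟩ := hcor d ⟨N + a + 1, fun l hl => W.ϖ_pow_cancel (k + 1) (by
      rw [← hd l (by omega), hN l (by omega)])⟩
    refine ⟨-Ξ, fun l hl => ?_⟩
    rw [map_add, map_smul, map_neg, Pi.add_apply, Pi.smul_apply, Pi.neg_apply, hd l hl, smul_eq_mul,
      ← mul_add, ← sub_eq_add_neg, pow_succ _ (k + 1)]
    exact mul_dvd_mul_left _ (hΞ l hl)
  choose! Ξ hΞ using hstep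
  let z : ℕ → E.XInf := fun k => Nat.rec y (fun k z => z + W.ϖ ^ (k + 1) • Ξ k z) k
  have hz : ∀ k i, a + 1 ≤ i → W.ϖ ^ (k + 1) ∣ E.coordInf ht ϑ hϑ (z k) i := by
    intro k
    induction k with
    | zero => intro i hi; rw [zero_add, pow_one]; exact hy i hi
    | succ k ih => exact hΞ k (z k) ih
  obtain ⟨Θ, hΘ⟩ := E.exists_limit ht ϑ hϑ z (fun k => Ξ k (z k)) (fun _ => rfl) hz
  refine nontrivial_of_ne Θ 0 fun h0 => ?_
  -- Over `R / ϖ` the limit is the given element, which has a coordinate that does not vanish there.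
  obtain ⟨N, hN, Θ', rfl⟩ := E.exists_toXInf (a + 1) y
  rw [coordInf_toXInf] at hu
  rw [coordInf_toXInf] at hy
  refine W.isUnit_iff.1 hu (E.dvd_coord ht ϑ hϑ (E.iX N Θ') (fun B hB x => ?_) a)
  have h1 := E.toFun_eq_evInf ht ϑ hϑ hN Θ' B (fun k hk => by
    obtain ⟨c, hc⟩ := hy k hk
    rw [hc, map_mul, hB, zero_mul]) x.1
  refine h1.trans ((hΘ B hB _).symm.trans ?_)
  rw [h0]
  rfl

/-- A nonzero element of `X_∞(E)` is a multiple by a power of `ϖ` of one with a unit coordinate. -/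
theorem exists_isUnit_coordInf (hT : ∃ s, ¬ W.ϖ ∣ E.coef t s) {y : E.XInf} (hy : y ≠ 0) :
    ∃ k y', y = W.ϖ ^ k • y' ∧ ∃ l, ¬ W.ϖ ∣ E.coordInf ht ϑ hϑ y' l := by
  by_contra! h
  have key : ∀ k : ℕ, ∃ y', y = W.ϖ ^ k • y' := by
    intro k
    induction k with
    | zero => exact ⟨y, by simp⟩
    | succ k ih =>
      obtain ⟨y', hy'⟩ := ih
      obtain ⟨y'', rfl⟩ := E.exists_eq_ϖ_smul_of_dvd_coordInf ht ϑ hϑ hT (h k y' hy')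
      exact ⟨y'', by rw [hy', smul_smul, pow_succ]⟩
  refine hy (E.coordInf_injective ht ϑ hϑ hT ?_)
  ext l
  rw [map_zero, Pi.zero_apply]
  refine W.eq_zero_of_forall_dvd fun k => ?_
  obtain ⟨y', hy'⟩ := key k
  exact ⟨E.coordInf ht ϑ hϑ y' l, by rw [hy', map_smul]; rfl⟩

/-- If `E` splits at `m`, there is a character of order `m` with leading coordinate `1`. -/
theorem exists_coordX_eq_one (hT : ∃ s, ¬ W.ϖ ∣ E.coef t s) {m : ℕ} (hm : E.SplitsAt m) :
    0 < m ∧ ∃ Θ : E.X m, E.coordX ht ϑ hϑ m Θ (m - 1) = 1 := by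
  have hm0 : 0 < m := by
    refine Nat.pos_of_ne_zero ?_
    rintro rfl
    have := E.subsingleton_X_zero ht hT
    have := hm.1
    exact not_subsingleton (E.X 0) ‹_›
  refine ⟨hm0, ?_⟩
  have := hm.1
  obtain ⟨Θ₀, hΘ₀⟩ := exists_ne (0 : E.X m)
  obtain ⟨k, y, hy, hl⟩ := E.exists_isUnit_coordInf ht ϑ hϑ hT (y := E.toXInf m Θ₀) (fun h => hΘ₀
    (E.coordX_injective ht ϑ hϑ hT m (by rw [← coordInf_toXInf, h, map_zero, map_zero])))
  have hsupp : ∀ l, m ≤ l → E.coordInf ht ϑ hϑ y l = 0 := fun l hl => W.ϖ_pow_cancel k (by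
    have h1 := congrFun (congrArg (E.coordInf ht ϑ hϑ) hy) l
    rw [coordInf_toXInf, coordX_of_le _ _ _ _ hl, map_smul] at h1
    exact h1.symm)
  obtain ⟨Θ, rfl⟩ := E.mem_range_toXInf ht ϑ hϑ hsupp
  -- The last index with a coordinate that is a unit.
  classical
  obtain ⟨a, ha, hmax⟩ : ∃ a, ¬ W.ϖ ∣ E.coordInf ht ϑ hϑ (E.toXInf m Θ) a ∧
      ∀ l, a < l → W.ϖ ∣ E.coordInf ht ϑ hϑ (E.toXInf m Θ) l := by
    obtain ⟨l, hl⟩ := hl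
    have hb : ∀ l, ¬ W.ϖ ∣ E.coordInf ht ϑ hϑ (E.toXInf m Θ) l → l ≤ m := fun l h => by
      by_contra hlt
      exact h (by rw [hsupp l (by omega)]; exact dvd_zero _)
    refine ⟨_, Nat.findGreatest_spec (P := fun l => ¬ W.ϖ ∣ E.coordInf ht ϑ hϑ (E.toXInf m Θ) l)
      (hb l hl) hl, fun i hi => ?_⟩
    by_contra hn
    exact absurd (Nat.le_findGreatest (P := fun l => ¬ W.ϖ ∣ E.coordInf ht ϑ hϑ (E.toXInf m Θ) l)
      (hb i hn) hn) (not_le.2 hi)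
  have ham : a < m := by
    by_contra hlt
    exact ha (by rw [hsupp a (by omega)]; exact dvd_zero _)
  have hnt := E.nontrivial_X_of_isUnit ht ϑ hϑ (W.isUnit_iff.2 ha) hmax
  have ham' : a = m - 1 := by
    by_contra hne
    have := hm.2 (a + 1) (by omega)
    exact not_subsingleton (E.X (a + 1)) this
  subst ham'
  obtain ⟨v, hv⟩ := (W.isUnit_iff.2 ha).exists_left_inv
  exact ⟨v • Θ, by rw [map_smul, ← coordInf_toXInf]; exact hv⟩

end AdmissibleModule

namespace AdmissibleModule

open Finset GaFun WittBase

variable {A : Type v} [CommRing A] {R : Type u} [CommRing R] [Algebra A R] {W : WittBase R}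
  (E : AdmissibleModule A W) [W.IsUniformized] [WittBase.Over A W]
  {t : A} (ht : algebraMap A R t = W.ϖ) (ϑ : (E.N 1).HomGa) (hϑ : E.IsNormalized ϑ)

/-! ### The modules of differential characters -/

/-- The condition on `Θ` fixes only the coordinate of `Ψ_m`, the other coordinates being arbitrary. -/
theorem isTheta_iff {m : ℕ} (hm : 0 < m) (Θ : E.X m) :
    E.IsTheta ϑ m Θ ↔ E.coordX ht ϑ hϑ m Θ (m - 1) = 1 := by
  have hval : ∀ (b : Fin m → R) (B : NilAlg W) (x : (E.N m).obj B),
      (∑ j, b j • E.psiN ϑ m j).toFun B x = ∑ j, B.str (b j) * E.Psi ϑ j B x := fun b B x => by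
    rw [FormalModule.HomGa.sum_apply]
    exact sum_congr rfl fun j _ => by rw [FormalModule.HomGa.smul_apply, psiN_toFun]
  constructor
  · rintro ⟨l, hl⟩
    have h : E.iX m Θ = ∑ j : Fin m, (if (j : ℕ) + 1 = m then 1 else - l j) • E.psiN ϑ m j := by
      refine FormalModule.HomGa.ext' fun B x => (hl B x).trans ((hval _ B x).trans ?_).symm
      refine sum_congr rfl fun j _ => ?_
      split_ifs <;> simp
    have h1 := E.coord_sum_psiN ht ϑ hϑ (fun j : Fin m => if (j : ℕ) + 1 = m then 1 else - l j)
      ⟨m - 1, by omega⟩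
    rw [← h, if_pos (by dsimp only; omega)] at h1
    exact h1
  · intro h
    refine ⟨fun j => - E.coordX ht ϑ hϑ m Θ j, fun B x => ?_⟩
    have h1 := E.sum_coord ht ϑ hϑ (E.iX m Θ)
    rw [← h1]
    refine (hval _ B x).trans (sum_congr rfl fun j _ => ?_)
    split_ifs with hj
    · have hj' : (j : ℕ) = m - 1 := by omega
      have h2 : E.coord ht ϑ hϑ m (E.iX m Θ) j = 1 := by rw [hj']; exact h
      rw [h2, map_one, one_mul]
    · rw [map_neg, neg_mul, neg_neg]
      rfl

section Leading

variable {m : ℕ}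

/-- An element without coordinates from the index `m - 1` on has order `m - 1`, hence is zero. -/
theorem eq_zero_of_coordInf_eq_zero (hsub : Subsingleton (E.X (m - 1))) {y : E.XInf}
    (hy : ∀ l, m - 1 ≤ l → E.coordInf ht ϑ hϑ y l = 0) : y = 0 := by
  obtain ⟨Θ, rfl⟩ := E.mem_range_toXInf ht ϑ hϑ hy
  rw [Subsingleton.elim Θ 0, map_zero]

variable {Θ : E.X m}

theorem isUnit_coordInf_of_leading (hm0 : 0 < m) (hΘ : E.coordX ht ϑ hϑ m Θ (m - 1) = 1) (j : ℕ) :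
    IsUnit (E.coordInf ht ϑ hϑ (E.frobXInf^[j] (E.toXInf m Θ)) (m - 1 + j)) := by
  refine (E.isUnit_coordInf_iterate ht ϑ hϑ (y := E.toXInf m Θ) (a := m - 1) ?_ (fun l hl => ?_) j).1
  · rw [coordInf_toXInf, hΘ]; exact isUnit_one
  · rw [coordInf_toXInf, coordX_of_le _ _ _ _ (by omega)]; exact dvd_zero _

theorem coordInf_iterate_eq_zero (Θ : E.X m) (j l : ℕ) (hl : m + j ≤ l) :
    E.coordInf ht ϑ hϑ (E.frobXInf^[j] (E.toXInf m Θ)) l = 0 := by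
  rw [← toXInf_frobXIter, coordInf_toXInf, coordX_of_le _ _ _ _ hl]

/-- The elements `φ^{*j} Θ` realize all sequences of coordinates from the index `m - 1` on. -/
theorem exists_coordInf_eq (hm0 : 0 < m) (hΘ : E.coordX ht ϑ hϑ m Θ (m - 1) = 1) (s : ℕ) (d : ℕ → R)
    (hd : ∀ l, m - 1 + s ≤ l → d l = 0) : ∃ c : ℕ → R, ∀ l, m - 1 ≤ l →
      d l = E.coordInf ht ϑ hϑ (∑ j ∈ range s, c j • E.frobXInf^[j] (E.toXInf m Θ)) l := by
  obtain ⟨c, hc⟩ := exists_sub_sum_mul_mem ⊥ (m - 1)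
    (fun j l => E.coordInf ht ϑ hϑ (E.frobXInf^[j] (E.toXInf m Θ)) l)
    (E.isUnit_coordInf_of_leading ht ϑ hϑ hm0 hΘ)
    (fun j l hl => E.coordInf_iterate_eq_zero ht ϑ hϑ Θ j l (by omega)) s d hd
  refine ⟨c, fun l hl => ?_⟩
  rw [coordInf_sum]
  exact sub_eq_zero.1 (hc l hl)

theorem exists_eq_sum (hm0 : 0 < m) (hsub : Subsingleton (E.X (m - 1)))
    (hΘ : E.coordX ht ϑ hϑ m Θ (m - 1) = 1) (s : ℕ) (y : E.XInf)
    (hy : ∀ l, m - 1 + s ≤ l → E.coordInf ht ϑ hϑ y l = 0) :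
    ∃ c : ℕ → R, y = ∑ j ∈ range s, c j • E.frobXInf^[j] (E.toXInf m Θ) := by
  obtain ⟨c, hc⟩ := E.exists_coordInf_eq ht ϑ hϑ hm0 hΘ s _ hy
  refine ⟨c, sub_eq_zero.1 (E.eq_zero_of_coordInf_eq_zero ht ϑ hϑ hsub fun l hl => ?_)⟩
  rw [map_sub, Pi.sub_apply, hc l hl, sub_self]

/-- The elements `φ^{*j} Θ` are linearly independent, since their leading coordinates have different
indices. -/
theorem eq_zero_of_sum_eq_zero (hm0 : 0 < m) (hΘ : E.coordX ht ϑ hϑ m Θ (m - 1) = 1) (s : ℕ)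
    (c : ℕ → R) (hc : ∑ j ∈ range s, c j • E.frobXInf^[j] (E.toXInf m Θ) = 0) :
    ∀ j < s, c j = 0 := by
  induction s with
  | zero => intro j hj; omega
  | succ s ih =>
    have h1 := congrFun (congrArg (E.coordInf ht ϑ hϑ) hc) (m - 1 + s)
    rw [coordInf_sum, map_zero, Pi.zero_apply, sum_range_succ, sum_eq_zero (fun j hj => by
      rw [E.coordInf_iterate_eq_zero ht ϑ hϑ Θ j _ (by have := mem_range.1 hj; omega), mul_zero]),
      zero_add] at h1
    have hs : c s = 0 := (E.isUnit_coordInf_of_leading ht ϑ hϑ hm0 hΘ s).mul_left_eq_zero.1 h1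
    rw [sum_range_succ, hs, zero_smul, add_zero] at hc
    intro j hj
    rcases Nat.lt_succ_iff_lt_or_eq.1 hj with h | rfl
    · exact ih hc j h
    · exact hs

/-- The characters `Θ, φ^* Θ, …, φ^{*d} Θ` form a basis of `X_{m+d}(E)`. -/
theorem exists_basis_X (hT : ∃ s, ¬ W.ϖ ∣ E.coef t s) (hm0 : 0 < m)
    (hsub : Subsingleton (E.X (m - 1))) (hΘ : E.coordX ht ϑ hϑ m Θ (m - 1) = 1) (d : ℕ) :
    ∃ b : Module.Basis (Fin (d + 1)) R (E.X (m + d)), ∀ j : Fin (d + 1),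
      b j = E.uX (Nat.add_le_add_left (Nat.le_of_lt_succ j.2) m) (E.frobXIter m j Θ) := by
  let w : Fin (d + 1) → E.X (m + d) := fun j =>
    E.uX (Nat.add_le_add_left (Nat.le_of_lt_succ j.2) m) (E.frobXIter m j Θ)
  have hw : ∀ c : ℕ → R, E.toXInf (m + d) (∑ j : Fin (d + 1), c j • w j) =
      ∑ j ∈ range (d + 1), c j • E.frobXInf^[j] (E.toXInf m Θ) := by
    intro c
    rw [map_sum, ← Fin.sum_univ_eq_sum_range]
    exact sum_congr rfl fun j _ => by rw [map_smul, toXInf_uX, toXInf_frobXIter]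
  have hli : LinearIndependent R w := by
    rw [Fintype.linearIndependent_iff]
    intro g hg i
    let c : ℕ → R := fun j => if h : j < d + 1 then g ⟨j, h⟩ else 0
    have hc : ∀ j : Fin (d + 1), c j = g j := fun j => dif_pos j.2
    rw [← hc]
    refine E.eq_zero_of_sum_eq_zero ht ϑ hϑ hm0 hΘ (d + 1) c ?_ i i.2
    rw [← hw]
    simp only [hc, hg, map_zero]
  refine ⟨Module.Basis.mk hli fun Θ' _ => ?_, fun j => Module.Basis.mk_apply ..⟩
  obtain ⟨c, hc⟩ := E.exists_eq_sum ht ϑ hϑ hm0 hsub hΘ (d + 1) (E.toXInf (m + d) Θ') (fun l hl => by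
    rw [coordInf_toXInf, coordX_of_le _ _ _ _ (by omega)])
  have h1 : Θ' = ∑ j : Fin (d + 1), c j • w j := by
    refine E.coordX_injective ht ϑ hϑ hT _ ?_
    rw [← coordInf_toXInf, ← coordInf_toXInf, hc, hw]
  rw [h1]
  exact Submodule.sum_mem _ fun j _ => Submodule.smul_mem _ _ (Submodule.subset_span ⟨j, rfl⟩)

/-- The characters of order `n` are the characters of `N^n` up to those of `N^{m-1}`. -/
theorem bijective_mkQ_comp_iX (hm0 : 0 < m)
    (hsub : Subsingleton (E.X (m - 1))) (hΘ : E.coordX ht ϑ hϑ m Θ (m - 1) = 1) {n : ℕ}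
    (h : m - 1 ≤ n) :
    Function.Bijective ((LinearMap.range (E.uN h)).mkQ.comp (E.iX n)) := by
  constructor
  · rw [injective_iff_map_eq_zero]
    intro Θ' h'
    rw [LinearMap.comp_apply, Submodule.mkQ_apply, Submodule.Quotient.mk_eq_zero] at h'
    obtain ⟨Θ'', rfl⟩ := E.exists_eq_uX h Θ' h'
    rw [Subsingleton.elim Θ'' 0, map_zero]
  · intro z
    obtain ⟨ψ, rfl⟩ := Submodule.mkQ_surjective _ z
    obtain ⟨c, hc⟩ := E.exists_coordInf_eq ht ϑ hϑ hm0 hΘ (n - (m - 1)) (E.coord ht ϑ hϑ n ψ)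
      (fun l hl => E.coord_of_le ht ϑ hϑ (by omega) ψ)
    obtain ⟨Θ', hΘ'⟩ := E.mem_range_toXInf ht ϑ hϑ (m := n) (fun k hk =>
      (hc k (h.trans hk)).symm.trans (E.coord_of_le ht ϑ hϑ hk ψ))
    refine ⟨Θ', ?_⟩
    rw [LinearMap.comp_apply, ← sub_eq_zero, ← map_sub, Submodule.mkQ_apply,
      Submodule.Quotient.mk_eq_zero]
    refine E.mem_range_uN ht ϑ hϑ h _ fun k hk => ?_
    rw [map_sub, Pi.sub_apply, hc k hk, ← hΘ', coordInf_toXInf]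
    exact sub_self _

end Leading

end AdmissibleModule

namespace AdmissibleModule

open Finset GaFun WittBase

variable {A : Type v} [CommRing A] {R : Type u} [CommRing R] [Algebra A R] {W : WittBase R}
  (E : AdmissibleModule A W)

/-! ### The action of the twisted polynomial ring -/

section Twisted

variable [WittBase.Over A W]

theorem twistedAct_monomial (i : ℕ) (r : R) (y : E.XInf) :
    E.twistedAct (SkewPolynomial.monomial i r : SkewPolynomial R) y = r • E.frobXInf^[i] y := by
  let _ := W.frobAction
  have h : E.twistedAct (SkewPolynomial.monomial i r : SkewPolynomial R) =
      Module.toAddMonoidEnd R E.XInf r * E.frobXInf ^ i :=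
    SkewMonoidAlgebra.liftNC_single (k := R) (G := Multiplicative ℕ) _ _ _ _
  have h1 : ∀ i : ℕ, ∀ y, (E.frobXInf ^ i) y = E.frobXInf^[i] y := by
    intro i
    induction i with
    | zero => exact fun _ => rfl
    | succ i ih =>
      intro y
      rw [pow_succ, Function.iterate_succ_apply, ← ih]
      rfl
  rw [h, ← h1]
  rfl

theorem canonicalMap_tmul {m : ℕ} (P : TwistedPoly W) (Θ : E.X m) :
    E.canonicalMap m (P ⊗ₜ[R] Θ) = E.twistedAct P (E.toXInf m Θ) := rfl

/-- A twisted polynomial is the sum of its monomials. -/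
theorem _root_.TwistedPoly.exists_eq_sum (P : TwistedPoly W) : ∃ (s : ℕ) (c : ℕ → R),
    P = (∑ j ∈ range s, SkewPolynomial.monomial j (c j) : SkewPolynomial R) := by
  let Q : SkewPolynomial R := P
  refine ⟨Q.support.sup id + 1, Q.coeff, (SkewPolynomial.sum_monomial Q).symm.trans ?_⟩
  rw [SkewPolynomial.sum_def]
  refine sum_subset (fun j hj => mem_range.2 (Nat.lt_succ_of_le (le_sup (f := id) hj))) fun j _ hj => ?_
  rw [SkewPolynomial.notMem_support_iff.1 hj, map_zero]

theorem twistedAct_sum (s : ℕ) (c : ℕ → R) (y : E.XInf) :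
    E.twistedAct (∑ j ∈ range s, SkewPolynomial.monomial j (c j) : SkewPolynomial R) y =
      ∑ j ∈ range s, c j • E.frobXInf^[j] y := by
  induction s with
  | zero =>
    have h : E.twistedAct (0 : TwistedPoly W) = 0 := map_zero _
    exact DFunLike.congr_fun h y
  | succ s ih =>
    rw [sum_range_succ, sum_range_succ, ← ih, ← twistedAct_monomial]
    have h := map_add E.twistedAct
      (∑ j ∈ range s, SkewPolynomial.monomial j (c j) : SkewPolynomial R)
      (SkewPolynomial.monomial s (c s) : SkewPolynomial R)
    exact DFunLike.congr_fun h y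

variable [W.IsUniformized]
  {t : A} (ht : algebraMap A R t = W.ϖ) (ϑ : (E.N 1).HomGa) (hϑ : E.IsNormalized ϑ)

theorem bijective_canonicalMap {m : ℕ} (hm0 : 0 < m) (hsub : Subsingleton (E.X (m - 1))) {Θ : E.X m}
    (hΘ : E.coordX ht ϑ hϑ m Θ (m - 1) = 1) (hspan : ∀ Θ' : E.X m, ∃ r : R, Θ' = r • Θ) :
    Function.Bijective (E.canonicalMap m) := by
  have htmul : ∀ z : TensorProduct R (TwistedPoly W) (E.X m), ∃ P : TwistedPoly W, z = P ⊗ₜ[R] Θ := by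
    intro z
    induction z with
    | zero => exact ⟨0, (TensorProduct.zero_tmul _ _).symm⟩
    | tmul P Θ' =>
      obtain ⟨r, rfl⟩ := hspan Θ'
      exact ⟨r • P, (TensorProduct.smul_tmul _ _ _).symm⟩
    | add z z' hz hz' =>
      obtain ⟨P, rfl⟩ := hz
      obtain ⟨P', rfl⟩ := hz'
      exact ⟨P + P', (TensorProduct.add_tmul _ _ _).symm⟩
  constructor
  · rw [injective_iff_map_eq_zero]
    intro z hz
    obtain ⟨P, rfl⟩ := htmul z
    obtain ⟨s, c, hP⟩ := P.exists_eq_sum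
    rw [canonicalMap_tmul, hP, twistedAct_sum] at hz
    have h := E.eq_zero_of_sum_eq_zero ht ϑ hϑ hm0 hΘ s c hz
    have h1 : P = 0 :=
      hP.trans (sum_eq_zero fun j hj => by rw [h j (mem_range.1 hj), map_zero]; rfl)
    rw [h1, TensorProduct.zero_tmul]
  · intro y
    obtain ⟨N, hN⟩ := E.exists_coordInf_eq_zero ht ϑ hϑ y
    obtain ⟨c, rfl⟩ := E.exists_eq_sum ht ϑ hϑ hm0 hsub hΘ N y fun l hl => hN l (by omega)
    exact ⟨_, (E.canonicalMap_tmul _ Θ).trans (E.twistedAct_sum N c _)⟩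

end Twisted

/-! ### Drinfeld modules -/

/-- The action of a nonzero element on a Drinfeld module does not vanish modulo `ϖ`, since its kernel is
finite and the affine line is not. -/
theorem IsDrinfeld.exists_not_dvd_coef [W.IsUniformized] {E : AdmissibleModule A W} {abs : A → ℕ} {r : ℕ}
    (hE : E.IsDrinfeld abs r) {a : A} (ha : a ≠ 0) : ∃ s, ¬ W.ϖ ∣ E.coef a s := by
  by_contra! h
  obtain ⟨C, _, _, x, -, hfin, -, hC⟩ := hE a ha
  have hϖ : (NilAlg.poly W 1).str W.ϖ = 0 := by
    change Polynomial.C (Ideal.Quotient.mk (Ideal.span {W.ϖ ^ 1}) W.ϖ) = 0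
    rw [pow_one, Ideal.Quotient.mk_singleton_self, map_zero]
  have h0 : E.act (NilAlg.poly W 1) a (Polynomial.X : Polynomial (R ⧸ Ideal.span {W.ϖ ^ 1})) = 0 := by
    rw [(E.hasCoef_act a).eq_sum _ _ 0 (fun j _ => by
      obtain ⟨c, hc⟩ := h j
      rw [hc, map_mul, hϖ, zero_mul]), range_zero, sum_empty]
  obtain ⟨g, hg, hgx⟩ := (hC (NilAlg.poly W 1)).surjOn h0
  -- The coordinate of the affine line over `R / ϖ` would be integral over `R`.
  obtain ⟨P, hP, hPx⟩ := Algebra.IsIntegral.isIntegral (R := R) x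
  have h1 := congrArg g hPx
  rw [Polynomial.hom_eval₂, hg, map_zero] at h1
  have hgx' : g x = (Polynomial.X : Polynomial (R ⧸ Ideal.span {W.ϖ ^ 1})) := hgx
  rw [hgx'] at h1
  have h2 : P.map (Ideal.Quotient.mk (Ideal.span {W.ϖ ^ 1})) = 0 := by
    rw [← Polynomial.eval₂_C_X (p := P.map _), Polynomial.eval₂_map]
    exact h1
  have : Nontrivial (R ⧸ Ideal.span {W.ϖ ^ 1}) := by
    refine Ideal.Quotient.nontrivial_iff.2 fun htop => IsUniformized.not_isUnit (W := W) ?_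
    rw [pow_one] at htop
    exact Ideal.span_singleton_eq_top.1 htop
  exact (hP.map _).ne_zero h2

end AdmissibleModule

/-! ### The base -/

theorem FrobeniusBase.isUniformized {A : Type v} [CommRing A] {𝔭 : Ideal A} {R : Type u} [CommRing R]
    [IsDomain R] [IsDiscreteValuationRing R] [Algebra A R] (S : FrobeniusBase 𝔭 R)
    (k : Type v) [Field k] [Finite k] [Algebra k A] [𝔭.IsMaximal] : (S.witt k).IsUniformized := by
  have hmem : ∀ x : R, x ∈ IsLocalRing.maximalIdeal R ↔ (S.witt k).ϖ ∣ x := fun x => by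
    rw [S.maximalIdeal_eq, Ideal.mem_span_singleton]; rfl
  have hpow : ∀ n : ℕ, (IsLocalRing.maximalIdeal R ^ n • ⊤ : Ideal R) =
      Ideal.span {(S.witt k).ϖ ^ n} := fun n => by
    rw [smul_eq_mul, Ideal.mul_top, S.maximalIdeal_eq, Ideal.span_singleton_pow]; rfl
  have := S.complete
  refine ⟨fun x => ?_, fun h => ?_, fun x hx => ?_, fun x hx => ?_⟩
  · rw [← hmem, IsLocalRing.mem_maximalIdeal, mem_nonunits_iff]
    exact em _
  · exact (hmem _).2 dvd_rfl h
  · refine IsHausdorff.haus (I := IsLocalRing.maximalIdeal R) inferInstance x fun n => ?_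
    rw [SModEq.zero, hpow, Ideal.mem_span_singleton]
    exact hx n
  · obtain ⟨l, hl⟩ := IsPrecomplete.prec (I := IsLocalRing.maximalIdeal R) inferInstance
      (f := x) fun {m n} hmn => by
        rw [SModEq.sub_mem, hpow, Ideal.mem_span_singleton]
        induction n, hmn using Nat.le_induction with
        | base => rw [sub_self]; exact dvd_zero _
        | succ n hmn ih =>
          have := dvd_sub ih ((pow_dvd_pow _ hmn).trans (hx n))
          rwa [sub_sub, add_sub_cancel] at this
    refine ⟨l, fun n => ?_⟩
    have := hl n
    rw [SModEq.sub_mem, hpow, Ideal.mem_span_singleton] at this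
    rwa [dvd_sub_comm]

theorem theorem1p1 {k : Type v} [Field k] [Finite k] (C : PointedCurve k) [Nontrivial C.A]
    (𝔭 : Ideal C.A) [𝔭.IsMaximal]
    {R : Type u} [CommRing R] [IsDomain R] [IsDiscreteValuationRing R] [Algebra C.A R]
    (S : FrobeniusBase 𝔭 R) (E : AdmissibleModule C.A (S.witt k)) (r : ℕ) (hE : E.IsDrinfeld C.abs r)
    (m : ℕ) (hm : E.SplitsAt m) :
    (∃! ϑ : (E.N 1).HomGa, E.IsNormalized ϑ) ∧
    ∀ ϑ : (E.N 1).HomGa, E.IsNormalized ϑ →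
      (∃! Θ : E.X m, E.IsTheta ϑ m Θ) ∧
      ∀ Θ : E.X m, E.IsTheta ϑ m Θ →
        (∃ b : Module.Basis Unit R (E.X m), b () = Θ) ∧
        Function.Bijective (E.canonicalMap m) ∧
        (∀ d : ℕ, ∃ b : Module.Basis (Fin (d + 1)) R (E.X (m + d)), ∀ j : Fin (d + 1),
          b j = E.uX (Nat.add_le_add_left (Nat.le_of_lt_succ j.2) m) (E.frobXIter m j Θ)) ∧
        (∀ n : ℕ, ∀ h : m ≤ n, Function.Bijective
          ((LinearMap.range (E.uN ((Nat.sub_le m 1).trans h))).mkQ.comp (E.iX n))) := by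
  have := S.isUniformized k
  have ht : algebraMap C.A R S.t = (S.witt k).ϖ := rfl
  have hT : ∃ s, ¬ (S.witt k).ϖ ∣ E.coef S.t s := hE.exists_not_dvd_coef fun h0 =>
    S.t_notMem (by rw [h0]; exact Ideal.zero_mem _)
  refine ⟨E.existsUnique_isNormalized ht, fun ϑ hϑ => ?_⟩
  obtain ⟨hm0, Θ₀, hΘ₀⟩ := E.exists_coordX_eq_one ht ϑ hϑ hT hm
  have hsub : Subsingleton (E.X (m - 1)) := hm.2 _ (by omega)
  refine ⟨⟨Θ₀, (E.isTheta_iff ht ϑ hϑ hm0 Θ₀).2 hΘ₀, fun Θ hΘ => ?_⟩, fun Θ hΘ => ?_⟩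
  · -- The coordinates of the difference are those of a character of order `m - 1`.
    replace hΘ := (E.isTheta_iff ht ϑ hϑ hm0 Θ).1 hΘ
    refine sub_eq_zero.1 (E.coordX_injective ht ϑ hϑ hT m ?_)
    have h : E.toXInf m (Θ - Θ₀) = 0 := E.eq_zero_of_coordInf_eq_zero ht ϑ hϑ hsub fun l hl => by
      rw [E.coordInf_toXInf, map_sub, Pi.sub_apply]
      rcases hl.eq_or_lt with rfl | hl
      · rw [hΘ, hΘ₀, sub_self]
      · rw [E.coordX_of_le _ _ _ (by omega), E.coordX_of_le _ _ _ (by omega), sub_self]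
    rw [← E.coordInf_toXInf, h, map_zero, map_zero]
  · rw [E.isTheta_iff ht ϑ hϑ hm0] at hΘ
    have hd := E.exists_basis_X ht ϑ hϑ hT hm0 hsub hΘ
    obtain ⟨b, hb⟩ := hd 0
    have hb' : b.reindex (Equiv.ofUnique (Fin 1) Unit) () = Θ := by
      rw [Module.Basis.reindex_apply]
      exact hb _
    refine ⟨⟨b.reindex (Equiv.ofUnique (Fin 1) Unit), hb'⟩,
      E.bijective_canonicalMap ht ϑ hϑ hm0 hsub hΘ fun Θ' => ?_, hd,
      fun n h => E.bijective_mkQ_comp_iX ht ϑ hϑ hm0 hsub hΘ _⟩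
    refine ⟨(b.reindex (Equiv.ofUnique (Fin 1) Unit)).repr Θ' (), ?_⟩
    have h := (b.reindex (Equiv.ofUnique (Fin 1) Unit)).sum_repr Θ'
    rw [Fintype.sum_unique] at h
    rw [← hb']
    exact h.symm
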